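/- All Hilbert spaces are finite-dimensional. Let Alice and Bob share a state $\tau_{AB_1}$ on $\mathcal H_A\otimes\mathcal H_{B_1}$ and, independently, Bob and Charlie a state $\tau_{B_2C}$ on $\mathcal H_{B_2}\otimes\mathcal H_C$, so that the global state is $\tau_{AB_1}\otimes\tau_{B_2C}$. Let $\mathscr B=(B^b)_{b=0}^3$ be a four-outcome measurement (POVM) of Bob on $\mathcal H_{B_1}\otimes\mathcal H_{B_2}$, and let Alice and Charlie each have two measurements with outcomes $\pm1$, denoted $A_0,A_1$ and $C_0,C_1$. Let $p_b$ be the probability of Bob's outcome $b$ and $\beta_b$ the value of $\mathrm{CHSH}_b$ in the statistics conditioned on $b$, where $$\mathrm{CHSH}_0=\langle A_0C_0\rangle+\langle A_0C_1\rangle+\langle A_1C_0\rangle-\langle A_1C_1\rangle,\quad \mathrm{CHSH}_1=\langle A_0C_0\rangle+\langle A_0C_1\rangle-\langle A_1C_0\rangle+\langle A_1C_1\rangle,$$ $\mathrm{CHSH}_2=-\mathrm{CHSH}_1$ and $\mathrm{CHSH}_3=-\mathrm{CHSH}_0$. Put $\beta_{\mathrm{ave}}=\sum_b p_b\beta_b$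 (outcomes with $p_b=0$ contribute $0$). Let $\Phi=(\Phi^b)_{b=0}^3$ be the Bell-state measurement on two qubits $\mathcal H_{B_1'}\otimes\mathcal H_{B_2'}$, i.e. the projectors onto $\frac{|00\rangle+|11\rangle}{\sqrt2},\frac{|00\rangle-|11\rangle}{\sqrt2},\frac{|01\rangle+|10\rangle}{\sqrt2},\frac{|01\rangle-|10\rangle}{\sqrt2}$ in this order, and let $$Q(\mathscr B,\Phi)=\frac14\max_{\Lambda_1,\Lambda_2}\sum_{b=0}^3\operatorname{Tr}\big[(\Lambda_1\otimes\Lambda_2)(B^b)\,\Phi^b\big],$$ the maximum (which is attained) being over completely positive unital maps $\Lambda_i:\mathcal L(\mathcal H_{B_i})\to\mathcal L(\mathcal H_{B_i'})$. Define $$x^*=\frac{16+14\sqrt2}{17},\quad g(x)=\frac12+\frac12\cdot\frac{x-x^*}{2\sqrt2-x^*},\quad s(\eta)=\frac{2}{\sqrt{1-\eta^2}},\quad t(\eta)=\frac{4}{\sqrt{1-\eta^2}}-\frac{4}{1+\eta},$$ and, for real $\beta$, with $q=g(\beta)$ and $\eta^*=2\sqrt{q(1-q)}$ (put $\eta^*=0$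 if $q(1-q)<0$), $$L(\beta)=\frac{1}{8(1+\eta^*)}\min_{\eta\in[0,\eta^*]}\big[4\,s(\eta)\,q-t(\eta)\big].$$ (If $\eta^*=1$, that is $q=\frac12$, the function in brackets equals $4/(1+\eta)$ for $\eta<1$ and is given its limit $2$ at $\eta=1$.) Then: 1. For every such scenario, the minimum in $L(\beta_{\mathrm{ave}})$ is attained and $Q(\mathscr B,\Phi)\ge L(\beta_{\mathrm{ave}})$. 2. The separable threshold of $\Phi$ is $\frac12$: the maximum of $\frac14\sum_b\operatorname{Tr}(F^b\Phi^b)$ over all four-outcome measurements $(F^b)$ on two qubits with all $F^b$ separable exists and equals $\frac12$. 3. There is $\beta_0\in(2.688,2.689)$, corresponding to a noise level $1-\beta_0/(2\sqrt2)$ between $4.9\%$ and $5\%$, such that for $\beta\in[2,2\sqrt2]$ one has $L(\beta)>\frac12$ if and only if $\beta>\beta_0$. Whenever $\beta_{\mathrm{ave}}>\beta_0$, we have $Q(\mathscr B,\Phi)>\frac12$ and at least one of Bob's operators $B^b$ is entangled (not separable with respect to $\mathcal H_{B_1}\otimes\mathcal H_{B_2}$). -/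

import Mathlib

open scoped Matrix Kronecker ComplexOrder

noncomputable section

namespace EntSwap

/-! Finite-dimensional Hilbert spaces are represented by `ℂ^n` for a finite index type `n`, operators
on them by matrices, and the tensor product of spaces by the product of the index types. -/

/-- Density operators. -/
def IsState {n : Type*} [Fintype n] (ρ : Matrix n n ℂ) : Prop :=
  ρ.PosSemidef ∧ ρ.trace = 1

/-- Measurements (POVMs) with outcome set `Fin d`. -/
def IsMeasurement {n : Type*} [Fintype n] [DecidableEq n] {d : ℕ}
    (F : Fin d → Matrix n n ℂ) : Prop :=
  (∀ j, (F j).PosSemidef) ∧ ∑ j, F j = 1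

/-! ### Completely positive unital maps and the quality of a simulation -/

section Maps

variable {m n m' n' : Type*} [Fintype m] [DecidableEq m] [Fintype n] [DecidableEq n]
  [Fintype m'] [DecidableEq m'] [Fintype n'] [DecidableEq n']

/-- The amplification `id ⊗ Λ` on block matrices: `Λ` is applied to every block. -/
def amplify (k : ℕ) (Λ : Matrix n n ℂ →ₗ[ℂ] Matrix n' n' ℂ)
    (X : Matrix (Fin k × n) (Fin k × n) ℂ) : Matrix (Fin k × n') (Fin k × n') ℂ :=
  Matrix.of fun p q => Λ (Matrix.of fun i j => X (p.1, i) (q.1, j)) p.2 q.2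

/-- Complete positivity: every amplification `id_k ⊗ Λ` preserves positive semidefiniteness. -/
def IsCompletelyPositive (Λ : Matrix n n ℂ →ₗ[ℂ] Matrix n' n' ℂ) : Prop :=
  ∀ (k : ℕ) (X : Matrix (Fin k × n) (Fin k × n) ℂ), X.PosSemidef → (amplify k Λ X).PosSemidef

/-- Completely positive unital maps. -/
def IsCPU (Λ : Matrix n n ℂ →ₗ[ℂ] Matrix n' n' ℂ) : Prop :=
  IsCompletelyPositive Λ ∧ Λ 1 = 1

/-- The tensor product `Λ₁ ⊗ Λ₂` of two linear maps, on operators on the tensor product space,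
expanded in matrix units. -/
def mapTensor (Λ₁ : Matrix m m ℂ →ₗ[ℂ] Matrix m' m' ℂ) (Λ₂ : Matrix n n ℂ →ₗ[ℂ] Matrix n' n' ℂ)
    (X : Matrix (m × n) (m × n) ℂ) : Matrix (m' × n') (m' × n') ℂ :=
  ∑ i, ∑ j, X i j • (Λ₁ (Matrix.single i.1 j.1 1) ⊗ₖ Λ₂ (Matrix.single i.2 j.2 1))

/-- `Λ₁ ⊗ Λ₂` sends `Y ⊗ Z` to `Λ₁ Y ⊗ Λ₂ Z`. -/
theorem mapTensor_kronecker (Λ₁ : Matrix m m ℂ →ₗ[ℂ] Matrix m' m' ℂ)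
    (Λ₂ : Matrix n n ℂ →ₗ[ℂ] Matrix n' n' ℂ) (Y : Matrix m m ℂ) (Z : Matrix n n ℂ) :
    mapTensor Λ₁ Λ₂ (Y ⊗ₖ Z) = Λ₁ Y ⊗ₖ Λ₂ Z := by
  have expand : Λ₁ Y = ∑ i, ∑ j, Y i j • Λ₁ (Matrix.single i j 1) := by
    conv_lhs => rw [Matrix.matrix_eq_sum_single Y]
    simp only [map_sum]
    refine Finset.sum_congr rfl fun i _ => Finset.sum_congr rfl fun j _ => ?_
    rw [← map_smul, Matrix.smul_single, smul_eq_mul, mul_one]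
  have expand' : Λ₂ Z = ∑ i, ∑ j, Z i j • Λ₂ (Matrix.single i j 1) := by
    conv_lhs => rw [Matrix.matrix_eq_sum_single Z]
    simp only [map_sum]
    refine Finset.sum_congr rfl fun i _ => Finset.sum_congr rfl fun j _ => ?_
    rw [← map_smul, Matrix.smul_single, smul_eq_mul, mul_one]
  rw [expand, expand']
  ext p q
  simp only [mapTensor, Fintype.sum_prod_type, Matrix.kroneckerMap_apply, Matrix.sum_apply,
    Matrix.smul_apply, smul_eq_mul, Finset.sum_mul_sum]
  refine Finset.sum_congr rfl fun i _ => Finset.sum_congr rfl fun k _ => ?_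
  refine Finset.sum_congr rfl fun j _ => Finset.sum_congr rfl fun l _ => ?_
  ring

/-- The Hilbert-Schmidt inner product `⟨X, Y⟩ = Tr (X† Y)` (real on Hermitian operators). -/
def hsInner (X Y : Matrix n n ℂ) : ℝ := (Xᴴ * Y).trace.re

/-- The values `(1 / (|B₁'| |B₂'|)) ∑ j, ⟨(Λ₁ ⊗ Λ₂)(F j), P j⟩` over all pairs of completely positive
unital maps `Λ₁ : L(B₁) → L(B₁')`, `Λ₂ : L(B₂) → L(B₂')`. -/
def simulationValues {d : ℕ} (F : Fin d → Matrix (m × n) (m × n) ℂ)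
    (P : Fin d → Matrix (m' × n') (m' × n') ℂ) : Set ℝ :=
  {v | ∃ (Λ₁ : Matrix m m ℂ →ₗ[ℂ] Matrix m' m' ℂ) (Λ₂ : Matrix n n ℂ →ₗ[ℂ] Matrix n' n' ℂ),
    IsCPU Λ₁ ∧ IsCPU Λ₂ ∧
      v = 1 / ((Fintype.card m' : ℝ) * Fintype.card n') *
        ∑ j, hsInner (mapTensor Λ₁ Λ₂ (F j)) (P j)}

/-- The quality `Q(F, P)` of the measurement `F` as a simulation of `P`: the largest of these
values. -/
def quality {d : ℕ} (F : Fin d → Matrix (m × n) (m × n) ℂ)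
    (P : Fin d → Matrix (m' × n') (m' × n') ℂ) : ℝ :=
  sSup (simulationValues F P)

/-- Separable positive operators: finite sums of tensor products of positive operators. -/
def IsSeparableOp (X : Matrix (m × n) (m × n) ℂ) : Prop :=
  ∃ (N : ℕ) (Y : Fin N → Matrix m m ℂ) (Z : Fin N → Matrix n n ℂ),
    (∀ k, (Y k).PosSemidef) ∧ (∀ k, (Z k).PosSemidef) ∧ X = ∑ k, Y k ⊗ₖ Z k

/-- The values `(1 / (|B₁'| |B₂'|)) ∑ j, ⟨F j, P j⟩` over all separable measurements `F` on
`B₁' ⊗ B₂'`; their maximum is the separable threshold of `P`. -/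
def separableValues {d : ℕ} (P : Fin d → Matrix (m' × n') (m' × n') ℂ) : Set ℝ :=
  {v | ∃ F : Fin d → Matrix (m' × n') (m' × n') ℂ,
    IsMeasurement F ∧ (∀ j, IsSeparableOp (F j)) ∧
      v = 1 / ((Fintype.card m' : ℝ) * Fintype.card n') * ∑ j, hsInner (F j) (P j)}

end Maps

/-! ### The Bell-state measurement -/

/-- The computational basis vector `|i j⟩` of two qubits. -/
def ket (i j : Fin 2) : Fin 2 × Fin 2 → ℂ := Pi.single (i, j) 1

/-- The Bell vectors `φ⁺, φ⁻, ψ⁺, ψ⁻`, in this order. -/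
def bellVec : Fin 4 → (Fin 2 × Fin 2 → ℂ) :=
  ![((1 / √2 : ℝ) : ℂ) • (ket 0 0 + ket 1 1), ((1 / √2 : ℝ) : ℂ) • (ket 0 0 - ket 1 1),
    ((1 / √2 : ℝ) : ℂ) • (ket 0 1 + ket 1 0), ((1 / √2 : ℝ) : ℂ) • (ket 0 1 - ket 1 0)]

/-- The Bell-state measurement: the projectors onto the Bell vectors. -/
def bellMeasurement (b : Fin 4) : Matrix (Fin 2 × Fin 2) (Fin 2 × Fin 2) ℂ :=
  Matrix.vecMulVec (bellVec b) (star (bellVec b))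

/-! ### The entanglement swapping scenario -/

/-- Two independent sources, one shared by Alice and Bob and one by Bob and Charlie; a four-outcome
measurement of Bob; for Alice and for Charlie two two-outcome measurements, where `alice x a` is
the operator of outcome `a` (standing for the value `(-1)^a`) for the setting `x`. -/
structure SwapScenario (A B₁ B₂ C : Type*) [Fintype A] [DecidableEq A] [Fintype B₁]
    [DecidableEq B₁] [Fintype B₂] [DecidableEq B₂] [Fintype C] [DecidableEq C] where
  stateAB : Matrix (A × B₁) (A × B₁) ℂ
  stateBC : Matrix (B₂ × C) (B₂ × C) ℂ
  bob : Fin 4 → Matrix (B₁ × B₂) (B₁ × B₂) ℂ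
  alice : Fin 2 → Fin 2 → Matrix A A ℂ
  charlie : Fin 2 → Fin 2 → Matrix C C ℂ
  isState_stateAB : IsState stateAB
  isState_stateBC : IsState stateBC
  isMeasurement_bob : IsMeasurement bob
  isMeasurement_alice : ∀ x, IsMeasurement (alice x)
  isMeasurement_charlie : ∀ z, IsMeasurement (charlie z)

section Scenario

variable {A B₁ B₂ C : Type*} [Fintype A] [DecidableEq A] [Fintype B₁]
    [DecidableEq B₁] [Fintype B₂] [DecidableEq B₂] [Fintype C] [DecidableEq C]

/-- The operator `1_A ⊗ F ⊗ 1_C` on `(A ⊗ B₁) ⊗ (B₂ ⊗ C)`, for `F` on `B₁ ⊗ B₂`. -/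
def bobOp (F : Matrix (B₁ × B₂) (B₁ × B₂) ℂ) :
    Matrix ((A × B₁) × (B₂ × C)) ((A × B₁) × (B₂ × C)) ℂ :=
  Matrix.of fun p q =>
    (1 : Matrix A A ℂ) p.1.1 q.1.1 * F (p.1.2, p.2.1) (q.1.2, q.2.1) *
      (1 : Matrix C C ℂ) p.2.2 q.2.2

/-- The partial trace over Bob's systems `B₁` and `B₂`. -/
def traceBob (X : Matrix ((A × B₁) × (B₂ × C)) ((A × B₁) × (B₂ × C)) ℂ) :
    Matrix (A × C) (A × C) ℂ :=
  Matrix.of fun p q => ∑ b₁, ∑ b₂, X ((p.1, b₁), (b₂, p.2)) ((q.1, b₁), (b₂, q.2))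

namespace SwapScenario

/-- The probability `p_b` of Bob's outcome `b`. -/
def prob (S : SwapScenario A B₁ B₂ C) (b : Fin 4) : ℝ :=
  (bobOp (S.bob b) * (S.stateAB ⊗ₖ S.stateBC)).trace.re

/-- The normalized state of Alice and Charlie conditioned on Bob's outcome `b` (meaningful if
`p_b ≠ 0`). -/
def condState (S : SwapScenario A B₁ B₂ C) (b : Fin 4) : Matrix (A × C) (A × C) ℂ :=
  ((S.prob b : ℂ))⁻¹ • traceBob (bobOp (S.bob b) * (S.stateAB ⊗ₖ S.stateBC))

/-- The probability that Alice and Charlie obtain `a` and `c` for the settings `x` and `z`,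
conditioned on Bob's outcome `b`. -/
def condProb (S : SwapScenario A B₁ B₂ C) (b : Fin 4) (x z a c : Fin 2) : ℝ :=
  ((S.alice x a ⊗ₖ S.charlie z c) * S.condState b).trace.re

/-- The correlator `⟨A_x C_z⟩` conditioned on Bob's outcome `b`. -/
def corr (S : SwapScenario A B₁ B₂ C) (b : Fin 4) (x z : Fin 2) : ℝ :=
  ∑ a : Fin 2, ∑ c : Fin 2, (-1 : ℝ) ^ ((a : ℕ) + (c : ℕ)) * S.condProb b x z a c

/-- The violation `β_b`: the value of `CHSH_b` conditioned on Bob's outcome `b`. -/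
def chsh (S : SwapScenario A B₁ B₂ C) (b : Fin 4) : ℝ :=
  ![S.corr b 0 0 + S.corr b 0 1 + S.corr b 1 0 - S.corr b 1 1,
    S.corr b 0 0 + S.corr b 0 1 - S.corr b 1 0 + S.corr b 1 1,
    -(S.corr b 0 0 + S.corr b 0 1 - S.corr b 1 0 + S.corr b 1 1),
    -(S.corr b 0 0 + S.corr b 0 1 + S.corr b 1 0 - S.corr b 1 1)] b

/-- The average violation `β_ave = ∑ b, p_b β_b`. -/
def avgCHSH (S : SwapScenario A B₁ B₂ C) : ℝ := ∑ b, S.prob b * S.chsh b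

end SwapScenario

end Scenario

/-! ### The explicit bound -/

/-- `x* = (16 + 14 √2) / 17`. -/
def xStar : ℝ := (16 + 14 * √2) / 17

/-- The linear bound on the extraction fidelity in terms of the CHSH value `x`. -/
def g (x : ℝ) : ℝ := 1 / 2 + 1 / 2 * ((x - xStar) / (2 * √2 - xStar))

/-- `η* = 2 √(q (1 - q))`. -/
def etaStar (q : ℝ) : ℝ := 2 * √(q * (1 - q))

/-- `s(η) = 2 / √(1 - η²)`. -/
def s (η : ℝ) : ℝ := 2 / √(1 - η ^ 2)

/-- `t(η) = 4 / √(1 - η²) - 4 / (1 + η)`. -/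
def t (η : ℝ) : ℝ := 4 / √(1 - η ^ 2) - 4 / (1 + η)

/-- The values `4 s(η) q - t(η)` for `η ∈ [0, η*]`. -/
def boundValues (q : ℝ) : Set ℝ := (fun η => 4 * s η * q - t η) '' Set.Icc 0 (etaStar q)

/-- The lower bound on the quality, as a function of the average violation `β`. -/
def robustBound (β : ℝ) : ℝ := 1 / (8 * (1 + etaStar (g β))) * sInf (boundValues (g β))

end EntSwap

end

/-!
# Robust self-testing of the Bell-state measurement

Every completely positive unital map is given by a positive Choi matrix with partial trace `1`
(`isCPU_iff`), so the values of simulations form a compact set, and every pair of such Choi matrices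
bounds the quality from below (`le_quality`). With the transposed states of the two sources as Choi
matrices, the same contraction `link` with Bob's operator `B^b` yields the transposed state that his
outcome prepares for Alice and Charlie. Hence the quality is bounded by extracting qubits from
these states and then turning the resulting states, shared by a qubit and one of Bob's systems, into
Choi matrices of unital maps.

*Extraction* (`exists_extraction`). Two contractive observables are compressions of direct sums of
pairs of qubit observables at angles `φ ∓ a` with `0 ≤ a ≤ π / 2` (`exists_qubit_decomposition`).
For qubits, each party dephases towards the axis that is closest to its two observables. The Bell
projectors, dephased on both sides, dominate `slope * CHSH_b + intercept`
(`posSemidef_dephased_sub`): in the Bell basis the difference splits into two `2 × 2` blocks, whose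
determinants are bounded below by polynomials in the two contraction factors, and these are
nonnegative on the unit square by their Bernstein coefficients (`bernstein_plus`,
`bernstein_minus`). Averaged over Bob's outcomes, the extracted qubits have an overlap `q ≥ g β_ave`
with the Bell states (`SwapScenario.exists_extracted`).

*Simulation* (`le_quality_of_extracted`). If `q > 1 / 2`, both extracted qubits are nearly maximally
mixed: their Bloch vectors have length at most `η* = 2 √(q (1 - q))` (`le_etaStar`), because
`Φ^b + k Z` has the largest eigenvalue `1 / 2 + √(1 / 4 + k ^ 2)` for every direction `Z` of either
qubit. Filtering one qubit makes its marginal proportional to `1`, at a cost measured by `s` and `t`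
(`posSemidef_filter_sub`); rescaling and adding noise does so for the other one, at the cost of a
factor `1 / (1 + η*)`. If `q ≤ 1 / 2`, the bound is at most `1 / 4`, the quality of discarding the
measured systems.

*Thresholds.* A Bell state has overlap at most `1 / 2` with a product state, and local maps preserve
separability, so a quality above `1 / 2` requires an entangled operator. Where `g β > 1 / 2`, the
condition `robustBound β ≤ 1 / 2` cuts out a closed initial segment (`exists_threshold`), and its
end point is located by evaluation at one rational point and tangent line bounds at another.
-/

set_option linter.unusedSectionVars false

noncomputable section

namespace EntSwap

/-! ### Choi matrices of maps and of tensor products of maps -/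

section Choi

variable {m n m' n' k l : Type*} [Fintype m] [Fintype n] [Fintype m'] [Fintype n'] [Fintype k]
  [Fintype l]

/-- Summing over all entries of a block of a positive semidefinite matrix, block by block, leaves a
positive semidefinite matrix. -/
theorem posSemidef_blockSum {K : Matrix (m × n) (m × n) ℂ} (hK : K.PosSemidef) :
    (Matrix.of fun p q => ∑ i, ∑ j, K (p, i) (q, j)).PosSemidef := by
  classical
  have := hK.conjTranspose_mul_mul_same
    (Matrix.of fun (x : m × n) (q : m) => if x.1 = q then (1 : ℂ) else 0)
  convert this using 1
  ext p q
  have key (f : m × n → ℂ) (q : m) : ∑ y, (if y.1 = q then f y else 0) = ∑ j, f (q, j) := by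
    rw [Fintype.sum_prod_type_right]
    simp
  simp only [Matrix.mul_apply, Matrix.conjTranspose_apply, Matrix.of_apply, apply_ite star,
    star_one, star_zero, ite_mul, mul_ite, one_mul, mul_one, zero_mul, mul_zero, key]
  exact Finset.sum_comm

/-- The linear map `L(ℂ^n) → L(ℂ^n')` with Choi matrix `J`, whose block `(·, i) (·, j)` is the image
of the matrix unit `|i⟩⟨j|`. The output system is the first factor of the index of `J`. -/
def choiMap (J : Matrix (n' × n) (n' × n) ℂ) : Matrix n n ℂ →ₗ[ℂ] Matrix n' n' ℂ where
  toFun F := Matrix.of fun p q => ∑ i, ∑ j, F i j * J (p, i) (q, j)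
  map_add' F G := by
    ext p q
    simp [add_mul, Finset.sum_add_distrib]
  map_smul' c F := by
    ext p q
    simp [Finset.mul_sum, mul_assoc]

theorem choiMap_apply (J : Matrix (n' × n) (n' × n) ℂ) (F : Matrix n n ℂ) (p q : n') :
    choiMap J F p q = ∑ i, ∑ j, F i j * J (p, i) (q, j) := rfl

/-- The partial trace over the second factor. -/
def marginal (J : Matrix (n' × n) (n' × n) ℂ) : Matrix n' n' ℂ :=
  Matrix.of fun p q => ∑ i, J (p, i) (q, i)

theorem marginal_apply (J : Matrix (n' × n) (n' × n) ℂ) (p q : n') :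
    marginal J p q = ∑ i, J (p, i) (q, i) := rfl

theorem choiMap_one [DecidableEq n] (J : Matrix (n' × n) (n' × n) ℂ) :
    choiMap J 1 = marginal J := by
  ext p q
  simp [choiMap_apply, marginal_apply, Matrix.one_apply]

theorem trace_marginal (J : Matrix (n' × n) (n' × n) ℂ) : (marginal J).trace = J.trace := by
  simp [Matrix.trace, marginal_apply, Fintype.sum_prod_type]

theorem isCompletelyPositive_choiMap {J : Matrix (n' × n) (n' × n) ℂ} (hJ : J.PosSemidef) :
    IsCompletelyPositive (choiMap J) := by
  intro k X hX
  have h := posSemidef_blockSum (m := Fin k × n') (n := n) ((hX.kronecker hJ).submatrix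
    fun x : (Fin k × n') × n => ((x.1.1, x.2), (x.1.2, x.2)))
  convert h using 1
  ext p q
  simp only [amplify, choiMap_apply, Matrix.of_apply, Matrix.submatrix_apply,
    Matrix.kroneckerMap_apply]

theorem isCPU_choiMap [DecidableEq n] [DecidableEq n'] {J : Matrix (n' × n) (n' × n) ℂ}
    (hJ : J.PosSemidef) (h1 : marginal J = 1) : IsCPU (choiMap J) :=
  ⟨isCompletelyPositive_choiMap hJ, by rw [choiMap_one, h1]⟩

/-- Positivity of completely positive maps. -/
theorem IsCompletelyPositive.posSemidef_apply {Λ : Matrix n n ℂ →ₗ[ℂ] Matrix n' n' ℂ}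
    (hΛ : IsCompletelyPositive Λ) {X : Matrix n n ℂ} (hX : X.PosSemidef) : (Λ X).PosSemidef := by
  have h := (hΛ 1 (X.submatrix Prod.snd Prod.snd) (hX.submatrix _)).submatrix
    (fun i : n' => ((0 : Fin 1), i))
  exact h

/-- The operator obtained by feeding the two halves of an operator `F` into the maps with Choi
matrices `J₁` and `J₂`. If these are transposed bipartite states, it is the transpose of the
subnormalized state that the outcome `F` of a joint measurement prepares on the other halves: one
expression covers both simulations and entanglement swapping. -/
def link (J₁ : Matrix (m' × m) (m' × m) ℂ) (J₂ : Matrix (n' × n) (n' × n) ℂ)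
    (F : Matrix (m × n) (m × n) ℂ) : Matrix (m' × n') (m' × n') ℂ :=
  Matrix.of fun p q => ∑ i, ∑ j, F i j * (J₁ (p.1, i.1) (q.1, j.1) * J₂ (p.2, i.2) (q.2, j.2))

theorem link_apply (J₁ : Matrix (m' × m) (m' × m) ℂ) (J₂ : Matrix (n' × n) (n' × n) ℂ)
    (F : Matrix (m × n) (m × n) ℂ) (p q : m' × n') : link J₁ J₂ F p q =
      ∑ i, ∑ j, F i j * (J₁ (p.1, i.1) (q.1, j.1) * J₂ (p.2, i.2) (q.2, j.2)) := rfl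

theorem choiMap_single [DecidableEq n] (J : Matrix (n' × n) (n' × n) ℂ) (i j : n) (p q : n') :
    choiMap J (Matrix.single i j 1) p q = J (p, i) (q, j) := by
  rw [choiMap_apply, Finset.sum_eq_single i, Finset.sum_eq_single j]
  · simp
  · intro b _ hb
    simp [hb.symm]
  · simp
  · intro b _ hb
    simp [hb.symm]
  · simp

theorem mapTensor_choiMap [DecidableEq m] [DecidableEq n] [DecidableEq m'] [DecidableEq n']
    (J₁ : Matrix (m' × m) (m' × m) ℂ) (J₂ : Matrix (n' × n) (n' × n) ℂ)
    (F : Matrix (m × n) (m × n) ℂ) :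
    mapTensor (choiMap J₁) (choiMap J₂) F = link J₁ J₂ F := by
  ext p q
  simp only [mapTensor, Matrix.sum_apply, Matrix.smul_apply, Matrix.kroneckerMap_apply,
    choiMap_single, smul_eq_mul, link_apply]

theorem posSemidef_link {J₁ : Matrix (m' × m) (m' × m) ℂ} {J₂ : Matrix (n' × n) (n' × n) ℂ}
    {F : Matrix (m × n) (m × n) ℂ} (h₁ : J₁.PosSemidef) (h₂ : J₂.PosSemidef)
    (hF : F.PosSemidef) : (link J₁ J₂ F).PosSemidef := by
  have h := posSemidef_blockSum (m := m' × n') (n := m × n)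
    ((hF.kronecker (h₁.kronecker h₂)).submatrix
      fun x : (m' × n') × (m × n) => (x.2, ((x.1.1, x.2.1), (x.1.2, x.2.2))))
  convert h using 1
  ext p q
  simp only [link_apply, Matrix.of_apply, Matrix.submatrix_apply, Matrix.kroneckerMap_apply]

theorem link_add_right (J₁ : Matrix (m' × m) (m' × m) ℂ) (J₂ J₃ : Matrix (n' × n) (n' × n) ℂ)
    (F : Matrix (m × n) (m × n) ℂ) : link J₁ (J₂ + J₃) F = link J₁ J₂ F + link J₁ J₃ F := by
  ext p q
  simp only [link_apply, Matrix.add_apply, mul_add, Finset.sum_add_distrib]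

theorem link_smul_right (c : ℝ) (J₁ : Matrix (m' × m) (m' × m) ℂ)
    (J₂ : Matrix (n' × n) (n' × n) ℂ)
    (F : Matrix (m × n) (m × n) ℂ) : link J₁ (c • J₂) F = c • link J₁ J₂ F := by
  ext p q
  simp only [link_apply, Matrix.smul_apply, Finset.smul_sum, mul_smul_comm]

theorem link_sum {ι : Type*} (t : Finset ι) (J₁ : Matrix (m' × m) (m' × m) ℂ)
    (J₂ : Matrix (n' × n) (n' × n) ℂ) (F : ι → Matrix (m × n) (m × n) ℂ) :
    link J₁ J₂ (∑ b ∈ t, F b) = ∑ b ∈ t, link J₁ J₂ (F b) := by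
  ext p q
  simp only [link_apply, Matrix.sum_apply, Finset.sum_mul]
  rw [Finset.sum_comm]
  simp_rw [Finset.sum_comm (s := t)]
  rw [Finset.sum_comm]

theorem link_one [DecidableEq m] [DecidableEq n] (J₁ : Matrix (m' × m) (m' × m) ℂ)
    (J₂ : Matrix (n' × n) (n' × n) ℂ) : link J₁ J₂ 1 = marginal J₁ ⊗ₖ marginal J₂ := by
  ext p q
  simp only [link_apply, Matrix.kroneckerMap_apply, marginal_apply, Finset.sum_mul_sum,
    Fintype.sum_prod_type (α₁ := m), Matrix.one_apply, ite_mul, one_mul, zero_mul, Prod.mk.injEq,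
    ite_and, Finset.sum_ite_eq, Finset.mem_univ, if_true, Finset.sum_ite_irrel,
    Finset.sum_const_zero]

theorem link_eq_sum (J₁ : Matrix (m' × m) (m' × m) ℂ) (J₂ : Matrix (n' × n) (n' × n) ℂ)
    (F : Matrix (m × n) (m × n) ℂ) : link J₁ J₂ F = ∑ i, ∑ j, F i j •
      (J₁.submatrix (·, i.1) (·, j.1) ⊗ₖ J₂.submatrix (·, i.2) (·, j.2)) := by
  ext p q
  simp only [link_apply, Matrix.sum_apply, Matrix.smul_apply, Matrix.kroneckerMap_apply,
    Matrix.submatrix_apply, smul_eq_mul]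

theorem submatrix_kronecker_one_conj [DecidableEq n] (L : Matrix k n' ℂ)
    (J : Matrix (n' × n) (n' × n) ℂ) (i j : n) :
    ((L ⊗ₖ (1 : Matrix n n ℂ)) * J * (L ⊗ₖ (1 : Matrix n n ℂ))ᴴ).submatrix (·, i) (·, j) =
      L * J.submatrix (·, i) (·, j) * Lᴴ := by
  ext p q
  simp only [Matrix.mul_apply, Matrix.submatrix_apply, Matrix.conjTranspose_apply,
    Matrix.kroneckerMap_apply, Matrix.one_apply, Fintype.sum_prod_type, mul_ite, mul_one, mul_zero,
    ite_mul, zero_mul, apply_ite star, star_zero, Finset.sum_ite_eq, Finset.mem_univ, if_true]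

/-- Local operators on the output systems pull out of a link. -/
theorem link_conj [DecidableEq m] [DecidableEq n] (L : Matrix k m' ℂ) (L' : Matrix l n' ℂ)
    (J₁ : Matrix (m' × m) (m' × m) ℂ)
    (J₂ : Matrix (n' × n) (n' × n) ℂ) (F : Matrix (m × n) (m × n) ℂ) :
    link ((L ⊗ₖ (1 : Matrix m m ℂ)) * J₁ * (L ⊗ₖ (1 : Matrix m m ℂ))ᴴ)
      ((L' ⊗ₖ (1 : Matrix n n ℂ)) * J₂ * (L' ⊗ₖ (1 : Matrix n n ℂ))ᴴ) F =
      (L ⊗ₖ L') * link J₁ J₂ F * (L ⊗ₖ L')ᴴ := by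
  rw [link_eq_sum, link_eq_sum]
  simp_rw [submatrix_kronecker_one_conj, Matrix.mul_kronecker_mul]
  rw [Matrix.conjTranspose_kronecker]
  simp only [Matrix.mul_sum, Matrix.sum_mul, Matrix.mul_smul, Matrix.smul_mul]

/-- The partial trace commutes with local operators on the remaining system. -/
theorem marginal_conj [DecidableEq n] (L : Matrix k n' ℂ) (J : Matrix (n' × n) (n' × n) ℂ) :
    marginal ((L ⊗ₖ (1 : Matrix n n ℂ)) * J * (L ⊗ₖ (1 : Matrix n n ℂ))ᴴ) =
      L * marginal J * Lᴴ := by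
  have h (J : Matrix (n' × n) (n' × n) ℂ) : marginal J = ∑ i, J.submatrix (·, i) (·, i) := by
    ext p q
    simp only [marginal_apply, Matrix.sum_apply, Matrix.submatrix_apply]
  have h' (J : Matrix (k × n) (k × n) ℂ) : marginal J = ∑ i, J.submatrix (·, i) (·, i) := by
    ext p q
    simp only [marginal_apply, Matrix.sum_apply, Matrix.submatrix_apply]
  simp only [h, h', submatrix_kronecker_one_conj, Matrix.mul_sum, Matrix.sum_mul]

theorem link_sum_sum {ι κ : Type*} [Fintype ι] [Fintype κ] (J₁ : ι → Matrix (m' × m) (m' × m) ℂ)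
    (J₂ : κ → Matrix (n' × n) (n' × n) ℂ) (F : Matrix (m × n) (m × n) ℂ) :
    link (∑ a, J₁ a) (∑ c, J₂ c) F = ∑ a, ∑ c, link (J₁ a) (J₂ c) F := by
  have hl (J : Matrix (n' × n) (n' × n) ℂ) :
      link (∑ a, J₁ a) J F = ∑ a, link (J₁ a) J F := by
    ext p q
    simp only [link_apply, Matrix.sum_apply, Finset.sum_mul, Finset.mul_sum]
    simp_rw [Finset.sum_comm (t := (Finset.univ : Finset ι))]
  have hr (J : Matrix (m' × m) (m' × m) ℂ) :
      link J (∑ c, J₂ c) F = ∑ c, link J (J₂ c) F := by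
    ext p q
    simp only [link_apply, Matrix.sum_apply, Finset.mul_sum]
    simp_rw [Finset.sum_comm (t := (Finset.univ : Finset κ))]
  simp only [hl, hr]

/-! ### Traces of products of positive operators -/

theorem exists_conjTranspose_mul_self [DecidableEq n] {X : Matrix n n ℂ} (hX : X.PosSemidef) :
    ∃ B : Matrix n n ℂ, X = Bᴴ * B := by
  open scoped MatrixOrder in
  exact CStarAlgebra.nonneg_iff_eq_star_mul_self.mp hX.nonneg

theorem re_trace_mul_nonneg {X Y : Matrix n n ℂ} (hX : X.PosSemidef) (hY : Y.PosSemidef) :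
    0 ≤ (X * Y).trace.re := by
  classical
  obtain ⟨B, rfl⟩ := exists_conjTranspose_mul_self hY
  rw [← Matrix.mul_assoc, Matrix.trace_mul_comm, ← Matrix.mul_assoc]
  exact (Complex.le_def.1 (hX.mul_mul_conjTranspose_same B).trace_nonneg).1

theorem re_trace_mul_le {X X' Y : Matrix n n ℂ} (hX : (X' - X).PosSemidef) (hY : Y.PosSemidef) :
    (X * Y).trace.re ≤ (X' * Y).trace.re := by
  have := re_trace_mul_nonneg hX hY
  rw [Matrix.sub_mul, Matrix.trace_sub, Complex.sub_re] at this
  linarith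

theorem hsInner_eq_of_isHermitian {X Y : Matrix n n ℂ} (hX : X.IsHermitian) :
    hsInner X Y = (Y * X).trace.re := by
  rw [hsInner, hX.eq, Matrix.trace_mul_comm]

end Choi

/-! ### Completely positive unital maps form a compact set -/

section Compact

variable {m n m' n' : Type*} [Fintype m] [DecidableEq m] [Fintype n] [DecidableEq n]
  [Fintype m'] [DecidableEq m'] [Fintype n'] [DecidableEq n']

theorem norm_apply_le_trace {X : Matrix n n ℂ} (hX : X.PosSemidef) (i j : n) :
    ‖X i j‖ ≤ X.trace.re := by
  obtain ⟨B, rfl⟩ := exists_conjTranspose_mul_self hX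
  have hd (i : n) : ((Bᴴ * B) i i).re = ∑ k, ‖B k i‖ ^ 2 := by
    simp only [Matrix.mul_apply, Matrix.conjTranspose_apply, Complex.re_sum]
    refine Finset.sum_congr rfl fun k _ => ?_
    rw [← Complex.normSq_eq_norm_sq, Complex.star_def, ← Complex.normSq_eq_conj_mul_self,
      Complex.ofReal_re]
  have ht : (Bᴴ * B).trace.re = ∑ i, ∑ k, ‖B k i‖ ^ 2 := by
    simp only [Matrix.trace, Matrix.diag_apply, Complex.re_sum, hd]
  have hle (i : n) : ∑ k, ‖B k i‖ ^ 2 ≤ (Bᴴ * B).trace.re := by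
    rw [ht]
    exact Finset.single_le_sum (f := fun i => ∑ k, ‖B k i‖ ^ 2)
      (fun i _ => Finset.sum_nonneg fun k _ => sq_nonneg _) (Finset.mem_univ i)
  have hij : ‖(Bᴴ * B) i j‖ ≤ ∑ k, (‖B k i‖ ^ 2 + ‖B k j‖ ^ 2) / 2 := by
    rw [Matrix.mul_apply]
    refine (norm_sum_le _ _).trans (Finset.sum_le_sum fun k _ => ?_)
    rw [Matrix.conjTranspose_apply, norm_mul, norm_star]
    nlinarith [sq_nonneg (‖B k i‖ - ‖B k j‖)]
  rw [← Finset.sum_div, Finset.sum_add_distrib] at hij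
  linarith [hle i, hle j]

/-- A linear map is completely positive and unital exactly if its Choi matrix is positive
semidefinite with partial trace `1`. -/
theorem isCPU_iff {Λ : Matrix n n ℂ →ₗ[ℂ] Matrix n' n' ℂ} :
    IsCPU Λ ↔ ∃ J : Matrix (n' × n) (n' × n) ℂ, J.PosSemidef ∧ marginal J = 1 ∧ Λ = choiMap J := by
  refine ⟨fun h => ?_, fun ⟨J, hJ, h1, hΛ⟩ => hΛ ▸ isCPU_choiMap hJ h1⟩
  have hΛ : Λ = choiMap (Matrix.of fun x y => Λ (Matrix.single x.2 y.2 1) x.1 y.1) := by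
    refine Matrix.ext_linearMap _ fun i j => LinearMap.ext_ring ?_
    ext p q
    simp [choiMap_single]
  refine ⟨Matrix.of fun x y => Λ (Matrix.single x.2 y.2 1) x.1 y.1, ?_, ?_, hΛ⟩
  · -- the Choi matrix is the image of a rank-one operator under an amplification of `Λ`
    let e := Fintype.equivFin n
    have hX := Matrix.posSemidef_vecMulVec_self_star
      (fun x : Fin (Fintype.card n) × n => if e.symm x.1 = x.2 then (1 : ℂ) else 0)
    have h2 := (h.1 _ _ hX).submatrix (fun x : n' × n => (e x.2, x.1))
    convert h2 using 1
    ext x y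
    simp only [Matrix.of_apply, Matrix.submatrix_apply, amplify]
    refine congrArg (fun M => Λ M x.1 y.1) ?_
    ext i j
    by_cases hi : x.2 = i <;> by_cases hj : y.2 = j <;>
      simp [Matrix.vecMulVec_apply, hi, hj]
  · rw [← choiMap_one, ← hΛ, h.2]

theorem isClosed_posSemidef : IsClosed {X : Matrix n n ℂ | X.PosSemidef} := by
  have : {X : Matrix n n ℂ | X.PosSemidef} = {X | X.IsHermitian} ∩
      ⋂ x : n → ℂ, {X | 0 ≤ star x ⬝ᵥ (X *ᵥ x)} := by
    ext X
    simp [Matrix.posSemidef_iff_dotProduct_mulVec]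
  rw [this]
  refine IsClosed.inter ?_ (isClosed_iInter fun x => ?_)
  · exact isClosed_eq (Continuous.matrix_conjTranspose continuous_id) continuous_id
  · exact isClosed_le continuous_const (by fun_prop)

theorem continuous_marginal : Continuous (marginal : Matrix (n' × n) (n' × n) ℂ → _) := by
  refine continuous_matrix fun i j => ?_
  simp only [marginal_apply]
  fun_prop

theorem norm_choi_apply_le {J : Matrix (n' × n) (n' × n) ℂ} (hJ : J.PosSemidef)
    (h1 : marginal J = 1) (x y : n' × n) : ‖J x y‖ ≤ Fintype.card n' := by
  refine (norm_apply_le_trace hJ x y).trans ?_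
  rw [← trace_marginal, h1, Matrix.trace_one]
  simp

theorem isCompact_choi :
    IsCompact {J : Matrix (n' × n) (n' × n) ℂ | J.PosSemidef ∧ marginal J = 1} := by
  have hb : IsCompact (Set.univ.pi fun _ => Set.univ.pi fun _ =>
      Metric.closedBall 0 (Fintype.card n') : Set (Matrix (n' × n) (n' × n) ℂ)) :=
    isCompact_univ_pi fun _ => isCompact_univ_pi fun _ => isCompact_closedBall _ _
  refine hb.of_isClosed_subset
    (isClosed_posSemidef.inter (isClosed_eq continuous_marginal continuous_const)) ?_
  rintro J ⟨hJ, h1⟩ x - y -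
  rw [mem_closedBall_zero_iff]
  exact norm_choi_apply_le hJ h1 x y

theorem simulationValues_eq {d : ℕ} (F : Fin d → Matrix (m × n) (m × n) ℂ)
    (P : Fin d → Matrix (m' × n') (m' × n') ℂ) :
    simulationValues F P =
      (fun J : Matrix (m' × m) (m' × m) ℂ × Matrix (n' × n) (n' × n) ℂ =>
        1 / ((Fintype.card m' : ℝ) * Fintype.card n') *
          ∑ j, hsInner (link J.1 J.2 (F j)) (P j)) ''
      ({J | J.PosSemidef ∧ marginal J = 1} ×ˢ {J | J.PosSemidef ∧ marginal J = 1}) := by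
  ext v
  constructor
  · rintro ⟨Λ₁, Λ₂, h₁, h₂, rfl⟩
    obtain ⟨J₁, hJ₁, hm₁, rfl⟩ := isCPU_iff.1 h₁
    obtain ⟨J₂, hJ₂, hm₂, rfl⟩ := isCPU_iff.1 h₂
    exact ⟨(J₁, J₂), ⟨⟨hJ₁, hm₁⟩, hJ₂, hm₂⟩, by simp only [mapTensor_choiMap]⟩
  · rintro ⟨⟨J₁, J₂⟩, ⟨⟨hJ₁, h₁⟩, hJ₂, h₂⟩, rfl⟩
    exact ⟨_, _, isCPU_choiMap hJ₁ h₁, isCPU_choiMap hJ₂ h₂, by simp only [mapTensor_choiMap]⟩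

theorem isCompact_simulationValues {d : ℕ} (F : Fin d → Matrix (m × n) (m × n) ℂ)
    (P : Fin d → Matrix (m' × n') (m' × n') ℂ) : IsCompact (simulationValues F P) := by
  rw [simulationValues_eq]
  refine (isCompact_choi.prod isCompact_choi).image ?_
  have h (j : Fin d) : Continuous fun J : Matrix (m' × m) (m' × m) ℂ ×
      Matrix (n' × n) (n' × n) ℂ => link J.1 J.2 (F j) := by
    refine continuous_matrix fun p q => ?_
    simp only [link_apply]
    fun_prop
  simp only [hsInner]
  refine continuous_const.mul (continuous_finsetSum _ fun j _ => Complex.continuous_re.comp ?_)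
  exact ((h j).matrix_conjTranspose.matrix_mul continuous_const).matrix_trace

theorem isGreatest_quality {d : ℕ} {F : Fin d → Matrix (m × n) (m × n) ℂ}
    {P : Fin d → Matrix (m' × n') (m' × n') ℂ} (h : (simulationValues F P).Nonempty) :
    IsGreatest (simulationValues F P) (quality F P) :=
  (isCompact_simulationValues F P).isGreatest_sSup h

/-- Positive Choi matrices with partial trace `1` bound the quality from below. -/
theorem le_quality {d : ℕ} (F : Fin d → Matrix (m × n) (m × n) ℂ)
    (P : Fin d → Matrix (m' × n') (m' × n') ℂ) {J₁ : Matrix (m' × m) (m' × m) ℂ}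
    {J₂ : Matrix (n' × n) (n' × n) ℂ} (hJ₁ : J₁.PosSemidef) (hJ₂ : J₂.PosSemidef)
    (h₁ : marginal J₁ = 1) (h₂ : marginal J₂ = 1) :
    1 / ((Fintype.card m' : ℝ) * Fintype.card n') * ∑ j, hsInner (link J₁ J₂ (F j)) (P j) ≤
      quality F P := by
  refine le_csSup (isCompact_simulationValues F P).bddAbove ?_
  rw [simulationValues_eq]
  exact ⟨(J₁, J₂), ⟨⟨hJ₁, h₁⟩, hJ₂, h₂⟩, rfl⟩

/-- Local completely positive unital maps turn separable measurements into separable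
measurements. -/
theorem simulationValues_subset_separableValues {d : ℕ}
    {F : Fin d → Matrix (m × n) (m × n) ℂ} (hF : IsMeasurement F)
    (hs : ∀ j, IsSeparableOp (F j)) (P : Fin d → Matrix (m' × n') (m' × n') ℂ) :
    simulationValues F P ⊆ separableValues P := by
  rintro v ⟨Λ₁, Λ₂, h₁, h₂, rfl⟩
  obtain ⟨J₁, hJ₁, hm₁, rfl⟩ := isCPU_iff.1 h₁
  obtain ⟨J₂, hJ₂, hm₂, rfl⟩ := isCPU_iff.1 h₂
  refine ⟨fun j => mapTensor (choiMap J₁) (choiMap J₂) (F j), ⟨fun j => ?_, ?_⟩, fun j => ?_, rfl⟩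
  · simp only [mapTensor_choiMap]
    exact posSemidef_link hJ₁ hJ₂ (hF.1 j)
  · simp only [mapTensor_choiMap]
    rw [← link_sum, hF.2, link_one, hm₁, hm₂, Matrix.one_kronecker_one]
  · obtain ⟨N, Y, Z, hY, hZ, h⟩ := hs j
    refine ⟨N, fun k => choiMap J₁ (Y k), fun k => choiMap J₂ (Z k),
      fun k => h₁.1.posSemidef_apply (hY k), fun k => h₂.1.posSemidef_apply (hZ k), ?_⟩
    simp only [h, mapTensor_choiMap, link_sum]
    simp only [← mapTensor_choiMap, mapTensor_kronecker]

end Compact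

/-! ### Bell states and the separable threshold -/

/-- The coefficient matrices of the Bell vectors, without the factor `1 / √2`. -/
def bellMat : Fin 4 → Matrix (Fin 2) (Fin 2) ℂ :=
  ![!![1, 0; 0, 1], !![1, 0; 0, -1], !![0, 1; 1, 0], !![0, 1; -1, 0]]

theorem bellMeasurement_apply (b : Fin 4) (p q : Fin 2 × Fin 2) :
    bellMeasurement b p q = 1 / 2 * (bellMat b p.1 p.2 * bellMat b q.1 q.2) := by
  have h2 : ((√2 : ℝ) : ℂ) ^ 2 = 2 := by
    rw [← Complex.ofReal_pow, Real.sq_sqrt (by norm_num)]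
    norm_num
  have h : ((√2 : ℝ) : ℂ)⁻¹ * ((√2 : ℝ) : ℂ)⁻¹ = 2⁻¹ := by
    rw [← mul_inv, ← sq, h2]
  obtain ⟨i, j⟩ := p
  obtain ⟨k, l⟩ := q
  fin_cases b <;> fin_cases i <;> fin_cases j <;> fin_cases k <;> fin_cases l <;>
    simp [bellMeasurement, bellVec, bellMat, ket, Matrix.vecMulVec_apply, h]

theorem posSemidef_bellMeasurement (b : Fin 4) : (bellMeasurement b).PosSemidef :=
  Matrix.posSemidef_vecMulVec_self_star _

theorem trace_bellMeasurement (b : Fin 4) : (bellMeasurement b).trace = 1 := by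
  fin_cases b <;>
    simp [Matrix.trace, bellMeasurement_apply, bellMat, Fintype.sum_prod_type] <;> norm_num

/-- The unitaries `K_b` with `Tr (Φ^b (Y ⊗ Z)) = (Tr Y Tr Z - Tr (Y K_b Z K_b†)) / 2`. -/
def reductionMat : Fin 4 → Matrix (Fin 2) (Fin 2) ℂ :=
  ![!![0, 1; -1, 0], !![0, 1; 1, 0], !![1, 0; 0, -1], !![1, 0; 0, 1]]

theorem trace_kronecker_bellMeasurement (b : Fin 4) (Y Z : Matrix (Fin 2) (Fin 2) ℂ) :
    (bellMeasurement b * (Y ⊗ₖ Z)).trace =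
      1 / 2 * (Y.trace * Z.trace - (Y * (reductionMat b * Z * (reductionMat b)ᴴ)).trace) := by
  fin_cases b <;>
    simp [Matrix.trace, Matrix.mul_apply, bellMeasurement_apply, bellMat, Fintype.sum_prod_type,
      reductionMat, Matrix.vecMul, dotProduct, Fin.sum_univ_two] <;> ring

/-- A Bell state has overlap at most one half with every product of positive operators. -/
theorem re_trace_kronecker_bellMeasurement_le (b : Fin 4) {Y Z : Matrix (Fin 2) (Fin 2) ℂ}
    (hY : Y.PosSemidef) (hZ : Z.PosSemidef) :
    (bellMeasurement b * (Y ⊗ₖ Z)).trace.re ≤ 1 / 2 * (Y ⊗ₖ Z).trace.re := by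
  have h := re_trace_mul_nonneg hY (hZ.mul_mul_conjTranspose_same (reductionMat b))
  rw [trace_kronecker_bellMeasurement, Matrix.trace_kronecker]
  have h2 : (1 / 2 : ℂ) = ((1 / 2 : ℝ) : ℂ) := by norm_num
  rw [h2, Complex.re_ofReal_mul, Complex.sub_re]
  linarith

theorem IsSeparableOp.re_trace_bellMeasurement_le (b : Fin 4)
    {X : Matrix (Fin 2 × Fin 2) (Fin 2 × Fin 2) ℂ} (hX : IsSeparableOp X) :
    (bellMeasurement b * X).trace.re ≤ 1 / 2 * X.trace.re := by
  obtain ⟨N, Y, Z, hY, hZ, rfl⟩ := hX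
  rw [Matrix.mul_sum, Matrix.trace_sum, Matrix.trace_sum, Complex.re_sum, Complex.re_sum,
    Finset.mul_sum]
  exact Finset.sum_le_sum fun k _ => re_trace_kronecker_bellMeasurement_le b (hY k) (hZ k)

/-- The separable threshold of the Bell-state measurement is attained by the measurement in the
computational basis. -/
theorem isGreatest_separableValues : IsGreatest (separableValues bellMeasurement) (1 / 2) := by
  constructor
  · let v : Fin 4 → Fin 2 × Fin 2 := ![(0, 0), (1, 1), (0, 1), (1, 0)]
    have hs (i : Fin 2) : (Matrix.single i i (1 : ℂ)).PosSemidef := by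
      have := Matrix.PosSemidef.diagonal (R := ℂ) (d := Pi.single i 1) (by
        intro k
        by_cases h : k = i <;> simp [h])
      rwa [Matrix.diagonal_single] at this
    refine ⟨fun b => Matrix.single (v b).1 (v b).1 1 ⊗ₖ Matrix.single (v b).2 (v b).2 1,
      ⟨fun b => (hs _).kronecker (hs _), ?_⟩, fun b => ⟨1, fun _ => Matrix.single (v b).1 (v b).1 1,
        fun _ => Matrix.single (v b).2 (v b).2 1, fun _ => hs _, fun _ => hs _, by simp⟩, ?_⟩
    · ext ⟨i, j⟩ ⟨k, l⟩
      fin_cases i <;> fin_cases j <;> fin_cases k <;> fin_cases l <;>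
        simp [Fin.sum_univ_four, v]
    · have h (b : Fin 4) : hsInner (Matrix.single (v b).1 (v b).1 1 ⊗ₖ
          Matrix.single (v b).2 (v b).2 1) (bellMeasurement b) = 1 / 2 := by
        rw [hsInner_eq_of_isHermitian ((hs _).kronecker (hs _)).1]
        fin_cases b <;> simp [v, Matrix.trace, Matrix.mul_apply, bellMeasurement_apply, bellMat,
          Fintype.sum_prod_type, Matrix.single_apply]
      simp only [h]
      norm_num
  · rintro x ⟨F, hF, hs, rfl⟩
    have h (b : Fin 4) : hsInner (F b) (bellMeasurement b) ≤ 1 / 2 * (F b).trace.re := by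
      rw [hsInner_eq_of_isHermitian (hF.1 b).1]
      exact (hs b).re_trace_bellMeasurement_le b
    have ht : ∑ b, (F b).trace.re = 4 := by
      rw [← Complex.re_sum, ← Matrix.trace_sum, hF.2, Matrix.trace_one]
      simp
    have := Finset.sum_le_sum fun b (_ : b ∈ Finset.univ) => h b
    rw [← Finset.mul_sum, ht] at this
    simp only [Fintype.card_fin]
    norm_num at this ⊢
    linarith

/-! ### Unitary matrices and contractions -/

section Unitary

variable {n : Type*} [Fintype n] [DecidableEq n]

/-- Some phase avoids the finitely many eigenvalues of `-U`. -/
theorem exists_isUnit_add_smul_one (U : Matrix n n ℂ) :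
    ∃ w : ℂ, w * star w = 1 ∧ IsUnit (U + w • (1 : Matrix n n ℂ)).det := by
  have hinf : (Metric.sphere (0 : ℂ) 1).Infinite := by
    refine (isPreconnected_sphere ?_ _ _).infinite_of_nontrivial ⟨1, by simp, -1, by simp, ?_⟩
    · rw [Complex.rank_real_complex]
      norm_num
    · norm_num
  obtain ⟨w, hw, hr⟩ := hinf.exists_notMem_finset ((-U).charpoly.roots.toFinset)
  refine ⟨w, ?_, ?_⟩
  · rw [Complex.star_def, Complex.mul_conj, Complex.normSq_eq_norm_sq]
    simp at hw
    simp [hw]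
  · rw [isUnit_iff_ne_zero]
    intro h0
    apply hr
    rw [Multiset.mem_toFinset, Polynomial.mem_roots (Matrix.charpoly_monic _).ne_zero,
      Polynomial.IsRoot, Matrix.eval_charpoly]
    rw [← h0]
    congr 1
    ext i j
    by_cases h : i = j <;> simp [Matrix.scalar_apply, h, add_comm]

/-- A unitary matrix is unitarily diagonalizable: for a suitable phase `w` its Cayley transform
`i (w - U) (w + U)⁻¹` is Hermitian, and the spectral theorem applies to that. -/
theorem exists_diagonalization_of_unitary {U : Matrix n n ℂ} (hU : U * Uᴴ = 1) :
    ∃ (V : Matrix n n ℂ) (u : n → ℂ), V * Vᴴ = 1 ∧ (∀ k, u k * star (u k) = 1) ∧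
      U = V * Matrix.diagonal u * Vᴴ := by
  have hU' : Uᴴ * U = 1 := mul_eq_one_comm.1 hU
  obtain ⟨w, hw, hdet⟩ := exists_isUnit_add_smul_one U
  set S := U + w • (1 : Matrix n n ℂ) with hS
  set H := Complex.I • ((w • (1 : Matrix n n ℂ) - U) * S⁻¹) with hH
  have hHS : H * S = Complex.I • (w • (1 : Matrix n n ℂ) - U) := by
    rw [hH, smul_mul_assoc, Matrix.mul_assoc, Matrix.nonsing_inv_mul _ hdet, Matrix.mul_one]
  have hHherm : H.IsHermitian := by
    have hSu : IsUnit S := (Matrix.isUnit_iff_isUnit_det _).2 hdet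
    have key : Sᴴ * H * S = Sᴴ * Hᴴ * S := by
      rw [Matrix.mul_assoc, hHS, ← Matrix.conjTranspose_mul, hHS]
      simp only [hS, Matrix.conjTranspose_smul, Matrix.conjTranspose_sub, Matrix.conjTranspose_add,
        Matrix.conjTranspose_one, Matrix.mul_add, Matrix.add_mul, Matrix.mul_sub, Matrix.sub_mul,
        smul_mul_assoc, mul_smul_comm, Matrix.mul_one, Matrix.one_mul, hU', smul_sub, smul_add,
        smul_smul, Complex.star_def, Complex.conj_I, map_mul]
      have h1 : w * (starRingEnd ℂ) w = 1 := hw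
      ext i j
      simp only [Matrix.add_apply, Matrix.sub_apply, Matrix.smul_apply, smul_eq_mul]
      linear_combination (2 * Complex.I * (1 : Matrix n n ℂ) i j) * h1
    have hSHu : IsUnit Sᴴ := by
      rw [Matrix.isUnit_iff_isUnit_det, Matrix.det_conjTranspose]
      exact hdet.star
    exact (hSHu.mul_left_cancel (hSu.mul_right_cancel key)).symm
  set V : Matrix n n ℂ := hHherm.eigenvectorUnitary.1 with hV
  have hVV : V * Vᴴ = 1 := Matrix.mem_unitaryGroup_iff.1 hHherm.eigenvectorUnitary.2
  have hVV' : Vᴴ * V = 1 := mul_eq_one_comm.1 hVV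
  set d := hHherm.eigenvalues
  have hd : H = V * Matrix.diagonal (fun i => (d i : ℂ)) * Vᴴ := by
    have := hHherm.spectral_theorem
    rw [Unitary.conjStarAlgAut_apply] at this
    exact this
  have hne (k : n) : (d k : ℂ) + Complex.I ≠ 0 := by
    intro h
    have := congrArg Complex.im h
    simp at this
  refine ⟨V, fun k => w * (Complex.I - d k) / (d k + Complex.I), hVV, fun k => ?_, ?_⟩
  · have h2 := hne k
    have h3 : (d k : ℂ) - Complex.I ≠ 0 := by
      intro h
      have := congrArg Complex.im h
      simp at this
    simp only [star_div₀, star_mul', star_sub, star_add, Complex.star_def, Complex.conj_I,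
      Complex.conj_ofReal]
    have hw' : w * (starRingEnd ℂ) w = 1 := hw
    have h3' : (d k : ℂ) + -Complex.I ≠ 0 := by rwa [← sub_eq_add_neg]
    rw [div_mul_div_comm, div_eq_one_iff_eq (mul_ne_zero h2 h3')]
    linear_combination ((Complex.I - d k) * (-Complex.I - d k)) * hw'
  · have hVUV : Vᴴ * U * V =
        Matrix.diagonal fun k => w * (Complex.I - d k) / (d k + Complex.I) := by
      have h1 : Matrix.diagonal (fun i => (d i : ℂ)) * (Vᴴ * U * V + w • 1) =
          Complex.I • (w • (1 : Matrix n n ℂ) - Vᴴ * U * V) := by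
        have := congrArg (fun M => Vᴴ * M * V) hHS
        rw [hd] at this
        have hS' : Vᴴ * S * V = Vᴴ * U * V + w • 1 := by
          rw [hS, Matrix.mul_add, Matrix.add_mul, mul_smul_comm, smul_mul_assoc, Matrix.mul_one,
            hVV']
        have hl : Vᴴ * (V * Matrix.diagonal (fun i => (d i : ℂ)) * Vᴴ * S) * V =
            (Vᴴ * V) * Matrix.diagonal (fun i => (d i : ℂ)) * (Vᴴ * S * V) := by
          simp only [Matrix.mul_assoc]
        rw [hl, hVV', Matrix.one_mul, hS'] at this
        rw [this, mul_smul_comm, smul_mul_assoc, Matrix.mul_sub, Matrix.sub_mul, mul_smul_comm,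
          smul_mul_assoc, Matrix.mul_one, hVV']
      ext i j
      have h2 := congrFun (congrFun h1 i) j
      rw [Matrix.diagonal_mul] at h2
      simp only [Matrix.add_apply, Matrix.smul_apply, Matrix.sub_apply, smul_eq_mul] at h2
      by_cases hij : i = j
      · subst hij
        rw [Matrix.diagonal_apply_eq, eq_div_iff (hne i)]
        rw [Matrix.one_apply_eq] at h2
        linear_combination h2
      · rw [Matrix.diagonal_apply_ne _ hij]
        rw [Matrix.one_apply_ne hij] at h2
        have : (Vᴴ * U * V) i j * (d i + Complex.I) = 0 := by linear_combination h2
        exact (mul_eq_zero.1 this).resolve_right (hne i)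
    rw [← hVUV]
    calc U = (V * Vᴴ) * U * (V * Vᴴ) := by rw [hVV]; simp
      _ = _ := by simp only [Matrix.mul_assoc]

/-- A Hermitian contraction is the Hermitian part of a unitary matrix, `A = Re (A + i √(1 - A²))`.
-/
theorem exists_unitary_of_contraction {A : Matrix n n ℂ} (h₁ : (1 - A).PosSemidef)
    (h₂ : (1 + A).PosSemidef) :
    ∃ W : Matrix n n ℂ, W * Wᴴ = 1 ∧ A = (1 / 2 : ℂ) • (W + Wᴴ) := by
  have hA : A.IsHermitian := by
    have := h₂.1
    rw [Matrix.IsHermitian, Matrix.conjTranspose_add, Matrix.conjTranspose_one] at this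
    exact add_left_cancel this
  set V : Matrix n n ℂ := hA.eigenvectorUnitary.1 with hV
  have hVV : V * Vᴴ = 1 := Matrix.mem_unitaryGroup_iff.1 hA.eigenvectorUnitary.2
  have hVV' : Vᴴ * V = 1 := mul_eq_one_comm.1 hVV
  set d := hA.eigenvalues
  have hd : A = V * Matrix.diagonal (fun i => (d i : ℂ)) * Vᴴ := by
    have := hA.spectral_theorem
    rw [Unitary.conjStarAlgAut_apply] at this
    exact this
  have hdiag : Vᴴ * A * V = Matrix.diagonal (fun i => (d i : ℂ)) := by
    rw [hd]
    calc Vᴴ * (V * Matrix.diagonal (fun i => (d i : ℂ)) * Vᴴ) * V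
        = (Vᴴ * V) * Matrix.diagonal (fun i => (d i : ℂ)) * (Vᴴ * V) := by
          simp only [Matrix.mul_assoc]
      _ = _ := by rw [hVV']; simp
  have hlo (i : n) : -1 ≤ d i := by
    have := (h₂.conjTranspose_mul_mul_same V).diag_nonneg (i := i)
    rw [Matrix.mul_add, Matrix.add_mul, hdiag, Matrix.mul_one, hVV'] at this
    have := (Complex.le_def.1 this).1
    simp at this
    linarith
  have hhi (i : n) : d i ≤ 1 := by
    have := (h₁.conjTranspose_mul_mul_same V).diag_nonneg (i := i)
    rw [Matrix.mul_sub, Matrix.sub_mul, hdiag, Matrix.mul_one, hVV'] at this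
    have := (Complex.le_def.1 this).1
    simp at this
    linarith
  set c : n → ℂ := fun i => (d i : ℂ) + (√(1 - d i ^ 2) : ℝ) * Complex.I with hc
  have hcc (i : n) : c i * star (c i) = 1 := by
    have : ((√(1 - d i ^ 2) : ℝ) : ℂ) ^ 2 = 1 - (d i : ℂ) ^ 2 := by
      rw [← Complex.ofReal_pow, Real.sq_sqrt (by nlinarith [hlo i, hhi i])]
      push_cast
      ring
    simp only [hc, star_add, star_mul', Complex.star_def, Complex.conj_ofReal, Complex.conj_I]
    linear_combination this - ((√(1 - d i ^ 2) : ℝ) : ℂ) ^ 2 * Complex.I_sq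
  have hWH : (V * Matrix.diagonal c * Vᴴ)ᴴ = V * Matrix.diagonal (star c) * Vᴴ := by
    simp only [Matrix.conjTranspose_mul, Matrix.conjTranspose_conjTranspose,
      Matrix.diagonal_conjTranspose, Matrix.mul_assoc]
  refine ⟨V * Matrix.diagonal c * Vᴴ, ?_, ?_⟩
  · rw [hWH]
    calc V * Matrix.diagonal c * Vᴴ * (V * Matrix.diagonal (star c) * Vᴴ)
        = V * (Matrix.diagonal c * (Vᴴ * V) * Matrix.diagonal (star c)) * Vᴴ := by
          simp only [Matrix.mul_assoc]
      _ = 1 := by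
        rw [hVV', Matrix.mul_one, Matrix.diagonal_mul_diagonal]
        simp only [Pi.star_apply, hcc, Matrix.diagonal_one, Matrix.mul_one, hVV]
  · rw [hWH, ← Matrix.add_mul, ← Matrix.mul_add, Matrix.diagonal_add, hd, ← smul_mul_assoc,
      ← mul_smul_comm, ← Matrix.diagonal_smul]
    congr 3
    ext i
    simp [hc]
    ring

end Unitary

/-! ### Decomposing a pair of observables into pairs of qubit observables -/

section Decomposition

variable {n : Type*} [Fintype n] [DecidableEq n]

/-- The qubit observable `cos φ Z + sin φ X` for `w = exp (i φ)`. -/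
def qubitObs (w : ℂ) : Matrix (Fin 2) (Fin 2) ℂ := !![(w.re : ℂ), w.im; w.im, -w.re]

/-- A phase or its conjugate is the square of a phase in the closed first quadrant. -/
theorem exists_quadrant_sqrt {u : ℂ} (hu : u * star u = 1) :
    ∃ z : ℂ, z * star z = 1 ∧ 0 ≤ z.re ∧ 0 ≤ z.im ∧ (z ^ 2 = u ∨ z ^ 2 = star u) := by
  obtain ⟨y, hy⟩ := IsAlgClosed.exists_pow_nat_eq u (n := 2) (by norm_num)
  have hun : Complex.normSq u = 1 := by
    have h : u * (starRingEnd ℂ) u = 1 := hu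
    rw [Complex.mul_conj] at h
    exact_mod_cast h
  have hyn : y.re * y.re + y.im * y.im = 1 := by
    have h : Complex.normSq y ^ 2 = 1 := by rw [← map_pow, hy, hun]
    have h0 := Complex.normSq_nonneg y
    have h1 : Complex.normSq y = 1 := by nlinarith
    rwa [Complex.normSq_apply] at h1
  have hre : u.re = y.re * y.re - y.im * y.im := by rw [← hy, sq, Complex.mul_re]
  have him : u.im = y.re * y.im + y.im * y.re := by rw [← hy, sq, Complex.mul_im]
  refine ⟨⟨|y.re|, |y.im|⟩, ?_, abs_nonneg _, abs_nonneg _, ?_⟩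
  · rw [Complex.star_def, Complex.mul_conj, Complex.normSq_apply]
    simp only [abs_mul_abs_self]
    rw [hyn, Complex.ofReal_one]
  · rcases le_total 0 (y.re * y.im) with h | h
    · left
      have h' : |y.re| * |y.im| = y.re * y.im := by rw [← abs_mul, abs_of_nonneg h]
      apply Complex.ext
      · rw [sq, Complex.mul_re, hre]
        simp only [abs_mul_abs_self]
      · rw [sq, Complex.mul_im, him]
        simp only
        linarith
    · right
      have h' : |y.re| * |y.im| = -(y.re * y.im) := by rw [← abs_mul, abs_of_nonpos h]
      apply Complex.ext
      · rw [sq, Complex.mul_re, Complex.star_def, Complex.conj_re, hre]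
        simp only [abs_mul_abs_self]
      · rw [sq, Complex.mul_im, Complex.star_def, Complex.conj_im, him]
        simp only
        linarith

/-- The map `ℂ^n → ℂ²` built from two vectors `g` and `h` for which `V† (cos φ Z + sin φ X) V` is
`(w w̄₀ g h† + h.c.) / 2`, where `w = exp (i φ)`. -/
def pairMap (w₀ : ℂ) (g h : n → ℂ) : Matrix (Fin 2) n ℂ :=
  Matrix.of ![fun x => (w₀ * star (g x) + star (h x)) / 2,
    fun x => (-Complex.I * w₀ * star (g x) + Complex.I * star (h x)) / 2]

theorem pairMap_gram {w₀ : ℂ} (hw : w₀ * star w₀ = 1) (g h : n → ℂ) (x y : n) :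
    ((pairMap w₀ g h)ᴴ * pairMap w₀ g h) x y =
      1 / 2 * (g x * star (g y) + h x * star (h y)) := by
  have hw' : w₀ * (starRingEnd ℂ) w₀ = 1 := hw
  simp only [Matrix.mul_apply, Fin.sum_univ_two, pairMap, Matrix.conjTranspose_apply,
    Matrix.of_apply, Matrix.cons_val_zero, Matrix.cons_val_one, Complex.star_def, map_div₀,
    map_add, map_mul, map_neg, Complex.conj_conj, Complex.conj_I, map_ofNat]
  linear_combination (1 / 2 * (g x * (starRingEnd ℂ) (g y))) * hw' -
    (1 / 4 * ((starRingEnd ℂ) w₀ * g x - h x) * (w₀ * (starRingEnd ℂ) (g y) -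
      (starRingEnd ℂ) (h y))) * Complex.I_sq

theorem pairMap_obs {w₀ : ℂ} (hw : w₀ * star w₀ = 1) (w : ℂ) (g h : n → ℂ) (x y : n) :
    ((pairMap w₀ g h)ᴴ * qubitObs w * pairMap w₀ g h) x y =
      1 / 2 * (w * star w₀ * (g x * star (h y)) + star w * w₀ * (h x * star (g y))) := by
  have hw' : w₀ * (starRingEnd ℂ) w₀ = 1 := hw
  have hI : (w.im : ℂ) * Complex.I = (w - (starRingEnd ℂ) w) / 2 := by
    rw [Complex.im_eq_sub_conj]
    field_simp
  have hr := Complex.re_eq_add_conj w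
  have hs : w = w.re + w.im * Complex.I := (Complex.re_add_im w).symm
  simp only [Matrix.mul_apply, Fin.sum_univ_two, pairMap, qubitObs, Matrix.conjTranspose_apply,
    Matrix.of_apply, Matrix.cons_val_zero, Matrix.cons_val_one, Complex.star_def, map_div₀,
    map_add, map_mul, map_neg, Complex.conj_conj, Complex.conj_I, map_ofNat, Matrix.cons_val',
    Matrix.cons_val_fin_one]
  generalize (starRingEnd ℂ) w₀ = v₀ at *
  generalize (starRingEnd ℂ) w = w' at *
  generalize (starRingEnd ℂ) (g y) = g' at *
  generalize (starRingEnd ℂ) (h y) = h' at *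
  have hI2 := Complex.I_sq
  generalize (w.re : ℂ) = a at *
  generalize (w.im : ℂ) = b at *
  grind

/-- **Dilation to qubits.** Two Hermitian contractions on one space are compressions of a direct sum
of pairs of qubit observables `cos (φ ∓ a) Z + sin (φ ∓ a) X` with `0 ≤ a ≤ π / 2`; here
`ζ = exp (i φ)` and `z = exp (i a)`. Writing them as Hermitian parts of unitaries `W₀` and `W₁`, the
summands are indexed by the eigenvectors of `W₀† W₁`, whose eigenvalues are `z ^ 2` up to complex
conjugation. This takes the place of Jordan's lemma. -/
theorem exists_qubit_decomposition {A₀ A₁ : Matrix n n ℂ}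
    (h₀ : (1 - A₀).PosSemidef ∧ (1 + A₀).PosSemidef)
    (h₁ : (1 - A₁).PosSemidef ∧ (1 + A₁).PosSemidef) {ζ : ℂ} (hζ : ζ * star ζ = 1) :
    ∃ (V : n → Matrix (Fin 2) n ℂ) (z : n → ℂ),
      (∀ k, z k * star (z k) = 1 ∧ 0 ≤ (z k).re ∧ 0 ≤ (z k).im) ∧
      ∑ k, (V k)ᴴ * V k = 1 ∧
      ∑ k, (V k)ᴴ * qubitObs (ζ * star (z k)) * V k = A₀ ∧
      ∑ k, (V k)ᴴ * qubitObs (ζ * z k) * V k = A₁ := by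
  obtain ⟨W₀, hW₀, rfl⟩ := exists_unitary_of_contraction h₀.1 h₀.2
  obtain ⟨W₁, hW₁, rfl⟩ := exists_unitary_of_contraction h₁.1 h₁.2
  have hW₀' : W₀ᴴ * W₀ = 1 := mul_eq_one_comm.1 hW₀
  obtain ⟨T, u, hT, hu, hU⟩ := exists_diagonalization_of_unitary (U := W₀ᴴ * W₁) (by
    rw [Matrix.conjTranspose_mul, Matrix.conjTranspose_conjTranspose, Matrix.mul_assoc,
      ← Matrix.mul_assoc W₁, hW₁, Matrix.one_mul, hW₀'])
  choose z hz hzre hzim hzu using fun k => exists_quadrant_sqrt (hu k)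
  set G := W₀ * T with hG
  have hGG : G * Gᴴ = 1 := by
    rw [hG, Matrix.conjTranspose_mul, Matrix.mul_assoc, ← Matrix.mul_assoc T, hT, Matrix.one_mul,
      hW₀]
  have hGT : G * Tᴴ = W₀ := by rw [hG, Matrix.mul_assoc, hT, Matrix.mul_one]
  have hTG : T * Gᴴ = W₀ᴴ := by
    have := congrArg Matrix.conjTranspose hGT
    simpa only [Matrix.conjTranspose_mul (M := G), Matrix.conjTranspose_conjTranspose] using this
  have hGuT : G * Matrix.diagonal u * Tᴴ = W₁ := by
    rw [hG, Matrix.mul_assoc, Matrix.mul_assoc, ← Matrix.mul_assoc T, ← hU, ← Matrix.mul_assoc,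
      hW₀, Matrix.one_mul]
  have hTuG : T * Matrix.diagonal (star u) * Gᴴ = W₁ᴴ := by
    have := congrArg Matrix.conjTranspose hGuT
    simpa only [Matrix.conjTranspose_mul (N := Tᴴ), Matrix.conjTranspose_mul (M := G),
      Matrix.conjTranspose_conjTranspose, Matrix.diagonal_conjTranspose, Matrix.mul_assoc]
      using this
  have hw₀ (k : n) : ζ * star (z k) * star (ζ * star (z k)) = 1 := by
    rw [star_mul', star_star]
    linear_combination (z k * star (z k)) * hζ + hz k
  classical
  -- exchanging the two vectors replaces the eigenvalue by its conjugate
  refine ⟨fun k => if z k ^ 2 = u k then pairMap (ζ * star (z k)) (fun x => G x k) (fun x => T x k)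
    else pairMap (ζ * star (z k)) (fun x => T x k) (fun x => G x k), z,
    fun k => ⟨hz k, hzre k, hzim k⟩, ?_, ?_, ?_⟩
  · have e1 (x y : n) := congrFun (congrFun hGG x) y
    have e2 (x y : n) := congrFun (congrFun hT x) y
    ext x y
    simp only [Matrix.mul_apply, Matrix.conjTranspose_apply] at e1 e2
    rw [Matrix.sum_apply]
    have : ∀ k ∈ Finset.univ, ((if z k ^ 2 = u k then
        pairMap (ζ * star (z k)) (fun x => G x k) (fun x => T x k)
        else pairMap (ζ * star (z k)) (fun x => T x k) (fun x => G x k))ᴴ *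
        (if z k ^ 2 = u k then pairMap (ζ * star (z k)) (fun x => G x k) (fun x => T x k)
        else pairMap (ζ * star (z k)) (fun x => T x k) (fun x => G x k))) x y =
        1 / 2 * (G x k * star (G y k)) + 1 / 2 * (T x k * star (T y k)) := by
      intro k _
      split_ifs <;> rw [pairMap_gram (hw₀ k)] <;> ring
    rw [Finset.sum_congr rfl this, Finset.sum_add_distrib, ← Finset.mul_sum, ← Finset.mul_sum, e1,
      e2]
    ring
  · have e1 (x y : n) := congrFun (congrFun hGT x) y
    have e2 (x y : n) := congrFun (congrFun hTG x) y
    ext x y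
    simp only [Matrix.mul_apply (M := G), Matrix.mul_apply (M := T),
      Matrix.conjTranspose_apply (M := G), Matrix.conjTranspose_apply (M := T)] at e1 e2
    rw [Matrix.sum_apply]
    have : ∀ k ∈ Finset.univ, ((if z k ^ 2 = u k then
        pairMap (ζ * star (z k)) (fun x => G x k) (fun x => T x k)
        else pairMap (ζ * star (z k)) (fun x => T x k) (fun x => G x k))ᴴ *
        qubitObs (ζ * star (z k)) *
        (if z k ^ 2 = u k then pairMap (ζ * star (z k)) (fun x => G x k) (fun x => T x k)
        else pairMap (ζ * star (z k)) (fun x => T x k) (fun x => G x k))) x y =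
        1 / 2 * (G x k * star (T y k)) + 1 / 2 * (T x k * star (G y k)) := by
      intro k _
      have h' := hw₀ k
      rw [mul_comm] at h'
      split_ifs <;> rw [pairMap_obs (hw₀ k), hw₀ k, h'] <;> ring
    rw [Finset.sum_congr rfl this, Finset.sum_add_distrib, ← Finset.mul_sum, ← Finset.mul_sum, e1,
      e2]
    simp only [Matrix.smul_apply, Matrix.add_apply, smul_eq_mul]
    ring
  · have e1 (x y : n) := congrFun (congrFun hGuT x) y
    have e2 (x y : n) := congrFun (congrFun hTuG x) y
    ext x y
    simp only [Matrix.mul_diagonal, Matrix.mul_apply (N := Gᴴ), Matrix.mul_apply (N := Tᴴ),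
      Matrix.conjTranspose_apply (M := G), Matrix.conjTranspose_apply (M := T)] at e1 e2
    rw [Matrix.sum_apply]
    have : ∀ k ∈ Finset.univ, ((if z k ^ 2 = u k then
        pairMap (ζ * star (z k)) (fun x => G x k) (fun x => T x k)
        else pairMap (ζ * star (z k)) (fun x => T x k) (fun x => G x k))ᴴ *
        qubitObs (ζ * z k) *
        (if z k ^ 2 = u k then pairMap (ζ * star (z k)) (fun x => G x k) (fun x => T x k)
        else pairMap (ζ * star (z k)) (fun x => T x k) (fun x => G x k))) x y =
        1 / 2 * (G x k * u k * star (T y k)) + 1 / 2 * (T x k * star u k * star (G y k)) := by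
      intro k _
      have a1 : ζ * z k * star (ζ * star (z k)) = z k ^ 2 := by
        rw [star_mul', star_star]
        linear_combination (z k ^ 2) * hζ
      have a2 : star (ζ * z k) * (ζ * star (z k)) = star (z k ^ 2) := by
        rw [← a1]
        simp only [star_mul', star_star]
      rw [Pi.star_apply]
      split_ifs with hk
      · rw [pairMap_obs (hw₀ k), a1, a2, hk]
        ring
      · rw [pairMap_obs (hw₀ k), a1, a2, (hzu k).resolve_left hk, star_star]
        ring
    rw [Finset.sum_congr rfl this, Finset.sum_add_distrib, ← Finset.mul_sum, ← Finset.mul_sum, e1,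
      e2]
    simp only [Matrix.smul_apply, Matrix.add_apply, smul_eq_mul]
    ring

end Decomposition

/-! ### The scalar inequality behind the operator inequality -/

/-- The determinant of one block of the operator inequality, as a function of the dephasing
parameters `g`, `h` of the two parties; `r` stands for `√2`, and `D`, `D'` are the values of
`(1 - g) |cos a - sin a|` for the two angles. The number `(4 + 5 r) / 16` is the slope of the affine
bound. -/
def plusForm (r g h D D' : ℝ) : ℝ :=
  ((1 + r) / 2 + g * h / 4) ^ 2 - ((1 + g ^ 2) * (1 + h ^ 2) + 4 * g * h) / 32 +
    (4 + 5 * r) / 16 * r / 4 *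
      ((1 + g) * (1 + h) * (1 + (r - 1) * g) * (1 + (r - 1) * h) + D * D') -
    4 * ((4 + 5 * r) / 16) ^ 2 *
      (1 + ((1 + (r - 1) * g) ^ 2 - 1) * ((1 + (r - 1) * h) ^ 2 - 1))

/-- The determinant of the other block. -/
def minusForm (r g h D D' : ℝ) : ℝ :=
  ((1 + r) / 2 - g * h / 4) ^ 2 - ((1 + g ^ 2) * (1 + h ^ 2) - 4 * g * h) / 32 +
    (4 + 5 * r) / 16 * r / 4 *
      ((1 + g) * (1 + (r - 1) * g) * D' + (1 + h) * (1 + (r - 1) * h) * D) -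
    4 * ((4 + 5 * r) / 16) ^ 2 *
      (1 - ((1 + (r - 1) * g) ^ 2 - 1) * ((1 + (r - 1) * h) ^ 2 - 1))

/-- For `D` and `D'` replaced by polynomial lower bounds, the form is a combination with positive
coefficients of the products of powers of `g`, `1 - g`, `h` and `1 - h`. -/
theorem bernstein_plus {r g p h q : ℝ} (hr : r ^ 2 = 2) (hr1 : 1.4142 ≤ r)
    (hg : 0 ≤ g) (hp : 0 ≤ p) (hh : 0 ≤ h) (hq : 0 ≤ q) (hgp : p = 1 - g) (hhq : q = 1 - h) :
    0 ≤ plusForm r g h ((1 - g) ^ 2 * (1 + (2 - r) * g)) ((1 - h) ^ 2 * (1 + (2 - r) * h)) := by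
  have a0 : 0 ≤ (-9 / 32 + (7 / 32) * r) := by linarith
  have a1 : 0 ≤ (-3 / 32 + (3 / 16) * r) := by linarith
  have a2 : 0 ≤ (-13 / 8 + (5 / 4) * r) := by linarith
  have a3 : 0 ≤ (-71 / 32 + (57 / 32) * r) := by linarith
  have a4 : 0 ≤ (1 / 32 + (1 / 4) * r) := by linarith
  have a5 : 0 ≤ (-9 / 32 + (7 / 32) * r) := by linarith
  have a6 : 0 ≤ (-71 / 32 + (57 / 32) * r) := by linarith
  have a7 : 0 ≤ (-29 / 16 + (13 / 8) * r) := by linarith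
  have a8 : 0 ≤ (1 / 8 + (1 / 16) * r) := by linarith
  have a9 : 0 ≤ (-3 / 32 + (3 / 16) * r) := by linarith
  have a10 : 0 ≤ (1 / 32 + (1 / 4) * r) := by linarith
  have a11 : 0 ≤ (1 / 8 + (1 / 16) * r) := by linarith
  have key : plusForm r g h ((1 - g) ^ 2 * (1 + (2 - r) * g)) ((1 - h) ^ 2 * (1 + (2 - r) * h)) =
        (-9 / 32 + (7 / 32) * r) * (p ^ 3 * h ^ 2 * q) +
        (-3 / 32 + (3 / 16) * r) * (p ^ 3 * h ^ 3) +
        (-13 / 8 + (5 / 4) * r) * (g * p ^ 2 * h * q ^ 2) +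
        (-71 / 32 + (57 / 32) * r) * (g * p ^ 2 * h ^ 2 * q) +
        (1 / 32 + (1 / 4) * r) * (g * p ^ 2 * h ^ 3) +
        (-9 / 32 + (7 / 32) * r) * (g ^ 2 * p * q ^ 3) +
        (-71 / 32 + (57 / 32) * r) * (g ^ 2 * p * h * q ^ 2) +
        (-29 / 16 + (13 / 8) * r) * (g ^ 2 * p * h ^ 2 * q) +
        (1 / 8 + (1 / 16) * r) * (g ^ 2 * p * h ^ 3) +
        (-3 / 32 + (3 / 16) * r) * (g ^ 3 * q ^ 3) +
        (1 / 32 + (1 / 4) * r) * (g ^ 3 * h * q ^ 2) +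
        (1 / 8 + (1 / 16) * r) * (g ^ 3 * h ^ 2 * q) := by
    subst hgp hhq
    rw [plusForm]
    linear_combination (
      (1 / 64) + (-1 / 8) * h ^ 2 + (15 / 64) * h ^ 2 * r + (3 / 32) * h ^ 3 + (-5 / 64) *
      h ^ 3 * r + (-3 / 8) * g * h + (3 / 4) * g * h * r + (-45 / 32) * g * h * r ^ 2 + (11
      / 16) * g * h ^ 2 + (-9 / 16) * g * h ^ 2 * r + (65 / 64) * g * h ^ 2 * r ^ 2 + (-25
      / 32) * g * h ^ 2 * r ^ 3 + (1 / 32) * g * h ^ 3 + (-3 / 32) * g * h ^ 3 * r + (5 /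
      64) * g * h ^ 3 * r ^ 2 + (-1 / 8) * g ^ 2 + (15 / 64) * g ^ 2 * r + (11 / 16) * g ^
      2 * h + (-9 / 16) * g ^ 2 * h * r + (65 / 64) * g ^ 2 * h * r ^ 2 + (-25 / 32) * g ^
      2 * h * r ^ 3 + (-29 / 64) * g ^ 2 * h ^ 2 + (-3 / 32) * g ^ 2 * h ^ 2 * r + (-31 /
      64) * g ^ 2 * h ^ 2 * r ^ 2 + (15 / 16) * g ^ 2 * h ^ 2 * r ^ 3 + (-25 / 64) * g ^ 2
      * h ^ 2 * r ^ 4 + (-11 / 32) * g ^ 2 * h ^ 3 + (27 / 64) * g ^ 2 * h ^ 3 * r + (-5 /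
      32) * g ^ 2 * h ^ 3 * r ^ 2 + (3 / 32) * g ^ 3 + (-5 / 64) * g ^ 3 * r + (1 / 32) * g
      ^ 3 * h + (-3 / 32) * g ^ 3 * h * r + (5 / 64) * g ^ 3 * h * r ^ 2 + (-11 / 32) * g ^
      3 * h ^ 2 + (27 / 64) * g ^ 3 * h ^ 2 * r + (-5 / 32) * g ^ 3 * h ^ 2 * r ^ 2 + (7 /
      32) * g ^ 3 * h ^ 3 + (-1 / 4) * g ^ 3 * h ^ 3 * r + (5 / 64) * g ^ 3 * h ^ 3 * r ^ 2) * hr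
  rw [key]
  positivity

/-- The same for the other block. Here the determinant vanishes to second order in `(g, h)` at the
corner `(0, 0)`, and one square has to be split off first. -/
theorem bernstein_minus {r g p h q : ℝ} (hr : r ^ 2 = 2) (hr1 : 1.4142 ≤ r) (hr2 : r ≤ 1.41422)
    (hg : 0 ≤ g) (hp : 0 ≤ p) (hh : 0 ≤ h) (hq : 0 ≤ q) (hgp : p = 1 - g) (hhq : q = 1 - h) :
    0 ≤ minusForm r g h ((1 - g) ^ 2 * (1 + (2 - r) * g + 2 / 5 * g ^ 2))
      ((1 - h) ^ 2 * (1 + (2 - r) * h + 2 / 5 * h ^ 2)) := by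
  have a0 : 0 ≤ (-271 / 800 + (39 / 160) * r) := by linarith
  have a1 : 0 ≤ (-3 / 8 + (13 / 32) * r) := by linarith
  have a2 : 0 ≤ (-3 / 32 + (3 / 16) * r) := by linarith
  have a3 : 0 ≤ (373 / 200 + (-5 / 4) * r) := by linarith
  have a4 : 0 ≤ (87 / 40 + (-107 / 80) * r) := by linarith
  have a5 : 0 ≤ (-7 / 16 + (13 / 16) * r) := by linarith
  have a6 : 0 ≤ (-11 / 16 + (17 / 16) * r) := by linarith
  have a7 : 0 ≤ (-271 / 800 + (39 / 160) * r) := by linarith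
  have a8 : 0 ≤ (87 / 40 + (-107 / 80) * r) := by linarith
  have a9 : 0 ≤ (181 / 40 + (-33 / 16) * r) := by linarith
  have a10 : 0 ≤ (21 / 16 + (113 / 160) * r) := by linarith
  have a11 : 0 ≤ (-49 / 160 + (25 / 16) * r) := by linarith
  have a12 : 0 ≤ (-3 / 8 + (13 / 32) * r) := by linarith
  have a13 : 0 ≤ (-7 / 16 + (13 / 16) * r) := by linarith
  have a14 : 0 ≤ (21 / 16 + (113 / 160) * r) := by linarith
  have a15 : 0 ≤ (7 / 4 + (3 / 4) * r) := by linarith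
  have a16 : 0 ≤ (3 / 4 + (13 / 16) * r) := by linarith
  have a17 : 0 ≤ (-3 / 32 + (3 / 16) * r) := by linarith
  have a18 : 0 ≤ (-11 / 16 + (17 / 16) * r) := by linarith
  have a19 : 0 ≤ (-49 / 160 + (25 / 16) * r) := by linarith
  have a20 : 0 ≤ (3 / 4 + (13 / 16) * r) := by linarith
  have a21 : 0 ≤ (9 / 16 + (1 / 4) * r) := by linarith
  have key : minusForm r g h ((1 - g) ^ 2 * (1 + (2 - r) * g + 2 / 5 * g ^ 2))
      ((1 - h) ^ 2 * (1 + (2 - r) * h + 2 / 5 * h ^ 2)) =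
        3 / 25 * (g * p * q ^ 2 - h * q * p ^ 2) ^ 2 +
        ((-271 / 800 + (39 / 160) * r) * (p ^ 4 * h ^ 2 * q ^ 2) +
        (-3 / 8 + (13 / 32) * r) * (p ^ 4 * h ^ 3 * q) +
        (-3 / 32 + (3 / 16) * r) * (p ^ 4 * h ^ 4) +
        (373 / 200 + (-5 / 4) * r) * (g * p ^ 3 * h * q ^ 3) +
        (87 / 40 + (-107 / 80) * r) * (g * p ^ 3 * h ^ 2 * q ^ 2) +
        (-7 / 16 + (13 / 16) * r) * (g * p ^ 3 * h ^ 3 * q) +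
        (-11 / 16 + (17 / 16) * r) * (g * p ^ 3 * h ^ 4) +
        (-271 / 800 + (39 / 160) * r) * (g ^ 2 * p ^ 2 * q ^ 4) +
        (87 / 40 + (-107 / 80) * r) * (g ^ 2 * p ^ 2 * h * q ^ 3) +
        (181 / 40 + (-33 / 16) * r) * (g ^ 2 * p ^ 2 * h ^ 2 * q ^ 2) +
        (21 / 16 + (113 / 160) * r) * (g ^ 2 * p ^ 2 * h ^ 3 * q) +
        (-49 / 160 + (25 / 16) * r) * (g ^ 2 * p ^ 2 * h ^ 4) +
        (-3 / 8 + (13 / 32) * r) * (g ^ 3 * p * q ^ 4) +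
        (-7 / 16 + (13 / 16) * r) * (g ^ 3 * p * h * q ^ 3) +
        (21 / 16 + (113 / 160) * r) * (g ^ 3 * p * h ^ 2 * q ^ 2) +
        (7 / 4 + (3 / 4) * r) * (g ^ 3 * p * h ^ 3 * q) +
        (3 / 4 + (13 / 16) * r) * (g ^ 3 * p * h ^ 4) +
        (-3 / 32 + (3 / 16) * r) * (g ^ 4 * q ^ 4) +
        (-11 / 16 + (17 / 16) * r) * (g ^ 4 * h * q ^ 3) +
        (-49 / 160 + (25 / 16) * r) * (g ^ 4 * h ^ 2 * q ^ 2) +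
        (3 / 4 + (13 / 16) * r) * (g ^ 4 * h ^ 3 * q) +
        (9 / 16 + (1 / 4) * r) * (g ^ 4 * h ^ 4)) := by
    subst hgp hhq
    rw [minusForm]
    linear_combination (
      (1 / 64) + (-3 / 32) * h ^ 2 + (15 / 64) * h ^ 2 * r + (1 / 32) * h ^ 3 + (-5 / 64) *
      h ^ 3 * r + (1 / 32) * h ^ 4 + (3 / 8) * g * h + (-3 / 4) * g * h * r + (45 / 32) * g
      * h * r ^ 2 + (-53 / 80) * g * h ^ 2 + (19 / 32) * g * h ^ 2 * r + (-65 / 64) * g * h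
      ^ 2 * r ^ 2 + (25 / 32) * g * h ^ 2 * r ^ 3 + (-13 / 160) * g * h ^ 3 + (1 / 32) * g
      * h ^ 3 * r + (-5 / 64) * g * h ^ 3 * r ^ 2 + (1 / 40) * g * h ^ 4 + (1 / 32) * g * h
      ^ 4 * r + (-3 / 32) * g ^ 2 + (15 / 64) * g ^ 2 * r + (-53 / 80) * g ^ 2 * h + (19 /
      32) * g ^ 2 * h * r + (-65 / 64) * g ^ 2 * h * r ^ 2 + (25 / 32) * g ^ 2 * h * r ^ 3
      + (511 / 320) * g ^ 2 * h ^ 2 + (-37 / 32) * g ^ 2 * h ^ 2 * r + (19 / 16) * g ^ 2 *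
      h ^ 2 * r ^ 2 + (-15 / 16) * g ^ 2 * h ^ 2 * r ^ 3 + (25 / 64) * g ^ 2 * h ^ 2 * r ^
      4 + (-9 / 80) * g ^ 2 * h ^ 3 + (7 / 64) * g ^ 2 * h ^ 3 * r + (-5 / 64) * g ^ 2 * h
      ^ 3 * r ^ 2 + (-1 / 160) * g ^ 2 * h ^ 4 + (1 / 32) * g ^ 2 * h ^ 4 * r + (1 / 32) *
      g ^ 3 + (-5 / 64) * g ^ 3 * r + (-13 / 160) * g ^ 3 * h + (1 / 32) * g ^ 3 * h * r +
      (-5 / 64) * g ^ 3 * h * r ^ 2 + (-9 / 80) * g ^ 3 * h ^ 2 + (7 / 64) * g ^ 3 * h ^ 2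
      * r + (-5 / 64) * g ^ 3 * h ^ 2 * r ^ 2 + (1 / 32) * g ^ 4 + (1 / 40) * g ^ 4 * h +
      (1 / 32) * g ^ 4 * h * r + (-1 / 160) * g ^ 4 * h ^ 2 + (1 / 32) * g ^ 4 * h ^ 2 * r) * hr
  rw [key]
  positivity

/-- The data of a dephasing channel for the angle `a` with `p = cos a` and `q = sin a`: the factors
`m₁` and `m₂` by which the two observables are contracted. The one closer to the observables of the
pair is left alone, the other one is contracted by `(1 + √2) (cos a + sin a - 1)`. -/
def IsDephasing (m₁ m₂ p q : ℝ) : Prop :=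
  0 ≤ p ∧ 0 ≤ q ∧ p ^ 2 + q ^ 2 = 1 ∧ ((q ≤ p ∧ m₁ = 1 ∧ m₂ = (1 + √2) * (p + q - 1)) ∨
    (p ≤ q ∧ m₂ = 1 ∧ m₁ = (1 + √2) * (p + q - 1)))

theorem sqrt_two_bounds : (1.4142 : ℝ) ≤ √2 ∧ √2 ≤ 1.41422 :=
  ⟨Real.le_sqrt_of_sq_le (by norm_num), Real.sqrt_le_iff.2 (by norm_num)⟩

/-- Both cases in terms of the contraction factor `g`, and a polynomial lower bound for
`(1 - g) |cos a - sin a|`. -/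
theorem IsDephasing.exists_param {m₁ m₂ p q : ℝ} (h : IsDephasing m₁ m₂ p q) :
    ∃ g : ℝ, 0 ≤ g ∧ g ≤ 1 ∧ m₁ + m₂ = 1 + g ∧ m₁ * m₂ = g ∧ p + q = 1 + (√2 - 1) * g ∧
      2 * (p * q) = (1 + (√2 - 1) * g) ^ 2 - 1 ∧
      (1 - g) ^ 2 * (1 + (2 - √2) * g + 2 / 5 * g ^ 2) ≤ (m₁ - m₂) * (p - q) := by
  obtain ⟨hp, hq, hpq, hm⟩ := h
  obtain ⟨r1, r2⟩ := sqrt_two_bounds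
  have hr : √2 ^ 2 = 2 := Real.sq_sqrt (by norm_num)
  set r := √2
  set g := (1 + r) * (p + q - 1) with hg
  have hs : p + q = 1 + (r - 1) * g := by
    rw [hg]
    linear_combination -(p + q - 1) * hr
  have hs2 : 2 * (p * q) = (1 + (r - 1) * g) ^ 2 - 1 := by
    rw [← hs]
    linear_combination -hpq
  have hg0 : 0 ≤ g := by
    refine mul_nonneg (by linarith) ?_
    have h1 : 1 ^ 2 ≤ (p + q) ^ 2 := by linarith [mul_nonneg hp hq]
    linarith [le_of_sq_le_sq h1 (add_nonneg hp hq)]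
  have hg1 : g ≤ 1 := by
    have h1 : (1 + (r - 1) * g) ^ 2 ≤ r ^ 2 := by linarith [sq_nonneg (p - q)]
    have h2 := le_of_sq_le_sq h1 (by linarith)
    by_contra! h
    have := mul_lt_mul_of_pos_left h (by linarith : 0 < r - 1)
    linarith
  have hf0 : 0 ≤ (1 - g) * (1 + (2 - r) * g + 2 / 5 * g ^ 2) :=
    mul_nonneg (by linarith) (by linarith [mul_nonneg (by linarith : 0 ≤ 2 - r) hg0, sq_nonneg g])
  have hf : (1 - g) * (1 + (2 - r) * g + 2 / 5 * g ^ 2) ≤ |p - q| := by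
    refine le_of_sq_le_sq ?_ (abs_nonneg _)
    have hd : (p - q) ^ 2 = 2 - (1 + (r - 1) * g) ^ 2 := by
      linear_combination hpq - hs2
    rw [sq_abs, hd]
    -- the gap is `1 - g` times a polynomial in `g` with nonnegative coefficients
    have hgap : 2 - (1 + (r - 1) * g) ^ 2 - ((1 - g) * (1 + (2 - r) * g + 2 / 5 * g ^ 2)) ^ 2 =
        (1 - g) * ((2 * (2 - r) - (2 - r) ^ 2 - 4 / 5) * g ^ 2 +
          ((2 - r) ^ 2 + 4 / 5 * (1 - (2 - r))) * g ^ 3 + (4 / 5 * (2 - r) - 4 / 25) * g ^ 4 +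
          4 / 25 * g ^ 5) := by
      linear_combination (-g ^ 2) * hr
    have hd2 : (2 - r) ^ 2 = 6 - 4 * r := by linear_combination hr
    have c1 : 0 ≤ 2 * (2 - r) - (2 - r) ^ 2 - 4 / 5 := by linarith
    have c2 : 0 ≤ (2 - r) ^ 2 + 4 / 5 * (1 - (2 - r)) := by linarith
    have c3 : 0 ≤ 4 / 5 * (2 - r) - 4 / 25 := by linarith
    have : 0 ≤ 2 - (1 + (r - 1) * g) ^ 2 -
        ((1 - g) * (1 + (2 - r) * g + 2 / 5 * g ^ 2)) ^ 2 := by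
      rw [hgap]
      exact mul_nonneg (by linarith) (by positivity)
    linarith
  have hD : (m₁ - m₂) * (p - q) = (1 - g) * |p - q| ∧ m₁ + m₂ = 1 + g ∧ m₁ * m₂ = g := by
    rcases hm with ⟨h, h1, h2⟩ | ⟨h, h1, h2⟩
    · rw [h1, h2, abs_of_nonneg (by linarith)]
      exact ⟨rfl, rfl, one_mul _⟩
    · rw [h1, h2, abs_of_nonpos (by linarith)]
      exact ⟨by ring, by ring, by ring⟩
  refine ⟨g, hg0, hg1, hD.2.1, hD.2.2, hs, hs2, ?_⟩
  rw [hD.1]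
  calc (1 - g) ^ 2 * (1 + (2 - r) * g + 2 / 5 * g ^ 2)
      = (1 - g) * ((1 - g) * (1 + (2 - r) * g + 2 / 5 * g ^ 2)) := by ring
    _ ≤ (1 - g) * |p - q| := mul_le_mul_of_nonneg_left hf (by linarith)

theorem plusForm_nonneg {r g t D D' : ℝ} (hr : r ^ 2 = 2) (r1 : 1.4142 ≤ r) (r2 : r ≤ 1.41422)
    (hg0 : 0 ≤ g) (hg1 : g ≤ 1) (ht0 : 0 ≤ t) (ht1 : t ≤ 1)
    (hgD : (1 - g) ^ 2 * (1 + (2 - r) * g + 2 / 5 * g ^ 2) ≤ D)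
    (htD : (1 - t) ^ 2 * (1 + (2 - r) * t + 2 / 5 * t ^ 2) ≤ D') : 0 ≤ plusForm r g t D D' := by
  have hs0 : 0 ≤ (4 + 5 * r) / 16 * r / 4 := by
    have : 0 ≤ r := by linarith
    positivity
  refine (bernstein_plus hr r1 hg0 (sub_nonneg.2 hg1) ht0 (sub_nonneg.2 ht1) rfl rfl).trans ?_
  have b1 : (1 - g) ^ 2 * (1 + (2 - r) * g) ≤ D :=
    le_trans (mul_le_mul_of_nonneg_left (by linarith [sq_nonneg g]) (sq_nonneg _)) hgD
  have b2 : (1 - t) ^ 2 * (1 + (2 - r) * t) ≤ D' :=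
    le_trans (mul_le_mul_of_nonneg_left (by linarith [sq_nonneg t]) (sq_nonneg _)) htD
  have b0 : 0 ≤ (1 - t) ^ 2 * (1 + (2 - r) * t) :=
    mul_nonneg (sq_nonneg _) (by linarith [mul_nonneg (by linarith : 0 ≤ 2 - r) ht0])
  have b0' : 0 ≤ (1 - g) ^ 2 * (1 + (2 - r) * g) :=
    mul_nonneg (sq_nonneg _) (by linarith [mul_nonneg (by linarith : 0 ≤ 2 - r) hg0])
  have := mul_le_mul_of_nonneg_left (mul_le_mul b1 b2 b0 (b0'.trans b1)) hs0
  rw [plusForm, plusForm]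
  linarith only [this]

theorem minusForm_nonneg {r g t D D' : ℝ} (hr : r ^ 2 = 2) (r1 : 1.4142 ≤ r) (r2 : r ≤ 1.41422)
    (hg0 : 0 ≤ g) (hg1 : g ≤ 1) (ht0 : 0 ≤ t) (ht1 : t ≤ 1)
    (hgD : (1 - g) ^ 2 * (1 + (2 - r) * g + 2 / 5 * g ^ 2) ≤ D)
    (htD : (1 - t) ^ 2 * (1 + (2 - r) * t + 2 / 5 * t ^ 2) ≤ D') : 0 ≤ minusForm r g t D D' := by
  have hs0 : 0 ≤ (4 + 5 * r) / 16 * r / 4 := by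
    have : 0 ≤ r := by linarith
    positivity
  refine (bernstein_minus hr r1 r2 hg0 (sub_nonneg.2 hg1) ht0 (sub_nonneg.2 ht1) rfl rfl).trans ?_
  have c1 : 0 ≤ (r - 1) * g := mul_nonneg (by linarith) hg0
  have c2 : 0 ≤ (r - 1) * t := mul_nonneg (by linarith) ht0
  have d1 := mul_le_mul_of_nonneg_left htD
    (mul_nonneg (by linarith : 0 ≤ 1 + g) (by linarith : 0 ≤ 1 + (r - 1) * g))
  have d2 := mul_le_mul_of_nonneg_left hgD
    (mul_nonneg (by linarith : 0 ≤ 1 + t) (by linarith : 0 ≤ 1 + (r - 1) * t))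
  have := mul_le_mul_of_nonneg_left (add_le_add d1 d2) hs0
  rw [minusForm, minusForm]
  linarith only [this]

/-- The scalar form of the operator inequality. The coefficients are those of the four products of
local observables; each of the two conditions says that one block is positive semidefinite. -/
theorem block_conditions {m₁ m₂ p q n₁ n₂ p' q' : ℝ} (h : IsDephasing m₁ m₂ p q)
    (h' : IsDephasing n₁ n₂ p' q') {s k₁ k₂ k₃ k₄ : ℝ} (hs : s = (4 + 5 * √2) / 16)
    (h₁ : k₁ = m₁ * n₁ * √2 / 8 - 2 * s * (p * p')) (h₂ : k₂ = m₂ * n₁ * √2 / 8 - 2 * s * (q * p'))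
    (h₃ : k₃ = m₁ * n₂ * √2 / 8 - 2 * s * (p * q'))
    (h₄ : k₄ = m₂ * n₂ * √2 / 8 - 2 * s * (q * q')) :
    0 ≤ m₁ * m₂ * n₁ * n₂ ∧ m₁ * m₂ * n₁ * n₂ ≤ 1 ∧
    (k₁ + k₄) ^ 2 + (k₂ + k₃) ^ 2 ≤ ((1 + √2) / 2 + m₁ * m₂ * n₁ * n₂ / 4) ^ 2 ∧
    (k₁ - k₄) ^ 2 + (k₂ - k₃) ^ 2 ≤ ((1 + √2) / 2 - m₁ * m₂ * n₁ * n₂ / 4) ^ 2 := by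
  obtain ⟨g, hg0, hg1, hgs, hgm, hge, hg2, hgD⟩ := h.exists_param
  obtain ⟨t, ht0, ht1, hts, htm, hte, ht2, htD⟩ := h'.exists_param
  have hpq := h.2.2.1
  have hpq' := h'.2.2.1
  obtain ⟨r1, r2⟩ := sqrt_two_bounds
  have hr : √2 ^ 2 = 2 := Real.sq_sqrt (by norm_num)
  have f1 := plusForm_nonneg hr r1 r2 hg0 hg1 ht0 ht1 hgD htD
  have f2 := minusForm_nonneg hr r1 r2 hg0 hg1 ht0 ht1 hgD htD
  clear h h' r1 r2 hgD htD
  generalize √2 = r at *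
  have hsum : m₁ ^ 2 + m₂ ^ 2 = 1 + g ^ 2 := by
    linear_combination (m₁ + m₂ + 1 + g) * hgs - 2 * hgm
  have hsum' : n₁ ^ 2 + n₂ ^ 2 = 1 + t ^ 2 := by
    linear_combination (n₁ + n₂ + 1 + t) * hts - 2 * htm
  have hmn : m₁ * m₂ * n₁ * n₂ = g * t := by rw [← hgm, ← htm]; ring
  have A0 : (m₁ ^ 2 + m₂ ^ 2) * (n₁ ^ 2 + n₂ ^ 2) = (1 + g ^ 2) * (1 + t ^ 2) := by
    rw [hsum, hsum']
  have A1 : ((m₁ + m₂) * (n₁ + n₂)) * ((p + q) * (p' + q')) =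
      (1 + g) * (1 + t) * ((1 + (r - 1) * g) * (1 + (r - 1) * t)) := by
    rw [hgs, hts, hge, hte]
  have A2 : (p ^ 2 + q ^ 2) * (p' ^ 2 + q' ^ 2) = 1 := by rw [hpq, hpq', one_mul]
  have A3 : 2 * (p * q) * (2 * (p' * q')) =
      ((1 + (r - 1) * g) ^ 2 - 1) * ((1 + (r - 1) * t) ^ 2 - 1) := by rw [hg2, ht2]
  have A4 : (m₁ + m₂) * (p + q) = (1 + g) * (1 + (r - 1) * g) := by rw [hgs, hge]
  have A5 : (n₁ + n₂) * (p' + q') = (1 + t) * (1 + (r - 1) * t) := by rw [hts, hte]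
  have e1 : ((1 + r) / 2 + m₁ * m₂ * n₁ * n₂ / 4) ^ 2 - ((k₁ + k₄) ^ 2 + (k₂ + k₃) ^ 2) =
      plusForm r g t ((m₁ - m₂) * (p - q)) ((n₁ - n₂) * (p' - q')) := by
    rw [h₁, h₂, h₃, h₄, plusForm, hmn, ← hs]
    linear_combination (-(r ^ 2 / 64)) * A0 + (s * r / 4) * A1 - 4 * s ^ 2 * (A2 + A3) -
      r ^ 2 / 16 * hmn - ((1 + g ^ 2) * (1 + t ^ 2) + 4 * g * t) / 64 * hr
  have e2 : ((1 + r) / 2 - m₁ * m₂ * n₁ * n₂ / 4) ^ 2 - ((k₁ - k₄) ^ 2 + (k₂ - k₃) ^ 2) =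
      minusForm r g t ((m₁ - m₂) * (p - q)) ((n₁ - n₂) * (p' - q')) := by
    rw [h₁, h₂, h₃, h₄, minusForm, hmn, ← hs]
    linear_combination (-(r ^ 2 / 64)) * A0 + (s * r / 4) * ((n₁ - n₂) * (p' - q')) * A4 +
      (s * r / 4) * ((m₁ - m₂) * (p - q)) * A5 - 4 * s ^ 2 * (A2 - A3) +
      r ^ 2 / 16 * hmn - ((1 + g ^ 2) * (1 + t ^ 2) - 4 * g * t) / 64 * hr
  refine ⟨by rw [hmn]; positivity, by rw [hmn]; exact mul_le_one₀ hg1 ht0 ht1,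
    sub_nonneg.1 (e1 ▸ f1), sub_nonneg.1 (e2 ▸ f2)⟩

/-! ### The two-qubit operator inequality -/

theorem posSemidef_two_by_two {r u w : ℝ} (hr : 0 ≤ r) (h : u ^ 2 + w ^ 2 ≤ r ^ 2) :
    (!![((r + u : ℝ) : ℂ), (w : ℂ); (w : ℂ), ((r - u : ℝ) : ℂ)]).PosSemidef := by
  have key (a b : ℝ) : 0 ≤ (r + u) * a ^ 2 + (r - u) * b ^ 2 + 2 * w * (a * b) := by
    have h1 : (u * (a ^ 2 - b ^ 2) + w * (2 * (a * b))) ^ 2 ≤ (r * (a ^ 2 + b ^ 2)) ^ 2 := by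
      have e1 : (u * (a ^ 2 - b ^ 2) + w * (2 * (a * b))) ^ 2 =
          (u ^ 2 + w ^ 2) * (a ^ 2 + b ^ 2) ^ 2 -
            (u * (2 * (a * b)) - w * (a ^ 2 - b ^ 2)) ^ 2 := by ring
      have e2 := mul_le_mul_of_nonneg_right h (sq_nonneg (a ^ 2 + b ^ 2))
      rw [e1, mul_pow]
      linarith [sq_nonneg (u * (2 * (a * b)) - w * (a ^ 2 - b ^ 2))]
    have h2 := (abs_le_of_sq_le_sq' h1 (by positivity)).1
    linarith
  refine Matrix.PosSemidef.of_dotProduct_mulVec_nonneg ?_ fun x => ?_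
  · ext i j
    fin_cases i <;> fin_cases j <;> simp
  · rw [Complex.le_def]
    simp only [dotProduct, Matrix.mulVec, Fin.sum_univ_two, Pi.star_apply, Complex.star_def,
      Matrix.of_apply, Matrix.cons_val_zero, Matrix.cons_val_one, Matrix.cons_val',
      Matrix.cons_val_fin_one, Complex.add_re, Complex.add_im, Complex.mul_re, Complex.mul_im,
      Complex.conj_re, Complex.conj_im, Complex.ofReal_re, Complex.ofReal_im, Complex.zero_re,
      Complex.zero_im]
    constructor
    · linarith [key (x 0).re (x 1).re, key (x 0).im (x 1).im]
    · ring

/-- The two-qubit operator with the given coefficients with respect to `1 ⊗ 1`, `Z ⊗ Z`, `X ⊗ Z`,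
`Z ⊗ X`, `X ⊗ X` and `Y ⊗ Y`. -/
def pauliSum (c α β γ δ ε : ℝ) : Matrix (Fin 2 × Fin 2) (Fin 2 × Fin 2) ℂ :=
  c • (1 : Matrix (Fin 2) (Fin 2) ℂ) ⊗ₖ (1 : Matrix (Fin 2) (Fin 2) ℂ) +
    α • qubitObs 1 ⊗ₖ qubitObs 1 + β • qubitObs Complex.I ⊗ₖ qubitObs 1 +
    γ • qubitObs 1 ⊗ₖ qubitObs Complex.I + δ • qubitObs Complex.I ⊗ₖ qubitObs Complex.I -
    ε • bellMat 3 ⊗ₖ bellMat 3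

/-- In the Bell basis `pauliSum` splits into two real symmetric `2 × 2` blocks. -/
theorem posSemidef_pauliSum {c α β γ δ ε : ℝ} (h₁ : 0 ≤ c + ε) (h₂ : 0 ≤ c - ε)
    (h₃ : (α - δ) ^ 2 + (β + γ) ^ 2 ≤ (c + ε) ^ 2)
    (h₄ : (α + δ) ^ 2 + (γ - β) ^ 2 ≤ (c - ε) ^ 2) : (pauliSum c α β γ δ ε).PosSemidef := by
  let W (a b : Fin 4) : Matrix (Fin 2) (Fin 2 × Fin 2) ℂ :=
    Matrix.of ![fun p => bellMat a p.1 p.2, fun p => bellMat b p.1 p.2]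
  have e : pauliSum c α β γ δ ε = (1 / 2 : ℝ) •
      ((W 1 2)ᴴ * !![((c + ε + (α - δ) : ℝ) : ℂ), ((β + γ : ℝ) : ℂ); ((β + γ : ℝ) : ℂ),
        ((c + ε - (α - δ) : ℝ) : ℂ)] * W 1 2 +
      (W 0 3)ᴴ * !![((c - ε + (α + δ) : ℝ) : ℂ), ((γ - β : ℝ) : ℂ); ((γ - β : ℝ) : ℂ),
        ((c - ε - (α + δ) : ℝ) : ℂ)] * W 0 3) := by
    ext ⟨i, j⟩ ⟨k, l⟩
    fin_cases i <;> fin_cases j <;> fin_cases k <;> fin_cases l <;>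
      simp [pauliSum, W, bellMat, qubitObs, Matrix.mul_apply, Fin.sum_univ_two] <;> ring
  rw [e]
  exact (((posSemidef_two_by_two h₁ h₃).conjTranspose_mul_mul_same _).add
    ((posSemidef_two_by_two h₂ h₄).conjTranspose_mul_mul_same _)).smul (by norm_num)

/-- The signs of the correlators of Alice's first observable in `CHSH_b`, which are those of `Z ⊗ Z`
in the Bell state `Φ^b`. -/
def signZ : Fin 4 → ℝ := ![1, 1, -1, -1]

/-- The signs of the correlators of Alice's second observable in `CHSH_b`, which are those of
`X ⊗ X` in `Φ^b`. -/
def signX : Fin 4 → ℝ := ![1, -1, 1, -1]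

theorem bellMeasurement_eq_pauliSum (b : Fin 4) : bellMeasurement b =
    (1 / 4 : ℝ) • ((1 : Matrix (Fin 2) (Fin 2) ℂ) ⊗ₖ (1 : Matrix (Fin 2) (Fin 2) ℂ) +
      signZ b • qubitObs 1 ⊗ₖ qubitObs 1 + signX b • qubitObs Complex.I ⊗ₖ qubitObs Complex.I +
      (signZ b * signX b) • bellMat 3 ⊗ₖ bellMat 3) := by
  ext ⟨i, j⟩ ⟨k, l⟩
  rw [bellMeasurement_apply]
  fin_cases b <;> fin_cases i <;> fin_cases j <;> fin_cases k <;> fin_cases l <;>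
    simp [bellMat, qubitObs, signZ, signX] <;> norm_num

/-- The slope of the affine function `g`. -/
def slope : ℝ := (4 + 5 * √2) / 16

/-- The intercept of the affine function `g`. -/
def intercept : ℝ := -(1 + 2 * √2) / 4

theorem qubitObs_smul_add (a b : ℝ) (v w : ℂ) :
    a • qubitObs v + b • qubitObs w = qubitObs (a * v + b * w) := by
  ext i j
  fin_cases i <;> fin_cases j <;> simp [qubitObs]
  ring

/-- The operator inequality for a pair of qubits: the Bell projector `Φ^b`, dephased on both sides,
dominates `slope * CHSH_b + intercept` for the qubit observables with the given angles. Here `Z`,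
`X`, `J` are the images of the Pauli matrices under Alice's dephasing, `Z'`, `X'`, `J'` those under
Charlie's. -/
theorem posSemidef_dephased_sub {m₁ m₂ p q n₁ n₂ p' q' : ℝ} (h : IsDephasing m₁ m₂ p q)
    (h' : IsDephasing n₁ n₂ p' q') (b : Fin 4) {r : ℝ} (hr : r = √2)
    {Z X J Z' X' J' A₀ A₁ C₀ C₁ : Matrix (Fin 2) (Fin 2) ℂ}
    (hZ : Z = qubitObs ((m₁ + m₂) / 2 + (m₁ - m₂) / 2 * Complex.I))
    (hX : X = qubitObs ((m₁ + m₂) / 2 * Complex.I + (m₁ - m₂) / 2))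
    (hJ : J = (m₁ * m₂) • bellMat 3) (hZ' : Z' = qubitObs n₁) (hX' : X' = qubitObs (n₂ * Complex.I))
    (hJ' : J' = (n₁ * n₂) • bellMat 3)
    (hA₀ : A₀ = qubitObs (((p + q) * r / 2 : ℝ) + ((p - q) * r / 2 : ℝ) * Complex.I))
    (hA₁ : A₁ = qubitObs (((p - q) * r / 2 : ℝ) + ((p + q) * r / 2 : ℝ) * Complex.I))
    (hC₀ : C₀ = qubitObs (p' + q' * Complex.I)) (hC₁ : C₁ = qubitObs (p' - q' * Complex.I)) :
    ((1 / 4 : ℝ) • ((1 : Matrix (Fin 2) (Fin 2) ℂ) ⊗ₖ (1 : Matrix (Fin 2) (Fin 2) ℂ) +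
      signZ b • Z ⊗ₖ Z' + signX b • X ⊗ₖ X' + (signZ b * signX b) • J ⊗ₖ J') -
      slope • (signZ b • A₀ ⊗ₖ (C₀ + C₁) + signX b • A₁ ⊗ₖ (C₀ - C₁)) -
      intercept • (1 : Matrix (Fin 2) (Fin 2) ℂ) ⊗ₖ (1 : Matrix (Fin 2) (Fin 2) ℂ)).PosSemidef := by
  obtain ⟨hm0, hm1, hc, hd⟩ := block_conditions h h' (s := slope) rfl rfl rfl rfl rfl
  have hr2 : r ^ 2 = 2 := by rw [hr, Real.sq_sqrt (by norm_num)]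
  have hr0 : 0 ≤ r := hr ▸ Real.sqrt_nonneg _
  rw [← hr] at hc hd
  have hint : 1 / 4 - intercept = (1 + r) / 2 := by rw [intercept, hr]; ring
  set s := slope
  set i₀ := intercept
  set z := signZ b with hz
  set x := signX b with hx
  set α := z * ((m₁ + m₂) * n₁ / 8 - s * p' * ((p + q) * r)) with hα
  set β := z * ((m₁ - m₂) * n₁ / 8 - s * p' * ((p - q) * r)) with hβ
  set γ := x * ((m₁ - m₂) * n₂ / 8 - s * q' * ((p - q) * r)) with hγ
  set δ := x * ((m₁ + m₂) * n₂ / 8 - s * q' * ((p + q) * r)) with hδ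
  have e : (1 / 4 : ℝ) • ((1 : Matrix (Fin 2) (Fin 2) ℂ) ⊗ₖ (1 : Matrix (Fin 2) (Fin 2) ℂ) +
      z • Z ⊗ₖ Z' + x • X ⊗ₖ X' + (z * x) • J ⊗ₖ J') -
      s • (z • A₀ ⊗ₖ (C₀ + C₁) + x • A₁ ⊗ₖ (C₀ - C₁)) -
      i₀ • (1 : Matrix (Fin 2) (Fin 2) ℂ) ⊗ₖ (1 : Matrix (Fin 2) (Fin 2) ℂ) =
      pauliSum (1 / 4 - i₀) α β γ δ (-(z * x * (m₁ * m₂ * n₁ * n₂) / 4)) := by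
    rw [hZ, hX, hJ, hZ', hX', hJ', hA₀, hA₁, hC₀, hC₁, pauliSum, hα, hβ, hγ, hδ]
    ext ⟨i, j⟩ ⟨k, l⟩
    fin_cases i <;> fin_cases j <;> fin_cases k <;> fin_cases l <;>
      simp [bellMat, qubitObs] <;> ring
  rw [e]
  have hzx : (z = 1 ∨ z = -1) ∧ (x = 1 ∨ x = -1) := by
    rw [hz, hx]
    fin_cases b <;> simp [signZ, signX]
  rw [hint]
  have hp : 0 ≤ (1 + r) / 2 + m₁ * m₂ * n₁ * n₂ / 4 := by linarith
  have hq : 0 ≤ (1 + r) / 2 - m₁ * m₂ * n₁ * n₂ / 4 := by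
    have : 1 ≤ r := by
      rw [hr]
      exact Real.one_le_sqrt.2 (by norm_num)
    linarith
  clear_value s
  set k₁ := m₁ * n₁ * r / 8 - 2 * s * (p * p') with h₁
  set k₂ := m₂ * n₁ * r / 8 - 2 * s * (q * p') with h₂
  set k₃ := m₁ * n₂ * r / 8 - 2 * s * (p * q') with h₃
  set k₄ := m₂ * n₂ * r / 8 - 2 * s * (q * q') with h₄
  have eα : α = z * (k₁ + k₂) * r / 2 := by
    rw [hα, h₁, h₂]; linear_combination (-(z * (m₁ + m₂) * n₁ / 16)) * hr2
  have eβ : β = z * (k₁ - k₂) * r / 2 := by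
    rw [hβ, h₁, h₂]; linear_combination (-(z * (m₁ - m₂) * n₁ / 16)) * hr2
  have eγ : γ = x * (k₃ - k₄) * r / 2 := by
    rw [hγ, h₃, h₄]; linear_combination (-(x * (m₁ - m₂) * n₂ / 16)) * hr2
  have eδ : δ = x * (k₃ + k₄) * r / 2 := by
    rw [hδ, h₃, h₄]; linear_combination (-(x * (m₁ + m₂) * n₂ / 16)) * hr2
  clear_value α β γ δ k₁ k₂ k₃ k₄ z x
  set M := m₁ * m₂ * n₁ * n₂ / 4
  have e₁ : (α - δ) ^ 2 + (β + γ) ^ 2 =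
      (z ^ 2 * (k₁ ^ 2 + k₂ ^ 2) + x ^ 2 * (k₃ ^ 2 + k₄ ^ 2)) -
        2 * (z * x) * (k₁ * k₄ + k₂ * k₃) := by
    rw [eα, eβ, eγ, eδ]
    linear_combination (((z * (k₁ + k₂) - x * (k₃ + k₄)) ^ 2 +
      (z * (k₁ - k₂) + x * (k₃ - k₄)) ^ 2) / 4) * hr2
  have e₂ : (α + δ) ^ 2 + (γ - β) ^ 2 =
      (z ^ 2 * (k₁ ^ 2 + k₂ ^ 2) + x ^ 2 * (k₃ ^ 2 + k₄ ^ 2)) +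
        2 * (z * x) * (k₁ * k₄ + k₂ * k₃) := by
    rw [eα, eβ, eγ, eδ]
    linear_combination (((z * (k₁ + k₂) + x * (k₃ + k₄)) ^ 2 +
      (z * (k₁ - k₂) - x * (k₃ - k₄)) ^ 2) / 4) * hr2
  have eε : z * x * (m₁ * m₂ * n₁ * n₂) / 4 = z * x * M := by ring
  rw [eε]
  apply posSemidef_pauliSum
  · rcases hzx with ⟨rfl | rfl, rfl | rfl⟩ <;> linarith only [hp, hq]
  · rcases hzx with ⟨rfl | rfl, rfl | rfl⟩ <;> linarith only [hp, hq]
  · rw [e₁]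
    rcases hzx with ⟨rfl | rfl, rfl | rfl⟩ <;> linarith only [hc, hd]
  · rw [e₂]
    rcases hzx with ⟨rfl | rfl, rfl | rfl⟩ <;> linarith only [hc, hd]

/-! ### Extraction of a pair of qubits -/

theorem qubitObs_conj (w v : ℂ) :
    (qubitObs w)ᴴ * qubitObs v * qubitObs w = qubitObs (w ^ 2 * star v) := by
  ext i j
  fin_cases i <;> fin_cases j <;>
    simp [qubitObs, Matrix.mul_apply, Fin.sum_univ_two, pow_two] <;> ring

theorem qubitObs_conj_one {w : ℂ} (hw : w * star w = 1) :
    (qubitObs w)ᴴ * qubitObs w = 1 := by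
  have h : (w.re : ℂ) * w.re + w.im * w.im = 1 := by
    have := congrArg Complex.re hw
    simp at this
    exact_mod_cast this
  ext i j
  fin_cases i <;> fin_cases j <;>
    simp [qubitObs, Matrix.mul_apply, Fin.sum_univ_two]
  · exact h
  · ring
  · ring
  · linear_combination h

theorem qubitObs_conj_bellMat {w : ℂ} (hw : w * star w = 1) :
    (qubitObs w)ᴴ * bellMat 3 * qubitObs w = -bellMat 3 := by
  have h : (w.re : ℂ) * w.re + w.im * w.im = 1 := by
    have := congrArg Complex.re hw
    simp at this
    exact_mod_cast this
  ext i j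
  fin_cases i <;> fin_cases j <;>
    simp [qubitObs, bellMat, Matrix.mul_apply, Fin.sum_univ_two]
  · ring
  · linear_combination -h
  · linear_combination h
  · ring

/-- Kraus operators of the channel that applies the reflection `qubitObs w` with probability
`(1 - g) / 2`. -/
theorem exists_kraus {g : ℝ} (h0 : 0 ≤ g) (h1 : g ≤ 1) {w : ℂ} (hw : w * star w = 1) :
    ∃ K : Fin 2 → Matrix (Fin 2) (Fin 2) ℂ, ∑ i, (K i)ᴴ * K i = 1 ∧
      (∀ v, ∑ i, (K i)ᴴ * qubitObs v * K i =
        qubitObs (((1 + g) / 2 : ℝ) * v + ((1 - g) / 2 : ℝ) * (w ^ 2 * star v))) ∧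
      ∑ i, (K i)ᴴ * bellMat 3 * K i = g • bellMat 3 := by
  have e₁ : √((1 + g) / 2) * √((1 + g) / 2) = (1 + g) / 2 := Real.mul_self_sqrt (by linarith)
  have e₂ : √((1 - g) / 2) * √((1 - g) / 2) = (1 - g) / 2 := Real.mul_self_sqrt (by linarith)
  refine ⟨![√((1 + g) / 2) • 1, √((1 - g) / 2) • qubitObs w], ?_, fun v => ?_, ?_⟩ <;>
    simp only [Fin.sum_univ_two, Matrix.cons_val_zero, Matrix.cons_val_one,
      Matrix.conjTranspose_smul, star_trivial, Matrix.smul_mul, Matrix.mul_smul, smul_smul, e₁, e₂,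
      Matrix.conjTranspose_one, one_mul, mul_one, qubitObs_conj, qubitObs_conj_one hw,
      qubitObs_conj_bellMat hw, qubitObs_smul_add]
  · rw [← add_smul]
    norm_num [← add_div]
  · rw [smul_neg, ← sub_eq_add_neg, ← sub_smul]
    congr 1
    ring

/-- The dephasing channel for the angle of `z`: it applies the reflection `qubitObs w`, or the one
perpendicular to it, whichever is closer to the observables `qubitObs (w * z)` and
`qubitObs (w * star z)`. -/
theorem exists_dephasing {z : ℂ} (hz : z * star z = 1) (h0 : 0 ≤ z.re) (h1 : 0 ≤ z.im) {w : ℂ}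
    (hw : w * star w = 1) :
    ∃ (m₁ m₂ : ℝ) (K : Fin 2 → Matrix (Fin 2) (Fin 2) ℂ), IsDephasing m₁ m₂ z.re z.im ∧
      ∑ i, (K i)ᴴ * K i = 1 ∧
      (∀ v, ∑ i, (K i)ᴴ * qubitObs v * K i =
        qubitObs (((m₁ + m₂) / 2 : ℝ) * v + ((m₁ - m₂) / 2 : ℝ) * (w ^ 2 * star v))) ∧
      ∑ i, (K i)ᴴ * bellMat 3 * K i = (m₁ * m₂) • bellMat 3 := by
  have hpq : z.re ^ 2 + z.im ^ 2 = 1 := by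
    have := congrArg Complex.re hz
    simp at this
    linarith
  set g := (1 + √2) * (z.re + z.im - 1) with hg
  rcases le_total z.im z.re with h | h
  · have hD : IsDephasing 1 g z.re z.im := ⟨h0, h1, hpq, Or.inl ⟨h, rfl, hg⟩⟩
    obtain ⟨g', a, b, -, e, -⟩ := hD.exists_param
    rw [one_mul] at e
    obtain ⟨K, hK⟩ := exists_kraus (e ▸ a) (e ▸ b) hw
    exact ⟨1, g, K, hD, by rwa [one_mul]⟩
  · have hD : IsDephasing g 1 z.re z.im := ⟨h0, h1, hpq, Or.inr ⟨h, rfl, hg⟩⟩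
    obtain ⟨g', a, b, -, e, -⟩ := hD.exists_param
    rw [mul_one] at e
    obtain ⟨K, hK1, hK2, hK3⟩ := exists_kraus (w := Complex.I * w) (e ▸ a) (e ▸ b) (by
      rw [star_mul', Complex.star_def, Complex.conj_I, ← Complex.star_def]
      linear_combination (-Complex.I ^ 2) * hw - Complex.I_sq)
    refine ⟨g, 1, K, hD, hK1, fun v => ?_, by rwa [mul_one]⟩
    rw [hK2, mul_pow, Complex.I_sq]
    congr 1
    push_cast
    ring

theorem sum_conj_kronecker {ι ι' n n' m m' : Type*} [Fintype ι] [Fintype ι'] [Fintype n]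
    [Fintype n'] [Fintype m] [Fintype m'] (V : ι → Matrix m n ℂ) (V' : ι' → Matrix m' n' ℂ)
    (X : ι → Matrix m m ℂ) (Y : ι' → Matrix m' m' ℂ) :
    ∑ k, ∑ l, (V k ⊗ₖ V' l)ᴴ * (X k ⊗ₖ Y l) * (V k ⊗ₖ V' l) =
      (∑ k, (V k)ᴴ * X k * V k) ⊗ₖ (∑ l, (V' l)ᴴ * Y l * V' l) := by
  simp only [Matrix.conjTranspose_kronecker, ← Matrix.mul_kronecker_mul]
  ext p q
  simp only [Matrix.sum_apply, Matrix.kroneckerMap_apply, Finset.sum_mul_sum]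

theorem kronecker_sub {m n m' n' : Type*} (X : Matrix m n ℂ) (Y Z : Matrix m' n' ℂ) :
    X ⊗ₖ (Y - Z) = X ⊗ₖ Y - X ⊗ₖ Z := by
  ext p q
  simp [mul_sub]

/-- The phase `exp (i π / 4)`. -/
theorem star_frame : ((1 + Complex.I) * (√2 / 2 : ℝ)) * star ((1 + Complex.I) * (√2 / 2 : ℝ)) =
    (1 : ℂ) ∧ ((1 + Complex.I) * (√2 / 2 : ℝ)) ^ 2 = Complex.I := by
  have h : ((√2 / 2 : ℝ) : ℂ) ^ 2 = 1 / 2 := by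
    rw [← Complex.ofReal_pow, div_pow, Real.sq_sqrt (by norm_num)]
    norm_num
  constructor
  · rw [star_mul', Complex.star_def, Complex.conj_ofReal, map_add, map_one,
      Complex.conj_I]
    linear_combination (1 - Complex.I ^ 2) * h - 1 / 2 * Complex.I_sq
  · linear_combination (1 + Complex.I) ^ 2 * h + 1 / 2 * Complex.I_sq

section Extraction

variable {n n' : Type*} [Fintype n] [DecidableEq n] [Fintype n'] [DecidableEq n']

/-- One party's part of the extraction: the Kraus operators `L` of the extraction channel, which
dephases each of the qubits in `exists_qubit_decomposition`. -/
theorem exists_local_extraction {A₀ A₁ : Matrix n n ℂ}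
    (h₀ : (1 - A₀).PosSemidef ∧ (1 + A₀).PosSemidef)
    (h₁ : (1 - A₁).PosSemidef ∧ (1 + A₁).PosSemidef) {ζ w : ℂ} (hζ : ζ * star ζ = 1)
    (hw : w * star w = 1) :
    ∃ (L : n × Fin 2 → Matrix (Fin 2) n ℂ) (V : n → Matrix (Fin 2) n ℂ) (z : n → ℂ)
      (m₁ m₂ : n → ℝ), (∀ k, IsDephasing (m₁ k) (m₂ k) (z k).re (z k).im) ∧
      ∑ κ, (L κ)ᴴ * L κ = 1 ∧
      (∀ v, ∑ κ, (L κ)ᴴ * qubitObs v * L κ = ∑ k, (V k)ᴴ * qubitObs (((m₁ k + m₂ k) / 2 : ℝ) * v +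
        ((m₁ k - m₂ k) / 2 : ℝ) * (w ^ 2 * star v)) * V k) ∧
      ∑ κ, (L κ)ᴴ * bellMat 3 * L κ = ∑ k, (V k)ᴴ * ((m₁ k * m₂ k) • bellMat 3) * V k ∧
      ∑ k, (V k)ᴴ * (1 : Matrix (Fin 2) (Fin 2) ℂ) * V k = 1 ∧
      ∑ k, (V k)ᴴ * qubitObs (ζ * star (z k)) * V k = A₀ ∧
      ∑ k, (V k)ᴴ * qubitObs (ζ * z k) * V k = A₁ := by
  obtain ⟨V, z, hz, hV, hA₀, hA₁⟩ := exists_qubit_decomposition h₀ h₁ hζ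
  choose m₁ m₂ K hD hK hKv hKJ using fun k => exists_dephasing (hz k).1 (hz k).2.1 (hz k).2.2 hw
  have key (X : Matrix (Fin 2) (Fin 2) ℂ) :
      ∑ κ : n × Fin 2, (K κ.1 κ.2 * V κ.1)ᴴ * X * (K κ.1 κ.2 * V κ.1) =
        ∑ k, (V k)ᴴ * (∑ i, (K k i)ᴴ * X * K k i) * V k := by
    simp only [Fintype.sum_prod_type, Matrix.mul_sum, Matrix.sum_mul, Matrix.conjTranspose_mul,
      Matrix.mul_assoc]
  refine ⟨fun κ => K κ.1 κ.2 * V κ.1, V, z, m₁, m₂, hD, ?_, fun v => ?_, ?_, ?_, hA₀, hA₁⟩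
  · have := key 1
    simp only [mul_one, hK, hV, Matrix.mul_one] at this
    exact this
  · rw [key]
    simp only [hKv]
  · rw [key]
    simp only [hKJ]
  · simpa only [Matrix.mul_one] using hV

/-- **Extraction.** For any two pairs of contractive observables there are local channels, given
here by the Kraus operators `L` and `L'` in the Heisenberg picture, which map the Bell projectors
to operators that dominate an affine function of the operators of the `CHSH_b`. -/
theorem exists_extraction {A₀ A₁ : Matrix n n ℂ} {C₀ C₁ : Matrix n' n' ℂ}
    (hA₀ : (1 - A₀).PosSemidef ∧ (1 + A₀).PosSemidef)
    (hA₁ : (1 - A₁).PosSemidef ∧ (1 + A₁).PosSemidef)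
    (hC₀ : (1 - C₀).PosSemidef ∧ (1 + C₀).PosSemidef)
    (hC₁ : (1 - C₁).PosSemidef ∧ (1 + C₁).PosSemidef) :
    ∃ (L : n × Fin 2 → Matrix (Fin 2) n ℂ) (L' : n' × Fin 2 → Matrix (Fin 2) n' ℂ),
      ∑ κ, (L κ)ᴴ * L κ = 1 ∧ ∑ κ, (L' κ)ᴴ * L' κ = 1 ∧
      ∀ b, (∑ κ, ∑ l, (L κ ⊗ₖ L' l)ᴴ * bellMeasurement b * (L κ ⊗ₖ L' l) -
        slope • (signZ b • A₀ ⊗ₖ (C₀ + C₁) + signX b • A₁ ⊗ₖ (C₀ - C₁)) -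
        intercept • (1 : Matrix (n × n') (n × n') ℂ)).PosSemidef := by
  -- Alice's frame is rotated by `π / 4` with respect to that of Charlie, whose two observables are
  -- taken in the opposite order
  obtain ⟨hf, hf2⟩ := star_frame
  obtain ⟨L, V, z, m₁, m₂, hD, hL, hLv, hLJ, hV, rfl, rfl⟩ :=
    exists_local_extraction hA₀ hA₁ hf hf
  obtain ⟨L', V', z', n₁, n₂, hD', hL', hLv', hLJ', hV', rfl, rfl⟩ :=
    exists_local_extraction (ζ := 1) (w := 1) hC₁ hC₀ (by simp) (by simp)
  refine ⟨L, L', hL, hL', fun b => ?_⟩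
  have hL1 : ∑ κ, (L κ)ᴴ * (1 : Matrix (Fin 2) (Fin 2) ℂ) * L κ = 1 := by simpa using hL
  have hL1' : ∑ κ, (L' κ)ᴴ * (1 : Matrix (Fin 2) (Fin 2) ℂ) * L' κ = 1 := by simpa using hL'
  have key := Matrix.posSemidef_sum Finset.univ fun k _ => Matrix.posSemidef_sum Finset.univ
    fun l _ => (posSemidef_dephased_sub (hD k) (hD' l) b rfl rfl rfl rfl rfl rfl rfl rfl rfl rfl
      rfl).conjTranspose_mul_mul_same (V k ⊗ₖ V' l)
  convert key using 1
  have hz (k) : (1 + Complex.I) * ((√2 / 2 : ℝ) : ℂ) * z k =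
      ((((z k).re - (z k).im) * √2 / 2 : ℝ) : ℂ) +
        ((((z k).re + (z k).im) * √2 / 2 : ℝ) : ℂ) * Complex.I := by
    apply Complex.ext <;> simp <;> ring
  have hz' (k) : (1 + Complex.I) * ((√2 / 2 : ℝ) : ℂ) * star (z k) =
      ((((z k).re + (z k).im) * √2 / 2 : ℝ) : ℂ) +
        ((((z k).re - (z k).im) * √2 / 2 : ℝ) : ℂ) * Complex.I := by
    apply Complex.ext <;> simp <;> ring
  have hz'' (l) : 1 * z' l = (z' l).re + (z' l).im * Complex.I := by
    apply Complex.ext <;> simp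
  have hz''' (l) : 1 * star (z' l) = (z' l).re - (z' l).im * Complex.I := by
    apply Complex.ext <;> simp
  rw [bellMeasurement_eq_pauliSum, ← Matrix.one_kronecker_one (m := n) (n := n')]
  simp only [hL1, hL1', hLv, hLJ, hLv', hLJ', Matrix.mul_sub, Matrix.sub_mul,
    Matrix.mul_add, Matrix.add_mul, Matrix.mul_smul, Matrix.smul_mul,
    Finset.sum_add_distrib, Finset.sum_sub_distrib, ← Finset.smul_sum,
    Matrix.kronecker_add, kronecker_sub, sum_conj_kronecker, hV, hV', hz, hz', hz'', hz''']
  rw [hf2]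
  have hZ (k) : ((((m₁ k + m₂ k) / 2 : ℝ) : ℂ) * 1 +
      (((m₁ k - m₂ k) / 2 : ℝ) : ℂ) * (Complex.I * star 1)) =
      (m₁ k + m₂ k) / 2 + (m₁ k - m₂ k) / 2 * Complex.I := by
    push_cast
    rw [star_one]
    ring
  have hX (k) : ((((m₁ k + m₂ k) / 2 : ℝ) : ℂ) * Complex.I +
      (((m₁ k - m₂ k) / 2 : ℝ) : ℂ) * (Complex.I * star Complex.I)) =
      (m₁ k + m₂ k) / 2 * Complex.I + (m₁ k - m₂ k) / 2 := by
    push_cast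
    rw [Complex.star_def, Complex.conj_I]
    linear_combination (-((m₁ k : ℂ) - m₂ k) / 2) * Complex.I_sq
  have hZ' (l) : ((((n₁ l + n₂ l) / 2 : ℝ) : ℂ) * 1 +
      (((n₁ l - n₂ l) / 2 : ℝ) : ℂ) * (1 ^ 2 * star 1)) = n₁ l := by
    push_cast
    rw [star_one]
    ring
  have hX' (l) : ((((n₁ l + n₂ l) / 2 : ℝ) : ℂ) * Complex.I +
      (((n₁ l - n₂ l) / 2 : ℝ) : ℂ) * (1 ^ 2 * star Complex.I)) = n₂ l * Complex.I := by
    push_cast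
    rw [Complex.star_def, Complex.conj_I]
    ring
  simp only [hZ, hX, hZ', hX']

end Extraction

/-! ### From extracted qubits to a simulation of the Bell-state measurement -/

/-- The diagonal qubit operator with entries `a` and `b`. -/
def diagMat (a b : ℝ) : Matrix (Fin 2) (Fin 2) ℂ := !![(a : ℂ), 0; 0, (b : ℂ)]

theorem diagMat_mul (a b c d : ℝ) : diagMat a b * diagMat c d = diagMat (a * c) (b * d) := by
  ext i j
  fin_cases i <;> fin_cases j <;> simp [diagMat, Matrix.mul_apply, Fin.sum_univ_two]

theorem diagMat_one : diagMat 1 1 = 1 := by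
  ext i j
  fin_cases i <;> fin_cases j <;> simp [diagMat]

theorem conjTranspose_diagMat (a b : ℝ) : (diagMat a b)ᴴ = diagMat a b := by
  ext i j
  fin_cases i <;> fin_cases j <;> simp [diagMat]

theorem trace_diagMat (a b : ℝ) : (diagMat a b).trace.re = a + b := by
  simp [diagMat, Matrix.trace_fin_two]

theorem posSemidef_diagMat {a b : ℝ} (ha : 0 ≤ a) (hb : 0 ≤ b) : (diagMat a b).PosSemidef := by
  have := Matrix.PosSemidef.diagonal (R := ℂ) (d := ![(a : ℂ), (b : ℂ)]) (by
    intro k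
    fin_cases k <;> simp [ha, hb])
  convert this using 1
  ext i j
  fin_cases i <;> fin_cases j <;> simp [diagMat]

/-- Spectral decomposition of the state of a qubit with Bloch vector of length `η`. -/
theorem exists_spectral {σ : Matrix (Fin 2) (Fin 2) ℂ} (hσ : σ.PosSemidef) (h1 : σ.trace = 1) :
    ∃ (U : Matrix (Fin 2) (Fin 2) ℂ) (η : ℝ), Uᴴ * U = 1 ∧ 0 ≤ η ∧
      σ = U * diagMat ((1 + η) / 2) ((1 - η) / 2) * Uᴴ := by
  obtain ⟨U, a, b, hU, rfl⟩ : ∃ (U : Matrix (Fin 2) (Fin 2) ℂ) (a b : ℝ), Uᴴ * U = 1 ∧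
      σ = U * diagMat a b * Uᴴ := by
    refine ⟨hσ.1.eigenvectorUnitary.1, hσ.1.eigenvalues 0, hσ.1.eigenvalues 1,
      (Matrix.mem_unitaryGroup_iff').1 hσ.1.eigenvectorUnitary.2, ?_⟩
    conv_lhs => rw [hσ.1.spectral_theorem]
    rw [Unitary.conjStarAlgAut_apply]
    congr 2
    ext i j
    fin_cases i <;> fin_cases j <;> simp [diagMat]
  have hab : a + b = 1 := by
    rw [Matrix.trace_mul_comm, ← Matrix.mul_assoc, hU, Matrix.one_mul] at h1
    rw [← trace_diagMat, h1, Complex.one_re]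
  rcases le_total b a with h | h
  · refine ⟨U, a - b, hU, sub_nonneg.2 h, ?_⟩
    rw [show (1 + (a - b)) / 2 = a by linarith, show (1 - (a - b)) / 2 = b by linarith]
  · have hX : (!![0, 1; 1, 0] : Matrix (Fin 2) (Fin 2) ℂ)ᴴ = !![0, 1; 1, 0] := by
      ext i j
      fin_cases i <;> fin_cases j <;> simp
    refine ⟨U * !![0, 1; 1, 0], b - a, ?_, sub_nonneg.2 h, ?_⟩
    · rw [Matrix.conjTranspose_mul, Matrix.mul_assoc, ← Matrix.mul_assoc Uᴴ, hU, Matrix.one_mul, hX]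
      ext i j
      fin_cases i <;> fin_cases j <;> simp [Matrix.mul_apply, Fin.sum_univ_two]
    · rw [show (1 + (b - a)) / 2 = b by linarith, show (1 - (b - a)) / 2 = a by linarith,
        Matrix.conjTranspose_mul, hX]
      simp only [← Matrix.mul_assoc]
      congr 1
      simp only [Matrix.mul_assoc]
      congr 1
      ext i j
      fin_cases i <;> fin_cases j <;> simp [diagMat, Matrix.mul_apply, Fin.sum_univ_two]

/-- `X ⊗ Y` maps the vector with coefficient matrix `1` to that with coefficient matrix `X Yᵀ`. -/
theorem bellMeasurement_eq_conj {X Y : Matrix (Fin 2) (Fin 2) ℂ} {b : Fin 4}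
    (h : X * Yᵀ = bellMat b) :
    bellMeasurement b = (X ⊗ₖ Y) * bellMeasurement 0 * (X ⊗ₖ Y)ᴴ := by
  have hr (i j) : star (bellMat b i j) = bellMat b i j := by
    fin_cases b <;> fin_cases i <;> fin_cases j <;> simp [bellMat]
  have hs (i j) : ∑ k, ∑ l, X i k * Y j l * bellMat 0 k l = bellMat b i j := by
    rw [← h]
    simp [bellMat, Matrix.mul_apply, Fin.sum_univ_two]
  ext p q
  have e : ((X ⊗ₖ Y) * bellMeasurement 0 * (X ⊗ₖ Y)ᴴ) p q = 1 / 2 *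
      ((∑ k, ∑ l, X p.1 k * Y p.2 l * bellMat 0 k l) *
        star (∑ k, ∑ l, X q.1 k * Y q.2 l * bellMat 0 k l)) := by
    simp [Matrix.mul_apply, Fintype.sum_prod_type, Fin.sum_univ_two, bellMeasurement_apply,
      bellMat]
    ring
  rw [e, hs, hs, hr, bellMeasurement_apply]

theorem bellMat_mul_conjTranspose (b : Fin 4) : bellMat b * (bellMat b)ᴴ = 1 := by
  ext i j
  fin_cases b <;> fin_cases i <;> fin_cases j <;>
    simp [bellMat, Matrix.mul_apply, Fin.sum_univ_two]

/-- A change of basis of the first qubit can be undone, up to one of the four Pauli operators, by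
one of the second qubit. -/
theorem exists_conj_left {U : Matrix (Fin 2) (Fin 2) ℂ} (hU : Uᴴ * U = 1) (b : Fin 4) :
    ∃ W : Matrix (Fin 2) (Fin 2) ℂ, W * Wᴴ = 1 ∧
      bellMeasurement b = (U ⊗ₖ W) * bellMeasurement 0 * (U ⊗ₖ W)ᴴ := by
  have hU' : U * Uᴴ = 1 := mul_eq_one_comm.1 hU
  refine ⟨(Uᴴ * bellMat b)ᵀ, ?_, bellMeasurement_eq_conj ?_⟩
  · have ht (M : Matrix (Fin 2) (Fin 2) ℂ) : Mᵀᴴ = Mᴴᵀ := rfl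
    rw [mul_eq_one_comm, ht, ← Matrix.transpose_mul,
      Matrix.conjTranspose_mul, Matrix.conjTranspose_conjTranspose, Matrix.mul_assoc,
      ← Matrix.mul_assoc _ _ U, bellMat_mul_conjTranspose,
      Matrix.one_mul, hU, Matrix.transpose_one]
  · rw [Matrix.transpose_transpose, ← Matrix.mul_assoc, hU', Matrix.one_mul]

/-- The same with the two qubits exchanged. -/
theorem exists_conj_right {U : Matrix (Fin 2) (Fin 2) ℂ} (hU : Uᴴ * U = 1) (b : Fin 4) :
    ∃ W : Matrix (Fin 2) (Fin 2) ℂ, W * Wᴴ = 1 ∧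
      bellMeasurement b = (W ⊗ₖ U) * bellMeasurement 0 * (W ⊗ₖ U)ᴴ := by
  have hU' : U * Uᴴ = 1 := mul_eq_one_comm.1 hU
  have hUt : Uᴴᵀ * Uᵀ = 1 := by rw [← Matrix.transpose_mul, hU', Matrix.transpose_one]
  refine ⟨bellMat b * Uᴴᵀ, ?_, bellMeasurement_eq_conj ?_⟩
  · have ht (M : Matrix (Fin 2) (Fin 2) ℂ) : Mᵀᴴ = Mᴴᵀ := rfl
    rw [Matrix.conjTranspose_mul, ← Matrix.mul_assoc, Matrix.mul_assoc (bellMat b), ht,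
      Matrix.conjTranspose_conjTranspose, hUt, Matrix.mul_one, bellMat_mul_conjTranspose]
  · rw [Matrix.mul_assoc, hUt, Matrix.mul_one]

/-- The largest eigenvalue of `Φ⁺ + k Z ⊗ 1` is `1 / 2 + √(1 / 4 + k ^ 2)`; likewise for the second
qubit. -/
theorem posSemidef_sub_bellMeasurement_zero (k : ℝ) :
    ((1 / 2 + √(1 / 4 + k ^ 2)) • (1 : Matrix (Fin 2) (Fin 2) ℂ) ⊗ₖ
      (1 : Matrix (Fin 2) (Fin 2) ℂ) - bellMeasurement 0 - k • diagMat 1 (-1) ⊗ₖ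
        (1 : Matrix (Fin 2) (Fin 2) ℂ)).PosSemidef ∧
    ((1 / 2 + √(1 / 4 + k ^ 2)) • (1 : Matrix (Fin 2) (Fin 2) ℂ) ⊗ₖ
      (1 : Matrix (Fin 2) (Fin 2) ℂ) - bellMeasurement 0 - k •
        (1 : Matrix (Fin 2) (Fin 2) ℂ) ⊗ₖ diagMat 1 (-1)).PosSemidef := by
  set r := √(1 / 4 + k ^ 2) with hr
  have hr0 : 0 ≤ r := Real.sqrt_nonneg _
  have hr2 : r ^ 2 = 1 / 4 + k ^ 2 := Real.sq_sqrt (by positivity)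
  obtain ⟨hk1, hk2⟩ := abs_le_of_sq_le_sq' (a := k) (b := r) (by rw [hr2]; linarith) hr0
  let W : Matrix (Fin 2) (Fin 2 × Fin 2) ℂ := Matrix.of fun i p => if p = (i, i) then 1 else 0
  have h := (posSemidef_two_by_two (r := r) (u := -k) (w := -(1 / 2)) hr0 (by
    rw [hr2]
    linarith)).conjTranspose_mul_mul_same W
  have hd (x y : ℝ) (hx : 0 ≤ x) (hy : 0 ≤ y) :
      (diagMat 1 0 ⊗ₖ diagMat 0 x + diagMat 0 1 ⊗ₖ diagMat y 0).PosSemidef :=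
    ((posSemidef_diagMat zero_le_one le_rfl).kronecker (posSemidef_diagMat le_rfl hx)).add
      ((posSemidef_diagMat le_rfl zero_le_one).kronecker (posSemidef_diagMat hy le_rfl))
  constructor
  · convert h.add (hd (1 / 2 + r - k) (1 / 2 + r + k) (by linarith) (by linarith)) using 1
    ext ⟨i, j⟩ ⟨i', j'⟩
    fin_cases i <;> fin_cases j <;> fin_cases i' <;> fin_cases j' <;>
      simp [W, bellMeasurement_apply, bellMat, diagMat, Matrix.mul_apply, Fin.sum_univ_two] <;>
      ring
  · convert h.add (hd (1 / 2 + r + k) (1 / 2 + r - k) (by linarith) (by linarith)) using 1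
    ext ⟨i, j⟩ ⟨i', j'⟩
    fin_cases i <;> fin_cases j <;> fin_cases i' <;> fin_cases j' <;>
      simp [W, bellMeasurement_apply, bellMat, diagMat, Matrix.mul_apply, Fin.sum_univ_two] <;>
      ring

/-- The filter that maps the spectrum `(1 ± η) / 2` to the maximally mixed one turns `Φ⁺` into an
operator that is at least `s η * Φ⁺ - t η / 4`. -/
theorem posSemidef_filter_sub {η : ℝ} (h0 : 0 ≤ η) (h1 : η < 1) {a b : ℝ}
    (ha : a = √(2 / (1 + η))) (hb : b = √(2 / (1 - η))) :
    ((diagMat a b ⊗ₖ (1 : Matrix (Fin 2) (Fin 2) ℂ)) * bellMeasurement 0 *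
      (diagMat a b ⊗ₖ (1 : Matrix (Fin 2) (Fin 2) ℂ))ᴴ -
      (s η • bellMeasurement 0 - (t η / 4) • (1 : Matrix (Fin 2) (Fin 2) ℂ) ⊗ₖ
        (1 : Matrix (Fin 2) (Fin 2) ℂ))).PosSemidef := by
  have hp : 0 < 1 + η := by linarith
  have hm : 0 < 1 - η := by linarith
  have hq : √(1 - η ^ 2) = √(1 + η) * √(1 - η) := by
    rw [← Real.sqrt_mul hp.le]
    congr 1
    ring
  have hqp : 0 < √(1 - η ^ 2) := by
    rw [hq]
    exact mul_pos (Real.sqrt_pos.2 hp) (Real.sqrt_pos.2 hm)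
  have ha2 : a * a = 2 / (1 + η) := by rw [ha, Real.mul_self_sqrt (by positivity)]
  have hb2 : b * b = 2 / (1 - η) := by rw [hb, Real.mul_self_sqrt (by positivity)]
  have hab : a * b = s η := by
    rw [ha, hb, s, hq, ← Real.sqrt_mul (by positivity), div_mul_div_comm,
      Real.sqrt_div (by norm_num), Real.sqrt_mul hp.le]
    congr 1
    rw [Real.sqrt_mul_self (by norm_num)]
  have ht : 0 ≤ t η / 4 := by
    have : √(1 - η ^ 2) ≤ 1 + η := by
      rw [Real.sqrt_le_left hp.le]
      nlinarith
    have := one_div_le_one_div_of_le hqp this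
    have e : t η / 4 = 1 / √(1 - η ^ 2) - 1 / (1 + η) := by rw [t]; ring
    rw [e]
    linarith
  have hst : s η / 2 - t η / 4 = 1 / (1 + η) := by rw [s, t]; ring
  have hlast : 0 ≤ 1 / (1 - η) - 1 / (1 + η) := by
    have := one_div_le_one_div_of_le hm (by linarith : 1 - η ≤ 1 + η)
    linarith
  have key := ((posSemidef_diagMat zero_le_one le_rfl).kronecker (posSemidef_diagMat le_rfl ht)).add
      ((posSemidef_diagMat le_rfl zero_le_one).kronecker (posSemidef_diagMat ht hlast))
  have ha2' : (a : ℂ) * a = 2 * (s η / 2 - t η / 4) := by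
    rw [← Complex.ofReal_mul, ha2, show 2 / (1 + η) = 2 * (s η / 2 - t η / 4) by rw [hst]; ring]
    push_cast
    ring
  have hb2' : (b : ℂ) * b = 2 * (1 - (η : ℂ))⁻¹ := by
    rw [← Complex.ofReal_mul, hb2]
    push_cast
    ring
  have hst' : (s η : ℂ) / 2 - t η / 4 = (1 + (η : ℂ))⁻¹ := by
    have := congrArg Complex.ofReal hst
    push_cast at this
    rw [this]
    ring
  have hab' : (a : ℂ) * b = s η := by rw [← Complex.ofReal_mul, hab]
  refine (congrArg Matrix.PosSemidef ?_).mpr key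
  ext ⟨i, j⟩ ⟨i', j'⟩
  fin_cases i <;> fin_cases j <;> fin_cases i' <;> fin_cases j' <;>
    simp [bellMeasurement_apply, bellMat, diagMat, Matrix.mul_apply, Fin.sum_univ_two,
      Fintype.sum_prod_type]
  · linear_combination 1 / 2 * ha2'
  · linear_combination 1 / 2 * hab'
  · linear_combination 1 / 2 * hab'
  · linear_combination 1 / 2 * hb2' - hst'

section QualityBound

variable {m n : Type*} [Fintype m] [DecidableEq m] [Fintype n] [DecidableEq n]

theorem posSemidef_marginal {J : Matrix (m × n) (m × n) ℂ} (hJ : J.PosSemidef) :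
    (marginal J).PosSemidef := by
  rw [← choiMap_one]
  exact (isCompletelyPositive_choiMap hJ).posSemidef_apply Matrix.PosSemidef.one

theorem kronecker_conj (U W X Y : Matrix (Fin 2) (Fin 2) ℂ) :
    (U ⊗ₖ W) * (X ⊗ₖ Y) * (U ⊗ₖ W)ᴴ = (U * X * Uᴴ) ⊗ₖ (W * Y * Wᴴ) := by
  rw [Matrix.conjTranspose_kronecker, ← Matrix.mul_kronecker_mul, ← Matrix.mul_kronecker_mul]

theorem sq_add_sq_le_one {q η : ℝ} (hq : 1 / 2 < q)
    (h : ∀ k : ℝ, q + k * η ≤ 1 / 2 + √(1 / 4 + k ^ 2)) : (2 * q - 1) ^ 2 + η ^ 2 ≤ 1 := by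
  set c := 2 * q - 1 with hc
  have hc0 : 0 < c := by linarith
  -- the value of `k` for which the hypothesis is sharpest in the case of equality
  have h1 := h (η / (2 * c))
  have e : c * (c ^ 2 + η ^ 2) / (2 * c) ≤ c * √(1 / 4 + (η / (2 * c)) ^ 2) := by
    have : c / 2 + η / (2 * c) * η ≤ √(1 / 4 + (η / (2 * c)) ^ 2) := by linarith
    refine le_trans (le_of_eq ?_) (mul_le_mul_of_nonneg_left this hc0.le)
    field_simp
  have e2 : c * √(1 / 4 + (η / (2 * c)) ^ 2) = √(c ^ 2 + η ^ 2) / 2 := by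
    have : c ^ 2 + η ^ 2 = (2 * c) ^ 2 * (1 / 4 + (η / (2 * c)) ^ 2) := by
      field_simp
      ring
    rw [this, Real.sqrt_mul (by positivity), Real.sqrt_sq (by positivity)]
    ring
  rw [e2, mul_comm 2 c, mul_div_mul_left _ _ hc0.ne'] at e
  set x := c ^ 2 + η ^ 2
  have hx : 0 < x := by positivity
  have h3 : x ≤ √x := by linarith
  rw [Real.le_sqrt' hx] at h3
  nlinarith

/-- A Bell overlap `q > 1 / 2` bounds the length of the local Bloch vectors. -/
theorem le_etaStar {q η : ℝ} (hq : 1 / 2 < q) (hη : 0 ≤ η)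
    (h : ∀ k : ℝ, q + k * η ≤ 1 / 2 + √(1 / 4 + k ^ 2)) : η ≤ etaStar q ∧ η < 1 := by
  have h1 := sq_add_sq_le_one hq h
  constructor
  · have h2 : (η / 2) ^ 2 ≤ q * (1 - q) := by linarith
    have := Real.le_sqrt_of_sq_le h2
    rw [etaStar]
    linarith
  · have : 0 < (2 * q - 1) ^ 2 := by
      have : 0 < 2 * q - 1 := by linarith
      positivity
    nlinarith

/-- A common bound `c` for the operators `Φ^b + k Z` bounds the total overlap of the Bell states with
an ensemble `N`, given the expectation of `Z` in its average. -/
theorem overlap_add_le {N : Fin 4 → Matrix (Fin 2 × Fin 2) (Fin 2 × Fin 2) ℂ}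
    (hN : ∀ b, (N b).PosSemidef) (htr : (∑ b, N b).trace.re = 1) {c k : ℝ}
    {Z : Matrix (Fin 2 × Fin 2) (Fin 2 × Fin 2) ℂ}
    (hZ : ∀ b, (c • 1 - bellMeasurement b - k • Z).PosSemidef) :
    ∑ b, (bellMeasurement b * N b).trace.re + k * (Z * ∑ b, N b).trace.re ≤ c := by
  have h := Finset.sum_nonneg fun b (_ : b ∈ Finset.univ) => re_trace_mul_nonneg (hZ b) (hN b)
  simp only [Matrix.sub_mul, Matrix.trace_sub, Complex.sub_re, Finset.sum_sub_distrib,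
    Matrix.smul_mul, Matrix.trace_smul, Complex.smul_re, ← Finset.smul_sum, Matrix.one_mul,
    ← Complex.re_sum (f := fun b => (N b).trace), ← Matrix.trace_sum, htr] at h
  rw [← Complex.re_sum (f := fun b => (Z * N b).trace), ← Matrix.trace_sum, ← Matrix.mul_sum] at h
  simp only [smul_eq_mul, mul_one] at h
  linarith

theorem trace_conj_bloch {U : Matrix (Fin 2) (Fin 2) ℂ} (hU : Uᴴ * U = 1) (η : ℝ) :
    (U * diagMat 1 (-1) * Uᴴ * (U * diagMat ((1 + η) / 2) ((1 - η) / 2) * Uᴴ)).trace = η := by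
  have : U * diagMat 1 (-1) * Uᴴ * (U * diagMat ((1 + η) / 2) ((1 - η) / 2) * Uᴴ) =
      U * (diagMat 1 (-1) * ((Uᴴ * U) * diagMat ((1 + η) / 2) ((1 - η) / 2))) * Uᴴ := by
    simp only [Matrix.mul_assoc]
  rw [this, hU, Matrix.trace_mul_comm, ← Matrix.mul_assoc, hU, Matrix.one_mul, Matrix.one_mul,
    diagMat_mul]
  simp [diagMat, Matrix.trace_fin_two]
  ring

/-- **The simulation.** States shared by two qubits with Bob's two systems, for which Bob's
measurement prepares the Bell states with overlap `q`, are turned into a simulation of the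
Bell-state measurement by making their partial traces `1`, as for Choi matrices of unital maps: for
the first state by filtering its qubit, for the second one by rescaling it and adding noise. -/
theorem le_quality_of_extracted {F : Fin 4 → Matrix (m × n) (m × n) ℂ} (hF : IsMeasurement F)
    {J₁ : Matrix (Fin 2 × m) (Fin 2 × m) ℂ} {J₂ : Matrix (Fin 2 × n) (Fin 2 × n) ℂ}
    (hJ₁ : IsState J₁) (hJ₂ : IsState J₂) {q : ℝ}
    (hq : q = ∑ b, (bellMeasurement b * link J₁ J₂ (F b)).trace.re) (hq2 : 1 / 2 < q) :
    ∃ η ∈ Set.Icc 0 (etaStar q),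
      1 / (8 * (1 + etaStar q)) * (4 * s η * q - t η) ≤ quality F bellMeasurement := by
  obtain ⟨U, η, hU, hη, hσ⟩ := exists_spectral (posSemidef_marginal hJ₁.1)
    (by rw [trace_marginal, hJ₁.2])
  obtain ⟨V, θ, hV, hθ, hτ⟩ := exists_spectral (posSemidef_marginal hJ₂.1)
    (by rw [trace_marginal, hJ₂.2])
  have hU' : U * Uᴴ = 1 := mul_eq_one_comm.1 hU
  have hV' : V * Vᴴ = 1 := mul_eq_one_comm.1 hV
  have hN (b : Fin 4) := posSemidef_link hJ₁.1 hJ₂.1 (hF.1 b)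
  have hsum : ∑ b, link J₁ J₂ (F b) = marginal J₁ ⊗ₖ marginal J₂ := by
    rw [← link_sum, hF.2, link_one]
  have htr : (∑ b, link J₁ J₂ (F b)).trace = 1 := by
    rw [hsum, Matrix.trace_kronecker, trace_marginal, trace_marginal, hJ₁.2, hJ₂.2, one_mul]
  have htr' : (∑ b, link J₁ J₂ (F b)).trace.re = 1 := by rw [htr, Complex.one_re]
  obtain ⟨hηq, hη1⟩ := le_etaStar hq2 hη fun k => by
    have h := overlap_add_le hN htr' (c := 1 / 2 + √(1 / 4 + k ^ 2)) (k := k)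
      (Z := (U * diagMat 1 (-1) * Uᴴ) ⊗ₖ 1) fun b => by
        obtain ⟨W, hW, hb⟩ := exists_conj_left hU b
        have := (posSemidef_sub_bellMeasurement_zero k).1.mul_mul_conjTranspose_same (U ⊗ₖ W)
        rw [Matrix.mul_sub, Matrix.mul_sub, Matrix.sub_mul, Matrix.sub_mul, ← hb, Matrix.mul_smul,
          Matrix.smul_mul, kronecker_conj, Matrix.mul_smul, Matrix.smul_mul, kronecker_conj,
          Matrix.mul_one, Matrix.mul_one, hU', hW, Matrix.one_kronecker_one] at this
        exact this
    rw [hsum, ← Matrix.mul_kronecker_mul, Matrix.trace_kronecker, Matrix.one_mul, trace_marginal J₂,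
      hJ₂.2, mul_one, hσ, trace_conj_bloch hU, Complex.ofReal_re, ← hq] at h
    exact h
  obtain ⟨hθq, hθ1⟩ := le_etaStar hq2 hθ fun k => by
    have h := overlap_add_le hN htr' (c := 1 / 2 + √(1 / 4 + k ^ 2)) (k := k)
      (Z := 1 ⊗ₖ (V * diagMat 1 (-1) * Vᴴ)) fun b => by
        obtain ⟨W, hW, hb⟩ := exists_conj_right hV b
        have := (posSemidef_sub_bellMeasurement_zero k).2.mul_mul_conjTranspose_same (W ⊗ₖ V)
        rw [Matrix.mul_sub, Matrix.mul_sub, Matrix.sub_mul, Matrix.sub_mul, ← hb, Matrix.mul_smul,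
          Matrix.smul_mul, kronecker_conj, Matrix.mul_smul, Matrix.smul_mul, kronecker_conj,
          Matrix.mul_one, Matrix.mul_one, hV', hW, Matrix.one_kronecker_one] at this
        exact this
    rw [hsum, ← Matrix.mul_kronecker_mul, Matrix.trace_kronecker, Matrix.one_mul, trace_marginal J₁,
      hJ₁.2, one_mul, hτ, trace_conj_bloch hV, Complex.ofReal_re, ← hq] at h
    exact h
  have hp : 0 < 1 + η := by linarith
  have hm : 0 < 1 - η := by linarith
  have hp' : 0 < 1 + θ := by linarith
  refine ⟨η, ⟨hη, hηq⟩, ?_⟩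
  -- the filter `R` is the inverse square root of the marginal
  set a := √(2 / (1 + η)) with ha
  set b' := √(2 / (1 - η)) with hb
  set R := U * diagMat a b' * Uᴴ with hR
  have hRH : Rᴴ = R := by
    rw [hR, Matrix.conjTranspose_mul, Matrix.conjTranspose_mul, Matrix.conjTranspose_conjTranspose,
      conjTranspose_diagMat, Matrix.mul_assoc]
  have hRR : R * marginal J₁ * Rᴴ = 1 := by
    have e : R * marginal J₁ * Rᴴ = U * (diagMat a b' * ((Uᴴ * U) *
        (diagMat ((1 + η) / 2) ((1 - η) / 2) * ((Uᴴ * U) * diagMat a b')))) * Uᴴ := by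
      rw [hRH, hσ, hR]
      simp only [Matrix.mul_assoc]
    have ea : a * ((1 + η) / 2 * a) = 1 := by
      rw [mul_left_comm, Real.mul_self_sqrt (by positivity)]
      field_simp
    have eb : b' * ((1 - η) / 2 * b') = 1 := by
      rw [mul_left_comm, Real.mul_self_sqrt (by positivity)]
      field_simp
    rw [e, hU, Matrix.one_mul, Matrix.one_mul, diagMat_mul, diagMat_mul, ea, eb, diagMat_one,
      Matrix.mul_one, hU']
  set K₁ := (R ⊗ₖ (1 : Matrix m m ℂ)) * J₁ * (R ⊗ₖ (1 : Matrix m m ℂ))ᴴ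
  set c := 2 / (1 + θ) with hc
  have hc0 : 0 < c := by positivity
  have hcPSD : (1 - c • marginal J₂).PosSemidef := by
    have e : 1 - c • marginal J₂ = V * diagMat 0 (1 - c * ((1 - θ) / 2)) * Vᴴ := by
      have hd : diagMat 0 (1 - c * ((1 - θ) / 2)) =
          1 - c • diagMat ((1 + θ) / 2) ((1 - θ) / 2) := by
        have h1 : c * ((1 + θ) / 2) = 1 := by
          rw [hc]
          field_simp
        have h1' : (c : ℂ) * ((1 + θ) / 2) = 1 := by
          have := congrArg Complex.ofReal h1
          push_cast at this
          exact this
        ext i j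
        fin_cases i <;> fin_cases j <;> simp [diagMat, h1']
      rw [hτ, hd, Matrix.mul_sub, Matrix.sub_mul, Matrix.mul_one, hV', Matrix.mul_smul,
        Matrix.smul_mul]
    rw [e]
    refine (posSemidef_diagMat le_rfl ?_).mul_mul_conjTranspose_same V
    rw [hc, div_mul_div_comm, mul_comm 2, mul_div_mul_right _ _ two_ne_zero, sub_nonneg,
      div_le_one hp']
    linarith
  have hn : Nonempty n := by
    by_contra h
    rw [not_nonempty_iff] at h
    have := hJ₂.2
    simp [Matrix.trace] at this
  have hd : (0 : ℝ) < Fintype.card n := by exact_mod_cast Fintype.card_pos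
  set noise := (1 - c • marginal J₂) ⊗ₖ ((1 / (Fintype.card n : ℝ)) • (1 : Matrix n n ℂ))
    with hnoise
  have hnoisePSD : noise.PosSemidef :=
    hcPSD.kronecker (Matrix.PosSemidef.one.smul (by positivity))
  have hK₁ : K₁.PosSemidef := hJ₁.1.mul_mul_conjTranspose_same _
  have hK₂ : (c • J₂ + noise).PosSemidef := (hJ₂.1.smul hc0.le).add hnoisePSD
  have hmK₁ : marginal K₁ = 1 := by rw [marginal_conj, hRR]
  have hmK₂ : marginal (c • J₂ + noise) = 1 := by
    have hd' : (Fintype.card n : ℂ) ≠ 0 := by exact_mod_cast hd.ne'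
    ext i j
    simp only [marginal_apply, hnoise, Matrix.add_apply, Matrix.smul_apply, Matrix.sub_apply,
      Matrix.kroneckerMap_apply, Matrix.one_apply_eq, Finset.sum_add_distrib, Finset.sum_const,
      Finset.card_univ, Complex.real_smul, nsmul_eq_mul, ← Finset.mul_sum]
    push_cast
    field_simp
    ring
  have hQ := le_quality F bellMeasurement hK₁ hK₂ hmK₁ hmK₂
  -- the noise contributes a nonnegative amount, which is dropped
  have hterm (b : Fin 4) : c * (s η * (bellMeasurement b * link J₁ J₂ (F b)).trace.re -
      t η / 4 * (link J₁ J₂ (F b)).trace.re) ≤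
      hsInner (link K₁ (c • J₂ + noise) (F b)) (bellMeasurement b) := by
    rw [hsInner_eq_of_isHermitian (posSemidef_link hK₁ hK₂ (hF.1 b)).1, link_add_right, link_smul_right,
      Matrix.mul_add, Matrix.trace_add, Complex.add_re, Matrix.mul_smul, Matrix.trace_smul,
      Complex.smul_re, smul_eq_mul]
    have h1 := re_trace_mul_nonneg (posSemidef_bellMeasurement b)
      (posSemidef_link hK₁ hnoisePSD (hF.1 b))
    have h2 : link K₁ J₂ (F b) = (R ⊗ₖ (1 : Matrix (Fin 2) (Fin 2) ℂ)) * link J₁ J₂ (F b) *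
        (R ⊗ₖ (1 : Matrix (Fin 2) (Fin 2) ℂ))ᴴ := by
      rw [← link_conj, Matrix.one_kronecker_one, Matrix.one_mul, Matrix.conjTranspose_one,
        Matrix.mul_one]
    have h3 := posSemidef_filter_sub hη hη1 ha hb
    obtain ⟨W, hW, hW2⟩ := exists_conj_left hU b
    have h4 := h3.mul_mul_conjTranspose_same (U ⊗ₖ W)
    have h5 : (U ⊗ₖ W) * (diagMat a b' ⊗ₖ (1 : Matrix (Fin 2) (Fin 2) ℂ)) =
        (R ⊗ₖ (1 : Matrix (Fin 2) (Fin 2) ℂ)) * (U ⊗ₖ W) := by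
      rw [← Matrix.mul_kronecker_mul, ← Matrix.mul_kronecker_mul, Matrix.mul_one, Matrix.one_mul,
        hR, Matrix.mul_assoc _ Uᴴ U, hU, Matrix.mul_one]
    have h6 : (U ⊗ₖ W) * ((diagMat a b' ⊗ₖ (1 : Matrix (Fin 2) (Fin 2) ℂ)) * bellMeasurement 0 *
        (diagMat a b' ⊗ₖ (1 : Matrix (Fin 2) (Fin 2) ℂ))ᴴ) * (U ⊗ₖ W)ᴴ =
        (R ⊗ₖ (1 : Matrix (Fin 2) (Fin 2) ℂ)) * bellMeasurement b *
          (R ⊗ₖ (1 : Matrix (Fin 2) (Fin 2) ℂ))ᴴ := by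
      rw [Matrix.mul_assoc _ _ (U ⊗ₖ W)ᴴ, Matrix.mul_assoc _ _ (U ⊗ₖ W)ᴴ,
        ← Matrix.conjTranspose_mul, h5, ← Matrix.mul_assoc, ← Matrix.mul_assoc, h5, hW2,
        Matrix.conjTranspose_mul]
      simp only [Matrix.mul_assoc]
    have hRR' : (R ⊗ₖ (1 : Matrix (Fin 2) (Fin 2) ℂ))ᴴ = R ⊗ₖ (1 : Matrix (Fin 2) (Fin 2) ℂ) := by
      rw [Matrix.conjTranspose_kronecker, hRH, Matrix.conjTranspose_one]
    rw [Matrix.mul_sub, Matrix.sub_mul, h6, Matrix.mul_sub, Matrix.sub_mul, Matrix.mul_smul,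
      Matrix.smul_mul, ← hW2, Matrix.mul_smul, Matrix.smul_mul, kronecker_conj, Matrix.mul_one,
      Matrix.mul_one, hU', hW, Matrix.one_kronecker_one] at h4
    have h7 := re_trace_mul_le h4 (hN b)
    rw [Matrix.sub_mul, Matrix.trace_sub, Matrix.smul_mul, Matrix.trace_smul, Matrix.smul_mul,
      Matrix.trace_smul, Complex.sub_re, Complex.smul_re, Complex.smul_re, Matrix.one_mul]
      at h7
    have h8 : ((R ⊗ₖ (1 : Matrix (Fin 2) (Fin 2) ℂ)) * bellMeasurement b *
        (R ⊗ₖ (1 : Matrix (Fin 2) (Fin 2) ℂ))ᴴ * link J₁ J₂ (F b)).trace =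
        (bellMeasurement b * link K₁ J₂ (F b)).trace := by
      rw [h2, hRR', Matrix.mul_assoc, Matrix.mul_assoc, Matrix.trace_mul_comm]
      simp only [Matrix.mul_assoc]
    rw [h8, smul_eq_mul, smul_eq_mul] at h7
    exact le_add_of_le_of_nonneg (mul_le_mul_of_nonneg_left h7 hc0.le) h1
  have hsumterm := Finset.sum_le_sum fun b (_ : b ∈ Finset.univ) => hterm b
  rw [← Finset.mul_sum, Finset.sum_sub_distrib, ← Finset.mul_sum, ← Finset.mul_sum, ← hq,
    ← Complex.re_sum, ← Matrix.trace_sum, htr'] at hsumterm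
  rw [Fintype.card_fin] at hQ
  refine le_trans ?_ hQ
  refine le_trans ?_ (mul_le_mul_of_nonneg_left hsumterm (by norm_num))
  have hpos : 0 ≤ 4 * s η * q - t η := by
    have e : 4 * s η * q - t η = 4 * (2 * q - 1) / √(1 - η ^ 2) + 4 / (1 + η) := by
      rw [s, t]
      ring
    have : 0 < 2 * q - 1 := by linarith
    rw [e]
    positivity
  have e : 1 / ((2 : ℕ) * (2 : ℕ) : ℝ) * (c * (s η * q - t η / 4 * 1)) =
      1 / (8 * (1 + θ)) * (4 * s η * q - t η) := by
    rw [hc]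
    field_simp
    ring
  rw [e]
  refine mul_le_mul_of_nonneg_right ?_ hpos
  exact one_div_le_one_div_of_le (by positivity) (by linarith)

end QualityBound

/-! ### The entanglement swapping scenario -/

section Scenario

variable {A B₁ B₂ C : Type*} [Fintype A] [DecidableEq A] [Fintype B₁]
    [DecidableEq B₁] [Fintype B₂] [DecidableEq B₂] [Fintype C] [DecidableEq C]

/-- Kraus operators on the first system map states to states. -/
theorem isState_kraus {n k ι : Type*} [Fintype n] [DecidableEq n] [Fintype k] [DecidableEq k]
    [Fintype ι] {J : Matrix (n × k) (n × k) ℂ} (hJ : IsState J) {L : ι → Matrix (Fin 2) n ℂ}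
    (hL : ∑ κ, (L κ)ᴴ * L κ = 1) :
    IsState (∑ κ, (L κ ⊗ₖ (1 : Matrix k k ℂ)) * J * (L κ ⊗ₖ (1 : Matrix k k ℂ))ᴴ) := by
  refine ⟨Matrix.posSemidef_sum _ fun κ _ => hJ.1.mul_mul_conjTranspose_same _, ?_⟩
  have h (κ) : ((L κ ⊗ₖ (1 : Matrix k k ℂ)) * J * (L κ ⊗ₖ (1 : Matrix k k ℂ))ᴴ).trace =
      ((((L κ)ᴴ * L κ) ⊗ₖ (1 : Matrix k k ℂ)) * J).trace := by
    rw [Matrix.trace_mul_comm, ← Matrix.mul_assoc, Matrix.conjTranspose_kronecker,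
      ← Matrix.mul_kronecker_mul, Matrix.conjTranspose_one, Matrix.mul_one]
  have hs : ∑ κ, ((L κ)ᴴ * L κ) ⊗ₖ (1 : Matrix k k ℂ) = 1 := by
    rw [← Matrix.one_kronecker_one, ← hL]
    ext p q
    simp only [Matrix.sum_apply, Matrix.kroneckerMap_apply, Finset.sum_mul]
  simp only [Matrix.trace_sum, h]
  rw [← Matrix.trace_sum, ← Matrix.sum_mul, hs, Matrix.one_mul, hJ.2]

theorem g_eq (β : ℝ) : g β = slope * β + intercept := by
  have hr : √2 ^ 2 = 2 := Real.sq_sqrt (by norm_num)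
  have h : 2 * √2 - xStar = (20 * √2 - 16) / 17 := by
    rw [xStar]
    ring
  have h0 : 0 < 20 * √2 - 16 := by linarith [sqrt_two_bounds.1]
  rw [g, slope, intercept, h, xStar]
  field_simp
  grind

namespace SwapScenario

variable (S : SwapScenario A B₁ B₂ C)

/-- Alice's observable for the setting `x`, transposed. Together with the observable of Charlie and
the two states it is transposed because the link of two Choi matrices describes the transpose of
the prepared state. -/
def obsA (x : Fin 2) : Matrix A A ℂ := (S.alice x 0 - S.alice x 1)ᵀ

/-- Charlie's observable for the setting `z`, transposed. -/
def obsC (z : Fin 2) : Matrix C C ℂ := (S.charlie z 0 - S.charlie z 1)ᵀ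

/-- The transposed state of Alice and Bob, as a Choi matrix. -/
def choiA : Matrix (A × B₁) (A × B₁) ℂ := S.stateABᵀ

/-- The transposed state of Charlie and Bob, as a Choi matrix. -/
def choiC : Matrix (C × B₂) (C × B₂) ℂ := S.stateBCᵀ.submatrix Prod.swap Prod.swap

/-- The subnormalized state that Bob's outcome `b` prepares, transposed. -/
def prepared (b : Fin 4) : Matrix (A × C) (A × C) ℂ := link S.choiA S.choiC (S.bob b)

theorem traceBob_eq (b : Fin 4) :
    traceBob (bobOp (S.bob b) * (S.stateAB ⊗ₖ S.stateBC)) = (S.prepared b)ᵀ := by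
  ext p q
  simp only [traceBob, bobOp, prepared, link_apply, choiA, choiC, Matrix.transpose_apply,
    Matrix.of_apply, Matrix.mul_apply, Fintype.sum_prod_type, Matrix.kroneckerMap_apply,
    Matrix.submatrix_apply, Matrix.one_apply, ite_mul, mul_ite, one_mul, mul_one, zero_mul,
    mul_zero]
  refine Finset.sum_congr rfl fun b₁ _ => Finset.sum_congr rfl fun b₂ _ => ?_
  rw [Finset.sum_eq_single p.1 (fun a _ h => by simp [h.symm]) (by simp)]
  simp [Prod.swap]

theorem isContraction_obs {n : Type*} [Fintype n] [DecidableEq n] {F : Fin 2 → Matrix n n ℂ}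
    (hF : IsMeasurement F) : (1 - (F 0 - F 1)ᵀ).PosSemidef ∧ (1 + (F 0 - F 1)ᵀ).PosSemidef := by
  have h1 : F 0 + F 1 = 1 := by rw [← hF.2, Fin.sum_univ_two]
  have e1 : 1 - (F 0 - F 1)ᵀ = ((2 : ℝ) • F 1)ᵀ := by
    rw [← Matrix.transpose_one, ← h1, ← Matrix.transpose_sub, two_smul]
    congr 1
    abel
  have e2 : 1 + (F 0 - F 1)ᵀ = ((2 : ℝ) • F 0)ᵀ := by
    rw [← Matrix.transpose_one, ← h1, ← Matrix.transpose_add, two_smul]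
    congr 1
    abel
  rw [e1, e2]
  exact ⟨((hF.1 1).smul zero_le_two).transpose, ((hF.1 0).smul zero_le_two).transpose⟩

theorem isState_choiA : IsState S.choiA :=
  ⟨S.isState_stateAB.1.transpose, by rw [choiA, Matrix.trace_transpose, S.isState_stateAB.2]⟩

theorem isState_choiC : IsState S.choiC := by
  refine ⟨S.isState_stateBC.1.transpose.submatrix _, ?_⟩
  rw [← S.isState_stateBC.2]
  simp only [choiC, Matrix.trace, Matrix.diag_apply, Matrix.submatrix_apply, Matrix.transpose_apply]
  exact Equiv.sum_comp (Equiv.prodComm C B₂) fun p => S.stateBC p p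

theorem posSemidef_prepared (b : Fin 4) : (S.prepared b).PosSemidef :=
  posSemidef_link S.isState_choiA.1 S.isState_choiC.1 (S.isMeasurement_bob.1 b)

theorem prob_eq (b : Fin 4) : S.prob b = (S.prepared b).trace.re := by
  rw [← Matrix.trace_transpose, ← traceBob_eq, prob]
  congr 1
  simp only [Matrix.trace, Matrix.diag_apply, traceBob, Matrix.of_apply, Fintype.sum_prod_type]
  refine Finset.sum_congr rfl fun a _ => ?_
  simp_rw [Finset.sum_comm (γ := C)]

/-- For `p_b = 0`, when the conditional state is a junk value, the prepared operator is positive with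
trace `0`, hence `0`. -/
theorem prob_mul_condState (b : Fin 4) :
    (S.prob b : ℂ) • S.condState b = (S.prepared b)ᵀ := by
  rw [condState, smul_smul, traceBob_eq]
  by_cases h : S.prob b = 0
  · have h0 : S.prepared b = 0 := by
      ext i j
      have := norm_apply_le_trace (S.posSemidef_prepared b) i j
      rw [← prob_eq, h] at this
      exact norm_le_zero_iff.1 this
    rw [h0, Matrix.transpose_zero, smul_zero]
  · rw [mul_inv_cancel₀ (by exact_mod_cast h), one_smul]

theorem prob_mul_corr (b : Fin 4) (x z : Fin 2) :
    S.prob b * S.corr b x z = ((S.obsA x ⊗ₖ S.obsC z) * S.prepared b).trace.re := by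
  have key (X : Matrix A A ℂ) (Y : Matrix C C ℂ) :
      S.prob b * ((X ⊗ₖ Y) * S.condState b).trace.re =
        ((Xᵀ ⊗ₖ Yᵀ) * S.prepared b).trace.re := by
    have e : (Xᵀ ⊗ₖ Yᵀ) * S.prepared b = ((S.prepared b)ᵀ * (X ⊗ₖ Y))ᵀ := by
      rw [Matrix.transpose_mul, Matrix.transpose_transpose, Matrix.kroneckerMap_transpose]
    rw [e, Matrix.trace_transpose, Matrix.trace_mul_comm, ← prob_mul_condState, Matrix.smul_mul,
      Matrix.trace_smul, smul_eq_mul, Complex.re_ofReal_mul]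
  have hk : S.obsA x ⊗ₖ S.obsC z = (S.alice x 0)ᵀ ⊗ₖ (S.charlie z 0)ᵀ -
      (S.alice x 0)ᵀ ⊗ₖ (S.charlie z 1)ᵀ - (S.alice x 1)ᵀ ⊗ₖ (S.charlie z 0)ᵀ +
      (S.alice x 1)ᵀ ⊗ₖ (S.charlie z 1)ᵀ := by
    ext p q
    simp [obsA, obsC]
    ring
  rw [hk]
  simp only [Matrix.add_mul, Matrix.sub_mul, Matrix.trace_add, Matrix.trace_sub, Complex.add_re,
    Complex.sub_re, ← key, corr, condProb, Fin.sum_univ_two]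
  simp
  ring

theorem prob_mul_chsh (b : Fin 4) : S.prob b * S.chsh b =
    ((signZ b • S.obsA 0 ⊗ₖ (S.obsC 0 + S.obsC 1) + signX b • S.obsA 1 ⊗ₖ (S.obsC 0 - S.obsC 1)) *
      S.prepared b).trace.re := by
  simp only [Matrix.kronecker_add, kronecker_sub, Matrix.add_mul, Matrix.smul_mul, Matrix.sub_mul,
    Matrix.trace_add, Matrix.trace_smul, Matrix.trace_sub, Complex.add_re, Complex.smul_re,
    Complex.sub_re, ← prob_mul_corr, smul_eq_mul]
  fin_cases b <;> simp [chsh, signZ, signX] <;> ring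

/-- Swapped and extracted, the qubits of Alice and Charlie are in the Bell states with average
overlap at least `g β_ave`. -/
theorem exists_extracted : ∃ (J₁ : Matrix (Fin 2 × B₁) (Fin 2 × B₁) ℂ)
    (J₂ : Matrix (Fin 2 × B₂) (Fin 2 × B₂) ℂ), IsState J₁ ∧ IsState J₂ ∧
      g S.avgCHSH ≤ ∑ b, (bellMeasurement b * link J₁ J₂ (S.bob b)).trace.re := by
  obtain ⟨L, L', hL, hL', h⟩ := exists_extraction (isContraction_obs (S.isMeasurement_alice 0))
    (isContraction_obs (S.isMeasurement_alice 1)) (isContraction_obs (S.isMeasurement_charlie 0))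
    (isContraction_obs (S.isMeasurement_charlie 1))
  refine ⟨_, _, isState_kraus S.isState_choiA hL, isState_kraus S.isState_choiC hL', ?_⟩
  simp only [link_sum_sum, link_conj]
  have hb (b : Fin 4) : slope * (S.prob b * S.chsh b) + intercept * (S.prepared b).trace.re ≤
      (bellMeasurement b * ∑ κ, ∑ l, (L κ ⊗ₖ L' l) * S.prepared b * (L κ ⊗ₖ L' l)ᴴ).trace.re := by
    have h1 := re_trace_mul_nonneg (h b) (S.posSemidef_prepared b)
    have e : (bellMeasurement b *
        ∑ κ, ∑ l, (L κ ⊗ₖ L' l) * S.prepared b * (L κ ⊗ₖ L' l)ᴴ).trace =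
        ((∑ κ, ∑ l, (L κ ⊗ₖ L' l)ᴴ * bellMeasurement b * (L κ ⊗ₖ L' l)) * S.prepared b).trace := by
      simp only [Matrix.mul_sum, Matrix.sum_mul, Matrix.trace_sum]
      refine Finset.sum_congr rfl fun κ _ => Finset.sum_congr rfl fun l _ => ?_
      rw [← Matrix.mul_assoc, Matrix.trace_mul_comm]
      simp only [Matrix.mul_assoc]
    rw [Matrix.sub_mul, Matrix.sub_mul, Matrix.trace_sub, Matrix.trace_sub, Matrix.smul_mul,
      Matrix.trace_smul, Matrix.smul_mul, Matrix.trace_smul, Complex.sub_re, Complex.sub_re,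
      Complex.smul_re, Complex.smul_re, Matrix.one_mul, ← e, smul_eq_mul, smul_eq_mul] at h1
    rw [prob_mul_chsh]
    simp only [obsA, obsC]
    linarith
  have htr : ∑ b, (S.prepared b).trace.re = 1 := by
    have : ∑ b, S.prepared b = marginal S.choiA ⊗ₖ marginal S.choiC := by
      simp only [prepared]
      rw [← link_sum, S.isMeasurement_bob.2, link_one]
    rw [← Complex.re_sum, ← Matrix.trace_sum, this, Matrix.trace_kronecker, trace_marginal,
      trace_marginal, S.isState_choiA.2, S.isState_choiC.2, one_mul, Complex.one_re]
  have hsum := Finset.sum_le_sum fun b (_ : b ∈ Finset.univ) => hb b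
  rw [Finset.sum_add_distrib, ← Finset.mul_sum, ← Finset.mul_sum, htr, mul_one] at hsum
  rw [g_eq]
  exact hsum

end SwapScenario

end Scenario

/-! ### The explicit bound and its threshold -/

/-- A quarter of the function minimized in the bound, in terms of `c = 2 q - 1`. -/
def profile (c η : ℝ) : ℝ := c / √(1 - η ^ 2) + 1 / (1 + η)

theorem bound_eq_profile (q η : ℝ) : 4 * s η * q - t η = 4 * profile (2 * q - 1) η := by
  rw [s, t, profile]
  ring

theorem etaStar_eq (q : ℝ) : etaStar q = √(1 - (2 * q - 1) ^ 2) := by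
  rw [etaStar, show 1 - (2 * q - 1) ^ 2 = 2 ^ 2 * (q * (1 - q)) by ring,
    Real.sqrt_mul (x := 2 ^ 2) (by norm_num), Real.sqrt_sq (by norm_num)]

theorem boundValues_eq (q : ℝ) : boundValues q =
    (fun η => 4 * profile (2 * q - 1) η) '' Set.Icc 0 √(1 - (2 * q - 1) ^ 2) := by
  rw [boundValues, etaStar_eq]
  simp only [bound_eq_profile]

theorem profile_mono {c c' : ℝ} (h : c ≤ c') (η : ℝ) : profile c η ≤ profile c' η := by
  rw [profile, profile]
  gcongr

theorem profile_nonneg {c η : ℝ} (hc : 0 ≤ c) (hη : 0 ≤ η) : 0 ≤ profile c η := by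
  rw [profile]
  positivity

theorem sqrt_one_sub_sq_anti {c c' : ℝ} (hc : 0 ≤ c) (h : c ≤ c') :
    √(1 - c' ^ 2) ≤ √(1 - c ^ 2) := by
  gcongr

/-- The minimum is attained: for `q ≠ 1 / 2` because `η* < 1`, and for `q = 1 / 2` because the term
that is singular at `η = 1` has the coefficient `0`. -/
theorem isLeast_boundValues (q : ℝ) : IsLeast (boundValues q) (sInf (boundValues q)) := by
  refine IsCompact.isLeast_sInf ?_ ⟨_, Set.mem_image_of_mem _ ⟨le_rfl, by
    rw [etaStar]
    positivity⟩⟩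
  rw [boundValues_eq]
  refine isCompact_Icc.image_of_continuousOn (continuousOn_const.mul ?_)
  refine ContinuousOn.add ?_ (ContinuousOn.div continuousOn_const (by fun_prop) fun η hη => by
    have := hη.1
    positivity)
  rcases eq_or_ne (2 * q - 1) 0 with h | h
  · simp only [h, zero_div]
    exact continuousOn_const
  · refine ContinuousOn.div continuousOn_const (by fun_prop) fun η hη => ?_
    have h1 : 0 < (2 * q - 1) ^ 2 := by positivity
    have h2 : √(1 - (2 * q - 1) ^ 2) < 1 := by
      rw [Real.sqrt_lt' one_pos]
      linarith
    have h3 := hη.1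
    have h4 := hη.2.trans_lt h2
    refine (Real.sqrt_pos.2 ?_).ne'
    nlinarith

/-- The value at `η = 0` suffices for this estimate. -/
theorem robustBound_le_quarter {β : ℝ} (h : g β ≤ 1 / 2) : robustBound β ≤ 1 / 4 := by
  have hmem : 4 * profile (2 * g β - 1) 0 ∈ boundValues (g β) := by
    rw [boundValues_eq]
    exact Set.mem_image_of_mem _ ⟨le_rfl, Real.sqrt_nonneg _⟩
  have h1 := (isLeast_boundValues (g β)).2 hmem
  have e : profile (2 * g β - 1) 0 = 2 * g β := by
    rw [profile]
    norm_num
  rw [e] at h1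
  have he : 0 ≤ etaStar (g β) := by
    rw [etaStar]
    positivity
  have he2 : 2 * g β ≤ 1 + etaStar (g β) := by linarith
  rw [robustBound, div_mul_eq_mul_div, one_mul, div_le_iff₀ (by positivity)]
  -- `2 q ≤ η*` for `0 ≤ q ≤ 1 / 2`
  have h3 : 4 * g β ≤ 1 + etaStar (g β) := by
    rcases le_total (g β) 0 with h0 | h0
    · linarith
    · have : g β ≤ √(g β * (1 - g β)) := Real.le_sqrt_of_sq_le (by nlinarith)
      rw [etaStar]
      linarith
  linarith

/-- The bound for `g β` is at most each of the values whose minimum defines the bound for a larger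
`q`. -/
theorem robustBound_le {β q η : ℝ} (h : 1 / 2 < g β) (hq : g β ≤ q)
    (hη : η ∈ Set.Icc 0 (etaStar q)) :
    robustBound β ≤ 1 / (8 * (1 + etaStar q)) * (4 * s η * q - t η) := by
  have h0 : 0 < 2 * g β - 1 := by linarith
  have h1 : etaStar q ≤ etaStar (g β) := by
    rw [etaStar_eq, etaStar_eq]
    exact sqrt_one_sub_sq_anti h0.le (by linarith)
  have h2 : 4 * profile (2 * g β - 1) η ∈ boundValues (g β) := by
    rw [boundValues_eq, ← etaStar_eq]
    exact Set.mem_image_of_mem _ ⟨hη.1, hη.2.trans h1⟩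
  have h3 := (isLeast_boundValues (g β)).2 h2
  have h4 := profile_mono (by linarith : 2 * g β - 1 ≤ 2 * q - 1) η
  have h5 := profile_nonneg (c := 2 * q - 1) (by linarith) hη.1
  have h6 : 0 ≤ etaStar q := by
    rw [etaStar]
    positivity
  rw [robustBound, bound_eq_profile]
  calc 1 / (8 * (1 + etaStar (g β))) * sInf (boundValues (g β)) ≤
      1 / (8 * (1 + etaStar (g β))) * (4 * profile (2 * q - 1) η) := by
        refine mul_le_mul_of_nonneg_left (by linarith) ?_
        have : 0 ≤ etaStar (g β) := h6.trans h1
        positivity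
    _ ≤ _ := by
        refine mul_le_mul_of_nonneg_right ?_ (by positivity)
        exact one_div_le_one_div_of_le (by positivity) (by linarith)

/-- The values `c = 2 q - 1` for which the bound is at most `1 / 2`. -/
def lowValues : Set ℝ :=
  {c | ∃ η ∈ Set.Icc 0 √(1 - c ^ 2), profile c η ≤ 1 + √(1 - c ^ 2)}

theorem lowValues_anti {c c' : ℝ} (hc : 0 ≤ c) (h : c ≤ c') (h' : c' ∈ lowValues) :
    c ∈ lowValues := by
  obtain ⟨η, hη, hp⟩ := h'
  have h1 := sqrt_one_sub_sq_anti hc h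
  exact ⟨η, ⟨hη.1, hη.2.trans h1⟩, (profile_mono h η).trans (hp.trans (by linarith))⟩

theorem half_lt_robustBound_iff {β : ℝ} :
    1 / 2 < robustBound β ↔ 2 * g β - 1 ∉ lowValues := by
  have he : 0 ≤ √(1 - (2 * g β - 1) ^ 2) := Real.sqrt_nonneg _
  obtain ⟨h1, h2⟩ := isLeast_boundValues (g β)
  have e : 1 / 2 < robustBound β ↔
      4 * (1 + √(1 - (2 * g β - 1) ^ 2)) < sInf (boundValues (g β)) := by
    rw [robustBound, etaStar_eq, div_mul_eq_mul_div, one_mul, lt_div_iff₀ (by positivity)]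
    constructor <;> intro h <;> linarith
  rw [e]
  constructor
  · rintro h ⟨η, hη, hp⟩
    have : 4 * profile (2 * g β - 1) η ∈ boundValues (g β) := by
      rw [boundValues_eq]
      exact Set.mem_image_of_mem _ hη
    have := h2 this
    linarith
  · intro h
    by_contra! hle
    rw [boundValues_eq] at h1
    obtain ⟨η, hη, hp⟩ := h1
    rw [← boundValues_eq] at hp
    exact h ⟨η, hη, by simp only at hp; linarith⟩

theorem mem_lowValues : (0.8057 : ℝ) ∈ lowValues := by
  have h1 : (0.5923 : ℝ) ≤ √(1 - 0.8057 ^ 2) := Real.le_sqrt_of_sq_le (by norm_num)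
  have h2 : (0.8994 : ℝ) ≤ √(1 - 0.437 ^ 2) := Real.le_sqrt_of_sq_le (by norm_num)
  refine ⟨0.437, ⟨by norm_num, by linarith⟩, ?_⟩
  have h3 : (0.8057 : ℝ) / √(1 - 0.437 ^ 2) ≤ 0.8057 / 0.8994 := by gcongr
  rw [profile]
  norm_num at h1 h3 ⊢
  linarith

/-- A tangent line bound for `y ↦ 1 / √y`. -/
theorem le_inv_sqrt {y w : ℝ} (hy : 0 < y) (hw : 0 < w) :
    3 * w / 2 - w ^ 3 * y / 2 ≤ 1 / √y := by
  have hu : 0 < √y := Real.sqrt_pos.2 hy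
  have hy2 : y = √y ^ 2 := (Real.sq_sqrt hy.le).symm
  rw [le_div_iff₀ hu]
  nth_rewrite 1 [hy2]
  have : 0 ≤ (1 - w * √y) ^ 2 * (2 + w * √y) := by positivity
  linarith

theorem not_mem_lowValues : (0.807 : ℝ) ∉ lowValues := by
  rintro ⟨η, hη, hp⟩
  have h0 := hη.1
  have h1 : √(1 - 0.807 ^ 2) ≤ (0.59056 : ℝ) := Real.sqrt_le_iff.2 (by norm_num)
  have h2 : η ≤ 0.59056 := hη.2.trans h1
  -- tangents near the minimizer `η ≈ 0.437`
  have h3 := le_inv_sqrt (y := 1 - η ^ 2) (w := 1.1117) (by nlinarith) (by norm_num)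
  have h4 : 2 * 0.696 - 0.696 ^ 2 * (1 + η) ≤ 1 / (1 + η) := by
    rw [le_div_iff₀ (by positivity)]
    nlinarith [sq_nonneg (1 - 0.696 * (1 + η))]
  rw [profile, ← mul_one_div] at hp
  nlinarith [sq_nonneg (η - 0.4369)]

/-- The positive low values are those up to a threshold `c₀`, the largest one in a short interval that
contains the transition. -/
theorem exists_threshold : ∃ c₀ : ℝ, 0.8057 ≤ c₀ ∧ c₀ < 0.807 ∧
    ∀ c, 0 < c → (c ∉ lowValues ↔ c₀ < c) := by
  let K : Set (ℝ × ℝ) := {x | x ∈ Set.Icc (0.8057 : ℝ) 0.807 ×ˢ Set.Icc (0 : ℝ) 0.6 ∧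
    x.2 ≤ √(1 - x.1 ^ 2) ∧ profile x.1 x.2 ≤ 1 + √(1 - x.1 ^ 2)}
  have hK : IsCompact K := by
    have hc : IsCompact (Set.Icc (0.8057 : ℝ) 0.807 ×ˢ Set.Icc (0 : ℝ) 0.6) :=
      isCompact_Icc.prod isCompact_Icc
    have h1 : IsClosed {x ∈ Set.Icc (0.8057 : ℝ) 0.807 ×ˢ Set.Icc (0 : ℝ) 0.6 |
        x.2 ≤ √(1 - x.1 ^ 2)} := hc.isClosed.isClosed_le (by fun_prop) (by fun_prop)
    have hcl : IsClosed K := by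
      have h2 : K = {x ∈ {x ∈ Set.Icc (0.8057 : ℝ) 0.807 ×ˢ Set.Icc (0 : ℝ) 0.6 |
          x.2 ≤ √(1 - x.1 ^ 2)} | profile x.1 x.2 ≤ 1 + √(1 - x.1 ^ 2)} := by
        ext x
        exact (and_assoc).symm
      rw [h2]
      refine h1.isClosed_le (ContinuousOn.add (ContinuousOn.div (by fun_prop) (by fun_prop) ?_)
        (ContinuousOn.div continuousOn_const (by fun_prop) ?_)) (by fun_prop)
      · rintro ⟨c, η⟩ ⟨⟨-, hη⟩, -⟩
        refine (Real.sqrt_pos.2 ?_).ne'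
        have h3 := hη.1
        have h4 := hη.2
        simp only at h3 h4 ⊢
        nlinarith
      · rintro ⟨c, η⟩ ⟨⟨-, hη⟩, -⟩
        have h3 := hη.1
        simp only at h3 ⊢
        positivity
    exact hc.of_isClosed_subset hcl fun x hx => hx.1
  have hbound {c η : ℝ} (h : 0.8057 ≤ c) (hη : η ≤ √(1 - c ^ 2)) : η ≤ 0.6 := by
    refine hη.trans ((sqrt_one_sub_sq_anti (by norm_num) h).trans ?_)
    exact Real.sqrt_le_iff.2 (by norm_num)
  have hmem (c : ℝ) : c ∈ Prod.fst '' K ↔ c ∈ Set.Icc (0.8057 : ℝ) 0.807 ∧ c ∈ lowValues := by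
    constructor
    · rintro ⟨⟨c, η⟩, ⟨⟨h1, h2⟩, h3, h4⟩, rfl⟩
      exact ⟨h1, η, ⟨h2.1, h3⟩, h4⟩
    · rintro ⟨h1, η, h2, h3⟩
      exact ⟨(c, η), ⟨⟨h1, h2.1, hbound h1.1 h2.2⟩, h2.2, h3⟩, rfl⟩
  obtain ⟨c₀, hc₀, hmax⟩ := (hK.image continuous_fst).exists_isGreatest
    ⟨0.8057, (hmem _).2 ⟨⟨le_rfl, by norm_num⟩, mem_lowValues⟩⟩
  obtain ⟨hI, hlow⟩ := (hmem c₀).1 hc₀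
  refine ⟨c₀, hI.1, lt_of_le_of_ne hI.2 ?_, fun c hc => ⟨fun h => ?_, fun h h' => ?_⟩⟩
  · rintro rfl
    exact not_mem_lowValues hlow
  · by_contra! hle
    exact h (lowValues_anti hc.le hle hlow)
  · have hle : c ≤ 0.807 := by
      by_contra! hlt
      exact not_mem_lowValues (lowValues_anti (by norm_num) hlt.le h')
    have := hmax ((hmem c).2 ⟨⟨hI.1.trans h.le, hle⟩, h'⟩)
    linarith

/-! ### The robust self-test -/

section SelfTest

variable {m n : Type*} [Fintype m] [DecidableEq m] [Fintype n] [DecidableEq n]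

/-- The Choi matrix of the map that sends `X` to `(Tr X / dim) • 1`. -/
def mixedChoi (k : Type*) [Fintype k] [DecidableEq k] : Matrix (Fin 2 × k) (Fin 2 × k) ℂ :=
  (1 : Matrix (Fin 2) (Fin 2) ℂ) ⊗ₖ ((1 / (Fintype.card k : ℝ)) • (1 : Matrix k k ℂ))

theorem posSemidef_mixedChoi (k : Type*) [Fintype k] [DecidableEq k] :
    (mixedChoi k).PosSemidef :=
  Matrix.PosSemidef.one.kronecker (Matrix.PosSemidef.one.smul (by positivity))

theorem marginal_mixedChoi (k : Type*) [Fintype k] [DecidableEq k] [Nonempty k] :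
    marginal (mixedChoi k) = 1 := by
  have hd : (Fintype.card k : ℂ) ≠ 0 := by exact_mod_cast Fintype.card_ne_zero
  ext i j
  have e (x : k) : mixedChoi k (i, x) (j, x) =
      (1 : Matrix (Fin 2) (Fin 2) ℂ) i j * (1 / Fintype.card k) := by
    simp [mixedChoi]
  rw [marginal_apply, Finset.sum_congr rfl fun x _ => e x, Finset.sum_const, Finset.card_univ,
    nsmul_eq_mul]
  field_simp

theorem nonempty_simulationValues [Nonempty m] [Nonempty n] {d : ℕ}
    (F : Fin d → Matrix (m × n) (m × n) ℂ)
    (P : Fin d → Matrix (Fin 2 × Fin 2) (Fin 2 × Fin 2) ℂ) : (simulationValues F P).Nonempty :=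
  ⟨_, choiMap (mixedChoi m), choiMap (mixedChoi n),
    isCPU_choiMap (posSemidef_mixedChoi m) (marginal_mixedChoi m),
    isCPU_choiMap (posSemidef_mixedChoi n) (marginal_mixedChoi n), rfl⟩

theorem link_mixedChoi (F : Matrix (m × n) (m × n) ℂ) :
    link (mixedChoi m) (mixedChoi n) F =
      (F.trace / (Fintype.card m * Fintype.card n)) •
        (1 : Matrix (Fin 2 × Fin 2) (Fin 2 × Fin 2) ℂ) := by
  have e (p q : Fin 2 × Fin 2) (i j : m × n) :
      F i j * (mixedChoi m (p.1, i.1) (q.1, j.1) * mixedChoi n (p.2, i.2) (q.2, j.2)) =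
        (1 : Matrix (m × n) (m × n) ℂ) i j * F i j / (Fintype.card m * Fintype.card n) *
          (1 : Matrix (Fin 2 × Fin 2) (Fin 2 × Fin 2) ℂ) p q := by
    rw [← Matrix.one_kronecker_one (m := m), ← Matrix.one_kronecker_one (m := Fin 2)]
    simp only [mixedChoi, Matrix.smul_apply, Matrix.kroneckerMap_apply, Complex.real_smul]
    push_cast
    ring
  ext p q
  simp only [link_apply, e, ← Finset.sum_mul, ← Finset.sum_div, Matrix.one_apply, ite_mul, one_mul,
    zero_mul, Finset.sum_ite_eq, Finset.mem_univ, if_true, Matrix.smul_apply, smul_eq_mul,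
    Matrix.trace, Matrix.diag_apply]

/-- The quality achieved by discarding the measured systems. -/
theorem quarter_le_quality [Nonempty m] [Nonempty n] {F : Fin 4 → Matrix (m × n) (m × n) ℂ}
    (hF : IsMeasurement F) : 1 / 4 ≤ quality F bellMeasurement := by
  have h := le_quality F bellMeasurement (posSemidef_mixedChoi m) (posSemidef_mixedChoi n)
    (marginal_mixedChoi m) (marginal_mixedChoi n)
  have e (b : Fin 4) : hsInner (link (mixedChoi m) (mixedChoi n) (F b)) (bellMeasurement b) =
      (F b).trace.re / (Fintype.card m * Fintype.card n) := by
    rw [hsInner_eq_of_isHermitian (posSemidef_link (posSemidef_mixedChoi m) (posSemidef_mixedChoi n)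
      (hF.1 b)).1, link_mixedChoi, Matrix.mul_smul, Matrix.trace_smul, Matrix.mul_one,
      trace_bellMeasurement, smul_eq_mul, mul_one, ← Nat.cast_mul, Complex.div_natCast_re,
      Nat.cast_mul]
  have hd : (Fintype.card m * Fintype.card n : ℝ) ≠ 0 := by
    exact_mod_cast mul_ne_zero Fintype.card_ne_zero Fintype.card_ne_zero
  simp only [e, ← Finset.sum_div, ← Complex.re_sum, ← Matrix.trace_sum, hF.2, Matrix.trace_one,
    Fintype.card_prod, Nat.cast_mul, Fintype.card_fin] at h
  norm_num at h
  exact h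

end SelfTest

variable {A B₁ B₂ C : Type*} [Fintype A] [DecidableEq A] [Fintype B₁]
    [DecidableEq B₁] [Fintype B₂] [DecidableEq B₂] [Fintype C] [DecidableEq C]

theorem SwapScenario.nonempty_bob (S : SwapScenario A B₁ B₂ C) : Nonempty B₁ ∧ Nonempty B₂ := by
  constructor
  · by_contra h
    rw [not_nonempty_iff] at h
    have := S.isState_stateAB.2
    simp [Matrix.trace] at this
  · by_contra h
    rw [not_nonempty_iff] at h
    have := S.isState_stateBC.2
    simp [Matrix.trace] at this

theorem SwapScenario.isGreatest_quality (S : SwapScenario A B₁ B₂ C) :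
    IsGreatest (simulationValues S.bob bellMeasurement) (quality S.bob bellMeasurement) := by
  obtain ⟨h1, h2⟩ := S.nonempty_bob
  exact EntSwap.isGreatest_quality (nonempty_simulationValues _ _)

theorem SwapScenario.robustBound_le_quality (S : SwapScenario A B₁ B₂ C) :
    robustBound S.avgCHSH ≤ quality S.bob bellMeasurement := by
  rcases le_or_gt (g S.avgCHSH) (1 / 2) with h | h
  · obtain ⟨h1, h2⟩ := S.nonempty_bob
    exact (robustBound_le_quarter h).trans (quarter_le_quality S.isMeasurement_bob)
  · obtain ⟨J₁, J₂, hJ₁, hJ₂, hq⟩ := S.exists_extracted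
    obtain ⟨η, hη, hle⟩ :=
      le_quality_of_extracted S.isMeasurement_bob hJ₁ hJ₂ rfl (h.trans_le hq)
    exact (robustBound_le h hq hη).trans hle

theorem exists_not_isSeparableOp {m n : Type*} [Fintype m] [DecidableEq m] [Fintype n]
    [DecidableEq n] {F : Fin 4 → Matrix (m × n) (m × n) ℂ} (hF : IsMeasurement F)
    (h : IsGreatest (simulationValues F bellMeasurement) (quality F bellMeasurement))
    (hQ : 1 / 2 < quality F bellMeasurement) : ∃ b, ¬ IsSeparableOp (F b) := by
  by_contra! hs
  exact hQ.not_ge (isGreatest_separableValues.2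
    (simulationValues_subset_separableValues hF hs bellMeasurement h.1))

theorem exists_robustBound_threshold : ∃ β₀ : ℝ, 2.688 < β₀ ∧ β₀ < 2.689 ∧
    ∀ β, 1 / 2 < robustBound β ↔ β₀ < β := by
  obtain ⟨c₀, h1, h2, hc⟩ := exists_threshold
  obtain ⟨r1, r2⟩ := sqrt_two_bounds
  have hs : 0 < slope := by rw [slope]; positivity
  refine ⟨((1 + c₀) / 2 - intercept) / slope, ?_, ?_, fun β => ?_⟩
  · rw [lt_div_iff₀ hs, slope, intercept]
    linarith
  · rw [div_lt_iff₀ hs, slope, intercept]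
    linarith
  · rw [div_lt_iff₀ hs, mul_comm β]
    rcases le_or_gt (g β) (1 / 2) with h | h
    · have := robustBound_le_quarter h
      rw [g_eq] at h
      constructor <;> intro h' <;> linarith
    · rw [half_lt_robustBound_iff, hc _ (by linarith), g_eq]
      constructor <;> intro h' <;> linarith

end EntSwap

end

theorem theorem2 :
    -- the robust self-test, for every entanglement swapping scenario
    (∀ (A B₁ B₂ C : Type*) [Fintype A] [DecidableEq A] [Fintype B₁] [DecidableEq B₁]
        [Fintype B₂] [DecidableEq B₂] [Fintype C] [DecidableEq C]
        (S : EntSwap.SwapScenario A B₁ B₂ C),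
      -- the minimum in the bound and the maximum in the quality are attained
      IsLeast (EntSwap.boundValues (EntSwap.g S.avgCHSH))
        (sInf (EntSwap.boundValues (EntSwap.g S.avgCHSH))) ∧
      IsGreatest (EntSwap.simulationValues S.bob EntSwap.bellMeasurement)
        (EntSwap.quality S.bob EntSwap.bellMeasurement) ∧
      EntSwap.robustBound S.avgCHSH ≤ EntSwap.quality S.bob EntSwap.bellMeasurement) ∧
    -- the separable threshold of the Bell-state measurement is `1 / 2`
    IsGreatest (EntSwap.separableValues EntSwap.bellMeasurement) (1 / 2) ∧
    -- the bound exceeds the threshold exactly above `β₀`, about 5 percent below the maximum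
    (∃ β₀ : ℝ, 2.688 < β₀ ∧ β₀ < 2.689 ∧
      0.049 < 1 - β₀ / (2 * √2) ∧ 1 - β₀ / (2 * √2) < 0.05 ∧
      (∀ β ∈ Set.Icc (2 : ℝ) (2 * √2), 1 / 2 < EntSwap.robustBound β ↔ β₀ < β) ∧
      -- and then the quality does, and Bob's measurement is entangled
      ∀ (A B₁ B₂ C : Type*) [Fintype A] [DecidableEq A] [Fintype B₁] [DecidableEq B₁]
        [Fintype B₂] [DecidableEq B₂] [Fintype C] [DecidableEq C]
        (S : EntSwap.SwapScenario A B₁ B₂ C),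
        β₀ < S.avgCHSH →
          1 / 2 < EntSwap.quality S.bob EntSwap.bellMeasurement ∧
            ∃ b, ¬ EntSwap.IsSeparableOp (S.bob b)) := by
  obtain ⟨β₀, h1, h2, hβ₀⟩ := EntSwap.exists_robustBound_threshold
  obtain ⟨r1, r2⟩ := EntSwap.sqrt_two_bounds
  refine ⟨fun A B₁ B₂ C _ _ _ _ _ _ _ _ S => ⟨EntSwap.isLeast_boundValues _,
    S.isGreatest_quality, S.robustBound_le_quality⟩, EntSwap.isGreatest_separableValues,
    β₀, h1, h2, ?_, ?_, fun β _ => hβ₀ β, fun A B₁ B₂ C _ _ _ _ _ _ _ _ S h => ?_⟩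
  · rw [lt_sub_comm, div_lt_iff₀ (by positivity)]
    linarith
  · rw [sub_lt_comm, lt_div_iff₀ (by positivity)]
    linarith
  · have hQ := ((hβ₀ _).2 h).trans_le S.robustBound_le_quality
    exact ⟨hQ, EntSwap.exists_not_isSeparableOp S.isMeasurement_bob S.isGreatest_quality hQ⟩
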